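/- For graphs $G,H$ let $r(G,H)$ be the least $N$ such that every red-blue colouring of the edges of the complete graph $K_N$ contains a red copy of $G$ or a blue copy of $H$. Let $C_n$ be the cycle of length $n$, and let $W_n = C_n * K_1$ be the wheel with $n$ rim vertices, i.e. the cycle $C_n$ together with one further vertex joined to all vertices of the cycle. Write $\delta(G)$ for the minimum degree of a graph $G$ and $c(G)$ for its circumference, the length of its longest cycle. Given real numbers $\alpha \in [\tfrac14, 1)$ and $\beta > 0$, call $(\alpha,\beta)$ an admissible pair if every finite 2-connected non-bipartite graph $G$ on $n$ vertices with $\delta(G) \ge \alpha n + \beta$ contains the cycle $C_t$ for every $t$ with $6 \le t \le c(G)$. Theorem. Let $(\alpha,\beta)$ be an admissible pair and let $2 < k < j$ be integers. Then $$ r(C_{2k+1}, W_{2j}) \le \frac{3j+\beta}{1-\alpha}. $$ -/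

import Mathlib

open scoped SimpleGraph

/-- The wheel `W_n = C_n * K_1`: a rim cycle on `n` vertices and one hub that is joined to all of
them. -/
def wheelGraph (n : ℕ) : SimpleGraph (Fin n ⊕ Unit) :=
  (SimpleGraph.cycleGraph n ⊕g (⊥ : SimpleGraph Unit)) ⊔ completeBipartiteGraph (Fin n) Unit

/-- Every red-blue colouring of the edges of the complete graph `K_N` contains a red copy of `G`
or a blue copy of `H`. A colouring is given by its graph `R` of red edges, and the graph of
blue edges is then the complement `Rᶜ`. -/
def RamseyArrows {V W : Type*} (N : ℕ) (G : SimpleGraph V) (H : SimpleGraph W) : Prop :=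
  ∀ R : SimpleGraph (Fin N), G ⊑ R ∨ H ⊑ Rᶜ

/-- The Ramsey number `r(G, H)`: the least `N` such that every red-blue colouring of the edges of
`K_N` contains a red copy of `G` or a blue copy of `H`. -/
noncomputable def ramseyNumber {V W : Type*} (G : SimpleGraph V) (H : SimpleGraph W) : ℕ :=
  sInf {N : ℕ | RamseyArrows N G H}

/-- A finite graph is 2-connected if it has more than two vertices, is connected, and remains
connected when any one vertex is deleted. -/
def IsTwoConnected {V : Type*} [Fintype V] (G : SimpleGraph V) : Prop :=
  2 < Fintype.card V ∧ G.Connected ∧ ∀ v : V, (G.induce ({v}ᶜ : Set V)).Connected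

/-- The circumference `c(G)` of a finite graph: the length of a longest cycle (and `0` for a graph
without cycles). -/
noncomputable def circumference {V : Type*} [Fintype V] (G : SimpleGraph V) : ℕ :=
  sSup {t : ℕ | 3 ≤ t ∧ SimpleGraph.cycleGraph t ⊑ G}

/-- `(α, β)`, with `1/4 ≤ α < 1` and `β > 0`, is an admissible pair if every 2-connected
non-bipartite graph on `n` vertices with minimum degree at least `α n + β` contains every cycle
`C_t` with `6 ≤ t ≤ c(G)`. -/
def IsAdmissiblePair (α β : ℝ) : Prop :=
  1 / 4 ≤ α ∧ α < 1 ∧ 0 < β ∧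
    ∀ (n : ℕ) (G : SimpleGraph (Fin n)) [DecidableRel G.Adj],
      IsTwoConnected G → ¬ G.IsBipartite → α * (n : ℝ) + β ≤ (G.minDegree : ℝ) →
        ∀ t : ℕ, 6 ≤ t → t ≤ circumference G → SimpleGraph.cycleGraph t ⊑ G

/-!
Let `N = ⌊(3j + β) / (1 - α)⌋` and suppose that a colouring of `K_N` has neither a red `C_{2k+1}`
nor a blue `W_{2j}`. The red graph `R` is shown to satisfy the hypotheses of an admissible pair and
to have a cycle of length at least `2k + 1`, so that it contains `C_{2k+1}` after all.

A preliminary point is that `4j + 1 ≤ N`. The 13-vertex graph `ringGraph` is 2-connected,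
non-bipartite and Hamiltonian, has minimum degree 4 and contains no `C_6`; so every admissible pair
satisfies `13α + β > 4` (`IsAdmissiblePair.four_lt`), which suffices because `α ≥ 1/4` and `j > 3`.

**Large blue degree.** Suppose that a vertex `v` has a set `A` of `3j - 1` blue neighbours. There is
no blue `C_{2j}` in `A`, as it would form a wheel with hub `v`. The main lemma
(`isTwoCliques_of_no_cycles`) says that `A` is then a union of two blue cliques. Up to one vertex all
edges between them are red, and a red complete bipartite graph forces every further vertex to be
blue to one whole side, since it would close a red `C_{2k+1}` otherwise. Counting the vertices joined
to each side gives a wheel (`exists_wheel_of_large_degree`).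

**The main lemma** goes by induction on `j`. It rests on one observation about a cycle that cannot be
enlarged by two vertices (section `Attach`): the neighbourhoods on the cycle of two outside vertices
cannot cross twice, and hardly any outside vertex is adjacent to two consecutive vertices of the
cycle. Hence any two outside vertices have about half of the cycle as common non-neighbours, that is,
as common neighbours in the other colour, and cycles of the other colour can be threaded through the
outside and the cycle alternately. Applied to a red `C_{2j-1}` that cannot be enlarged to `C_{2j+1}`
this yields a blue `C_{2j}` (`hasCycleOn_of_odd_cycleMap`); applied to a blue `C_{2j}` that cannot be
enlarged to `C_{2j+2}` it yields first a large blue clique outside, and then two blue cliques with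
red edges between them (`isTwoCliques_of_cycleMap`), to which the remaining vertices are added in
`isTwoCliques_of_core`. If there is no blue `C_{2j}` at all, the induction hypothesis provides the
two cliques in a smaller set.

**Small blue degree.** Otherwise `R` has minimum degree at least `N - 3j + 1 ≥ αN + β`. If `R` is
bipartite, one of its classes is a blue clique with `2j + 1` vertices. If two large disjoint sets have
only blue edges between them, then one of them contains a vertex of large blue degree, which is the
hub of a wheel, or else the red graph on it has minimum degree above half and is pancyclic by
`hasCycleOn_of_degree` (Dirac's and Bondy's arguments). This excludes cut vertices of `R`
(`isTwoConnected_of_no_wheel`). It also yields a red cycle of length at least `2k + 1`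
(`exists_long_cycle`): without one, the predecessors of the neighbours of the first vertex of a
longest red path are starting vertices of longest paths too, and so have red neighbours only among
the first `2k` vertices of the path.
-/

/-! ### Paths and cycles as lists of vertices -/

section PathLists

variable {V : Type*} {G : SimpleGraph V} {a b c d : V} {l m : List V}

/-- `l` lists, in order and without repetition, the vertices of a path of `G` from `a` to `b`. -/
structure IsPathList (G : SimpleGraph V) (a b : V) (l : List V) : Prop where
  nodup : l.Nodup
  chain : l.IsChain G.Adj
  head : l.head? = some a
  last : l.getLast? = some b

theorem IsPathList.singleton (G : SimpleGraph V) (a : V) : IsPathList G a a [a] :=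
  ⟨by simp, by simp, rfl, rfl⟩

theorem IsPathList.head_mem (h : IsPathList G a b l) : a ∈ l := List.mem_of_mem_head? h.head

theorem IsPathList.last_mem (h : IsPathList G a b l) : b ∈ l := List.mem_of_getLast? h.last

theorem IsPathList.append (hl : IsPathList G a b l) (hm : IsPathList G c d m)
    (hbc : G.Adj b c) (hlm : ∀ x ∈ l, x ∉ m) : IsPathList G a d (l ++ m) := by
  refine ⟨?_, ?_, ?_, ?_⟩
  · exact List.nodup_append'.2 ⟨hl.nodup, hm.nodup, fun x h1 h2 => hlm x h1 h2⟩
  · refine List.isChain_append.2 ⟨hl.chain, hm.chain, ?_⟩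
    intro x hx y hy
    rw [hl.last] at hx
    rw [hm.head] at hy
    cases hx
    cases hy
    exact hbc
  · simp [List.head?_append, hl.head]
  · simp [List.getLast?_append, hm.last]

theorem IsPathList.reverse (hl : IsPathList G a b l) : IsPathList G b a l.reverse := by
  refine ⟨List.nodup_reverse.2 hl.nodup, ?_, ?_, ?_⟩
  · rw [List.isChain_reverse]
    exact hl.chain.imp fun _ _ h => h.symm
  · simp [hl.last]
  · simp [hl.head]

theorem IsPathList.cons (hl : IsPathList G a b l) (hc : G.Adj c a) (hcl : c ∉ l) :
    IsPathList G c b (c :: l) :=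
  (IsPathList.singleton G c).append hl hc (by simpa using hcl)

theorem IsPathList.snoc (hl : IsPathList G a b l) (hc : G.Adj b c) (hcl : c ∉ l) :
    IsPathList G a c (l ++ [c]) :=
  hl.append (IsPathList.singleton G c) hc (by rintro x hx h; simp at h; exact hcl (h ▸ hx))

/-- `G` has a cycle with `n` vertices, all of them in `A`. (For `n ≤ 2` this is a degenerate
notion; it is only meant for `3 ≤ n`.) -/
def HasCycleOn (G : SimpleGraph V) (A : Set V) (n : ℕ) : Prop :=
  ∃ a b l, IsPathList G a b l ∧ G.Adj b a ∧ l.length = n ∧ ∀ x ∈ l, x ∈ A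

theorem HasCycleOn.mono {A A' : Set V} {n : ℕ} (h : HasCycleOn G A n) (hA : A ⊆ A') :
    HasCycleOn G A' n := by
  obtain ⟨a, b, l, h1, h2, h3, h4⟩ := h
  exact ⟨a, b, l, h1, h2, h3, fun x hx => hA (h4 x hx)⟩

theorem hasCycleOn_of_two_paths {A : Set V} {n : ℕ} (hl : IsPathList G a b l)
    (hm : IsPathList G c d m) (hbc : G.Adj b c) (hda : G.Adj d a) (hlm : ∀ x ∈ l, x ∉ m)
    (hn : l.length + m.length = n) (hlA : ∀ x ∈ l, x ∈ A) (hmA : ∀ x ∈ m, x ∈ A) :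
    HasCycleOn G A n :=
  ⟨a, d, l ++ m, hl.append hm hbc hlm, hda, by simpa using hn, by
    intro x hx
    rcases List.mem_append.1 hx with h | h
    exacts [hlA x h, hmA x h]⟩

/-- A cycle as a cyclically indexed family of vertices. -/
theorem HasCycleOn.exists_zmod {A : Set V} {n : ℕ} (hn : 2 ≤ n) (h : HasCycleOn G A n) :
    ∃ f : ZMod n → V, Function.Injective f ∧ (∀ i, G.Adj (f i) (f (i + 1))) ∧ ∀ i, f i ∈ A := by
  obtain ⟨a, b, l, hl, hba, hlen, hA⟩ := h
  have : NeZero n := ⟨by omega⟩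
  have hlt (i : ZMod n) : i.val < l.length := hlen ▸ ZMod.val_lt i
  refine ⟨fun i => l[i.val]'(hlt i), ?_, ?_, fun i => hA _ (List.getElem_mem _)⟩
  · intro i j hij
    exact ZMod.val_injective n ((hl.nodup.getElem_inj_iff).1 hij)
  · intro i
    have hv : (i + 1).val = (i.val + 1) % n := by
      have : Fact (1 < n) := ⟨by omega⟩
      rw [ZMod.val_add, ZMod.val_one]
    by_cases hi : i.val + 1 < n
    · have : (i + 1).val = i.val + 1 := by rw [hv, Nat.mod_eq_of_lt hi]
      simp only [this]
      exact List.isChain_iff_getElem.1 hl.chain i.val (by omega)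
    · have h1 : i.val + 1 = n := by have := ZMod.val_lt i; omega
      have h0 : (i + 1).val = 0 := by rw [hv, h1, Nat.mod_self]
      simp only [h0]
      have e1 : l[i.val]'(hlt i) = b := by
        have := hl.last
        rw [List.getLast?_eq_getElem?, List.getElem?_eq_some_iff] at this
        obtain ⟨h2, h3⟩ := this
        have h4 : i.val = l.length - 1 := by omega
        simp only [h4, h3]
      have e2 : l[0]'(by omega) = a := by
        have := hl.head
        rw [List.head?_eq_getElem?, List.getElem?_eq_some_iff] at this
        obtain ⟨h2, h3⟩ := this
        exact h3
      rw [e1, e2]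
      exact hba

theorem cycleGraph_isContained_of_zmod {n : ℕ} (f : ZMod n → V)
    (hf : Function.Injective f) (hadj : ∀ i, G.Adj (f i) (f (i + 1))) (hn : 2 ≤ n) :
    SimpleGraph.cycleGraph n ⊑ G := by
  match n, hn with
  | n + 2, _ =>
    refine ⟨⟨⟨fun i : Fin (n + 2) => f i, ?_⟩, hf⟩⟩
    intro i j hij
    rcases SimpleGraph.cycleGraph_adj.1 hij with h | h
    · have e : i = j + 1 := by rw [← h]; abel
      rw [e]
      exact (hadj j).symm
    · have e : j = i + 1 := by rw [← h]; abel
      rw [e]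
      exact hadj i

theorem HasCycleOn.isContained {A : Set V} {n : ℕ} (hn : 2 ≤ n) (h : HasCycleOn G A n) :
    SimpleGraph.cycleGraph n ⊑ G := by
  obtain ⟨f, hf, hadj, -⟩ := h.exists_zmod hn
  exact cycleGraph_isContained_of_zmod f hf hadj hn

section Arc

variable {L : ℕ} {f : ZMod L → V}

/-- The list of the `p + 1` vertices of the cycle `f` from `f a` to `f (a + p)`. -/
def arc (f : ZMod L → V) (a : ZMod L) (p : ℕ) : List V :=
  (List.range (p + 1)).map fun i => f (a + (i : ℕ))

theorem length_arc (a : ZMod L) (p : ℕ) : (arc f a p).length = p + 1 := by simp [arc]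

theorem mem_arc {a : ZMod L} {p : ℕ} {x : V} :
    x ∈ arc f a p ↔ ∃ i ≤ p, f (a + (i : ℕ)) = x := by
  simp [arc]

theorem isPathList_arc [NeZero L] (hf : Function.Injective f) (hadj : ∀ i, G.Adj (f i) (f (i + 1)))
    (a : ZMod L) {p : ℕ} (hp : p < L) : IsPathList G (f a) (f (a + (p : ℕ))) (arc f a p) := by
  induction p with
  | zero => simpa [arc] using IsPathList.singleton G (f a)
  | succ p ih =>
    have e : arc f a (p + 1) = arc f a p ++ [f (a + ((p + 1 : ℕ) : ZMod L))] := by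
      simp [arc, List.range_succ]
    rw [e]
    refine (ih (by omega)).snoc ?_ ?_
    · have := hadj (a + (p : ℕ))
      rwa [add_assoc, ← Nat.cast_succ] at this
    · rw [mem_arc]
      rintro ⟨i, hi, h⟩
      have h1 := add_left_cancel (hf h)
      rw [ZMod.natCast_eq_natCast_iff, Nat.ModEq, Nat.mod_eq_of_lt (by omega),
        Nat.mod_eq_of_lt hp] at h1
      omega

/-- Deleting the edges from `a` to `a + 1` and from `b` to `b + 1` splits a cycle into two paths. -/
theorem exists_split [NeZero L] (hf : Function.Injective f) (hadj : ∀ i, G.Adj (f i) (f (i + 1)))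
    {a b : ZMod L} (hab : a ≠ b) :
    ∃ P Q : List V, IsPathList G (f (a + 1)) (f b) P ∧ IsPathList G (f (b + 1)) (f a) Q ∧
      (∀ x ∈ P, x ∉ Q) ∧ P.length + Q.length = L ∧ P.length = (b - a).val ∧
      (∀ x ∈ P, x ∈ Set.range f) ∧ ∀ x ∈ Q, x ∈ Set.range f := by
  set d := (b - a).val with hd
  have hd0 : 0 < d := by
    rw [hd, Nat.pos_iff_ne_zero, Ne, ZMod.val_eq_zero, sub_eq_zero]
    exact fun h => hab h.symm
  have hdL : d < L := ZMod.val_lt _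
  have hb : b = a + (d : ℕ) := by rw [hd, ZMod.natCast_zmod_val]; abel
  have e1 : a + 1 + ((d - 1 : ℕ) : ZMod L) = b := by
    rw [hb, Nat.cast_sub hd0]; push_cast; ring
  have e2 : b + 1 + ((L - d - 1 : ℕ) : ZMod L) = a := by
    rw [hb, Nat.sub_sub, Nat.cast_sub (by omega)]; push_cast; simp
  have h1 := isPathList_arc hf hadj (a + 1) (p := d - 1) (by omega)
  have h2 := isPathList_arc hf hadj (b + 1) (p := L - d - 1) (by omega)
  rw [e1] at h1
  rw [e2] at h2
  refine ⟨_, _, h1, h2, ?_, ?_, ?_, ?_, ?_⟩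
  · intro x hx hy
    obtain ⟨i, hi, rfl⟩ := mem_arc.1 hx
    obtain ⟨i', hi', h⟩ := mem_arc.1 hy
    have h3 := hf h
    have h4 : ((d + i' : ℕ) : ZMod L) = (i : ℕ) := by
      rw [hb] at h3
      have : a + 1 + ((d + i' : ℕ) : ZMod L) = a + 1 + (i : ℕ) := by
        rw [← h3]; push_cast; ring
      exact add_left_cancel this
    rw [ZMod.natCast_eq_natCast_iff, Nat.ModEq, Nat.mod_eq_of_lt (by omega),
        Nat.mod_eq_of_lt (by omega)] at h4
    omega
  · simp only [length_arc]; omega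
  · simp only [length_arc]; omega
  · intro x hx
    obtain ⟨i, -, rfl⟩ := mem_arc.1 hx
    exact ⟨_, rfl⟩
  · intro x hx
    obtain ⟨i, -, rfl⟩ := mem_arc.1 hx
    exact ⟨_, rfl⟩

end Arc

/-- A clique contains paths of every length between two of its vertices. -/
theorem exists_path_of_clique [DecidableEq V] {X : Finset V}
    (hX : ∀ x ∈ X, ∀ y ∈ X, x ≠ y → G.Adj x y) {x y : V} (hx : x ∈ X) (hy : y ∈ X) (hxy : x ≠ y)
    {m : ℕ} (hm : 2 ≤ m) (hmX : m ≤ X.card) :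
    ∃ l, IsPathList G x y l ∧ l.length = m ∧ ∀ z ∈ l, z ∈ X := by
  have hcard : ((X.erase x).erase y).card = X.card - 2 := by
    rw [Finset.card_erase_of_mem (Finset.mem_erase.2 ⟨hxy.symm, hy⟩), Finset.card_erase_of_mem hx]
    omega
  obtain ⟨T, hT, hTc⟩ := Finset.exists_subset_card_eq (s := (X.erase x).erase y) (n := m - 2)
    (by omega)
  have hTX : ∀ z ∈ T, z ∈ X ∧ z ≠ x ∧ z ≠ y := fun z hz => by
    have := hT hz
    simp only [Finset.mem_erase] at this
    exact ⟨this.2.2, this.2.1, this.1⟩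
  have hmem : ∀ z ∈ x :: (T.toList ++ [y]), z ∈ X := by
    intro z hz
    simp only [List.mem_cons, List.mem_append, Finset.mem_toList, List.not_mem_nil, or_false] at hz
    rcases hz with rfl | hz | rfl
    exacts [hx, (hTX z hz).1, hy]
  have hnd : (x :: (T.toList ++ [y])).Nodup := by
    rw [List.nodup_cons, List.nodup_append']
    refine ⟨?_, T.nodup_toList, by simp, ?_⟩
    · simp only [List.mem_append, Finset.mem_toList, List.mem_singleton, not_or]
      exact ⟨fun h => (hTX x h).2.1 rfl, hxy⟩
    · intro z hz hz'
      simp only [List.mem_singleton] at hz'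
      exact (hTX z (Finset.mem_toList.1 hz)).2.2 hz'
  refine ⟨x :: (T.toList ++ [y]), ⟨hnd, ?_, rfl, by simp [List.getLast?_cons]⟩, ?_, hmem⟩
  · have : (x :: (T.toList ++ [y])).Pairwise G.Adj := by
      refine hnd.imp_of_mem ?_
      intro z w hz hw hzw
      exact hX z (hmem z hz) w (hmem w hw) hzw
    exact this.isChain
  · simp [hTc]; omega

theorem hasCycleOn_of_clique [DecidableEq V] {X : Finset V}
    (hX : ∀ x ∈ X, ∀ y ∈ X, x ≠ y → G.Adj x y) {m : ℕ} (hm : 2 ≤ m) (hmX : m ≤ X.card) :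
    HasCycleOn G X m := by
  obtain ⟨x, hx, y, hy, hxy⟩ := Finset.one_lt_card.1 (show 1 < X.card by omega)
  obtain ⟨l, hl, hlm, hlX⟩ := exists_path_of_clique hX hx hy hxy hm hmX
  exact ⟨x, y, l, hl, hX y hy x hx hxy.symm, hlm, hlX⟩

/-- The connector lemma: if any two vertices of the list `us` have at least `us.length - 1` common
neighbours in `K`, then a path can be threaded through `us` that uses one vertex of `K` between
any two consecutive vertices of `us`. -/
theorem exists_threaded_path [DecidableEq V] [DecidableRel G.Adj] (K : Finset V) (us : List V)
    (hus : us.Nodup) (husK : ∀ x ∈ us, x ∉ K) {a b : V} (ha : us.head? = some a)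
    (hb : us.getLast? = some b)
    (hcard : ∀ x ∈ us, ∀ y ∈ us, x ≠ y →
      us.length - 1 ≤ (K.filter fun q => G.Adj x q ∧ G.Adj q y).card) :
    ∃ l, IsPathList G a b l ∧ l.length = 2 * us.length - 1 ∧
      ∃ S ⊆ K, S.card = us.length - 1 ∧ ∀ v ∈ l, v ∈ us ∨ v ∈ S := by
  induction us generalizing a with
  | nil => simp at ha
  | cons x rest ih =>
    obtain rfl : x = a := by simpa using ha
    match rest with
    | [] =>
      obtain rfl : x = b := by simpa using hb
      exact ⟨[x], .singleton G x, by simp, ∅, by simp, by simp, by simp⟩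
    | y :: rest =>
      have hxy : x ≠ y := by
        rintro rfl
        simp at hus
      obtain ⟨l, hl, hlen, S, hSK, hSc, hlS⟩ := ih (a := y) hus.tail
        (fun z hz => husK z (List.mem_cons_of_mem _ hz)) rfl (by simpa [List.getLast?_cons] using hb)
        (fun z hz w hw hzw => le_trans (by simp)
          (hcard z (List.mem_cons_of_mem _ hz) w (List.mem_cons_of_mem _ hw) hzw))
      have h1 := hcard x (by simp) y (by simp) hxy
      obtain ⟨q, hq, hqS⟩ := Finset.exists_mem_notMem_of_card_lt_card
        (s := S) (t := K.filter fun q => G.Adj x q ∧ G.Adj q y) (by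
          simp only [List.length_cons] at h1 hSc; omega)
      simp only [Finset.mem_filter] at hq
      have hxl : x ∉ l := by
        intro h
        rcases hlS x h with h | h
        · exact (List.nodup_cons.1 hus).1 h
        · exact husK x (by simp) (hSK h)
      have hql : q ∉ l := by
        intro h
        rcases hlS q h with h | h
        · exact husK q (List.mem_cons_of_mem _ h) hq.1
        · exact hqS h
      refine ⟨x :: q :: l, (hl.cons hq.2.2 hql).cons hq.2.1 ?_, ?_, insert q S, ?_, ?_, ?_⟩
      · simp only [List.mem_cons, not_or]
        exact ⟨hq.2.1.ne, hxl⟩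
      · simp only [List.length_cons] at hlen ⊢; omega
      · exact Finset.insert_subset hq.1 hSK
      · rw [Finset.card_insert_of_notMem hqS, hSc]; simp
      · intro v hv
        simp only [List.mem_cons] at hv
        rcases hv with rfl | rfl | hv
        · simp
        · simp
        · rcases hlS v hv with h | h
          · exact Or.inl (List.mem_cons_of_mem _ h)
          · exact Or.inr (Finset.mem_insert_of_mem h)

end PathLists

/-! ### Attaching vertices to a cycle that cannot be enlarged by two -/

section Attach

variable {V : Type*} {G B : SimpleGraph V} {A : Set V} {L : ℕ} [NeZero L]

/-- `f` is a cycle of `G` inside `A`, indexed cyclically. -/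
structure IsCycleMap (G : SimpleGraph V) (A : Set V) (f : ZMod L → V) : Prop where
  inj : Function.Injective f
  adj : ∀ i, G.Adj (f i) (f (i + 1))
  mem : ∀ i, f i ∈ A

open Classical in
/-- The positions on the cycle `f` of the neighbours of `w`. -/
noncomputable def nbrPos (G : SimpleGraph V) (f : ZMod L → V) (w : V) : Finset (ZMod L) :=
  Finset.univ.filter fun i => G.Adj w (f i)

theorem mem_nbrPos {f : ZMod L → V} {w : V} {i : ZMod L} :
    i ∈ nbrPos G f w ↔ G.Adj w (f i) := by simp [nbrPos]

/-- The positions `i ∈ S` whose successor lies in `T`. If `S = T` is the set of neighbours of an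
outside vertex, these are the places where that vertex can be inserted into the cycle. -/
def succIn (S T : Finset (ZMod L)) : Finset (ZMod L) := S.filter fun i => i + 1 ∈ T

omit [NeZero L] in
theorem mem_succIn {S T : Finset (ZMod L)} {i : ZMod L} :
    i ∈ succIn S T ↔ i ∈ S ∧ i + 1 ∈ T := by simp [succIn]

/-- The positions on the cycle `f` at which neither `w` nor `w'` has a neighbour. -/
noncomputable def nonNbrPos (G : SimpleGraph V) (f : ZMod L → V) (w w' : V) : Finset (ZMod L) :=
  (nbrPos G f w ∪ nbrPos G f w')ᶜ

theorem mem_nonNbrPos {f : ZMod L → V} {w w' : V} {i : ZMod L} :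
    i ∈ nonNbrPos G f w w' ↔ ¬ G.Adj w (f i) ∧ ¬ G.Adj w' (f i) := by
  simp [nonNbrPos, mem_nbrPos]

theorem nonNbrPos_comm {f : ZMod L → V} (w w' : V) :
    nonNbrPos G f w w' = nonNbrPos G f w' w := by
  simp [nonNbrPos, Finset.union_comm]

theorem card_nonNbrPos {f : ZMod L → V} (w w' : V) :
    (nonNbrPos G f w w').card + (nbrPos G f w ∪ nbrPos G f w').card = L := by
  rw [nonNbrPos, add_comm, Finset.card_add_card_compl, ZMod.card]

/-- A set of positions that covers more than half of a cycle contains consecutive positions. -/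
theorem two_mul_card_le (U : Finset (ZMod L)) : 2 * U.card ≤ L + (succIn U U).card := by
  have h1 : (U.image fun i => i - 1).card = U.card :=
    Finset.card_image_of_injective _ fun a b h => by simpa using h
  have h2 : U ∩ (U.image fun i => i - 1) = succIn U U := by
    ext i
    simp only [Finset.mem_inter, Finset.mem_image, mem_succIn]
    constructor
    · rintro ⟨h, a, ha, rfl⟩
      exact ⟨h, by simpa using ha⟩
    · rintro ⟨h, h'⟩
      exact ⟨h, i + 1, h', by ring⟩
  have h3 := Finset.card_union_add_card_inter U (U.image fun i => i - 1)
  have h4 : (U ∪ U.image fun i => i - 1).card ≤ L := by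
    simpa [ZMod.card] using Finset.card_le_univ (U ∪ U.image fun i => i - 1)
  rw [h2] at h3
  omega

namespace IsCycleMap

variable {f : ZMod L → V} {w w' : V} (hf : IsCycleMap G A f)
include hf

/-- Two different outside vertices cannot cross: if `w` sees positions `a, b` and `w'` sees
`a + 1, b + 1`, both can be threaded into the cycle. -/
theorem eq_of_mem_succIn (hno : ¬ HasCycleOn G A (L + 2)) (hww : w ≠ w') (hwA : w ∈ A)
    (hwA' : w' ∈ A) (hw : w ∉ Set.range f) (hw' : w' ∉ Set.range f) {a b : ZMod L}
    (ha : a ∈ succIn (nbrPos G f w) (nbrPos G f w'))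
    (hb : b ∈ succIn (nbrPos G f w) (nbrPos G f w')) : a = b := by
  by_contra hab
  obtain ⟨P, Q, hP, hQ, hPQ, hlen, -, hPf, hQf⟩ := exists_split hf.inj hf.adj hab
  simp only [mem_succIn, mem_nbrPos] at ha hb
  have hrA : ∀ x ∈ Set.range f, x ∈ A := by rintro _ ⟨i, rfl⟩; exact hf.mem i
  refine hno (hasCycleOn_of_two_paths (hP.cons ha.2 fun h => hw' (hPf _ h))
    (hQ.reverse.cons ha.1 fun h => hw (hQf _ (List.mem_reverse.1 h))) hb.1.symm hb.2.symm
    ?_ ?_ ?_ ?_)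
  · intro x hx hx'
    simp only [List.mem_cons, List.mem_reverse] at hx hx'
    rcases hx with rfl | hx <;> rcases hx' with rfl | hx'
    exacts [hww rfl, hw' (hQf _ hx'), hw (hPf _ hx), hPQ _ hx hx']
  · simp; omega
  · intro x hx
    rcases List.mem_cons.1 hx with rfl | hx
    exacts [hwA', hrA _ (hPf _ hx)]
  · intro x hx
    rcases List.mem_cons.1 hx with rfl | hx
    exacts [hwA, hrA _ (hQf _ (List.mem_reverse.1 hx))]

/-- Two different outside vertices cannot be inserted between consecutive vertices of the cycle
at two different places. -/
theorem eq_of_mem_gaps (hno : ¬ HasCycleOn G A (L + 2)) (hww : w ≠ w') (hwA : w ∈ A)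
    (hwA' : w' ∈ A) (hw : w ∉ Set.range f) (hw' : w' ∉ Set.range f) {a b : ZMod L}
    (ha : a ∈ succIn (nbrPos G f w) (nbrPos G f w))
    (hb : b ∈ succIn (nbrPos G f w') (nbrPos G f w')) : a = b := by
  by_contra hab
  obtain ⟨P, Q, hP, hQ, hPQ, hlen, -, hPf, hQf⟩ := exists_split hf.inj hf.adj hab
  simp only [mem_succIn, mem_nbrPos] at ha hb
  have hrA : ∀ x ∈ Set.range f, x ∈ A := by rintro _ ⟨i, rfl⟩; exact hf.mem i
  refine hno (hasCycleOn_of_two_paths (hP.cons ha.2 fun h => hw (hPf _ h))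
    (hQ.cons hb.2 fun h => hw' (hQf _ h)) hb.1.symm ha.1.symm ?_ ?_ ?_ ?_)
  · intro x hx hx'
    simp only [List.mem_cons] at hx hx'
    rcases hx with rfl | hx <;> rcases hx' with rfl | hx'
    exacts [hww rfl, hw (hQf _ hx'), hw' (hPf _ hx), hPQ _ hx hx']
  · simp; omega
  · intro x hx
    rcases List.mem_cons.1 hx with rfl | hx
    exacts [hwA, hrA _ (hPf _ hx)]
  · intro x hx
    rcases List.mem_cons.1 hx with rfl | hx
    exacts [hwA', hrA _ (hQf _ hx)]

/-- An outside edge `w w'` cannot be inserted between consecutive vertices of the cycle. -/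
theorem succIn_eq_empty (hno : ¬ HasCycleOn G A (L + 2)) (hadj : G.Adj w w') (hwA : w ∈ A)
    (hwA' : w' ∈ A) (hw : w ∉ Set.range f) (hw' : w' ∉ Set.range f) :
    succIn (nbrPos G f w) (nbrPos G f w') = ∅ := by
  rw [Finset.eq_empty_iff_forall_notMem]
  intro a ha
  simp only [mem_succIn, mem_nbrPos] at ha
  have hL : 0 < L := Nat.pos_of_ne_zero (NeZero.ne L)
  have hP := isPathList_arc hf.inj hf.adj (a + 1) (p := L - 1) (by omega)
  have e : a + 1 + ((L - 1 : ℕ) : ZMod L) = a := by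
    rw [Nat.cast_sub hL]; push_cast; simp
  rw [e] at hP
  have hrange : ∀ x ∈ arc f (a + 1) (L - 1), x ∈ Set.range f := by
    intro x hx
    obtain ⟨i, -, rfl⟩ := mem_arc.1 hx
    exact ⟨_, rfl⟩
  refine hno (hasCycleOn_of_two_paths hP
    ((IsPathList.singleton G w').cons hadj (by simpa using hadj.ne)) ha.1.symm ha.2 ?_ ?_ ?_ ?_)
  · intro x hx hx'
    simp only [List.mem_cons, List.not_mem_nil, or_false] at hx'
    rcases hx' with rfl | rfl
    exacts [hw (hrange _ hx), hw' (hrange _ hx)]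
  · rw [length_arc]; simp; omega
  · intro x hx
    obtain ⟨i, rfl⟩ := hrange x hx
    exact hf.mem i
  · intro x hx
    simp only [List.mem_cons, List.not_mem_nil, or_false] at hx
    rcases hx with rfl | rfl
    exacts [hwA, hwA']

omit [NeZero L] hf in
theorem succIn_union_subset (S T : Finset (ZMod L)) :
    succIn (S ∪ T) (S ∪ T) ⊆ (succIn S S ∪ succIn T T) ∪ (succIn S T ∪ succIn T S) := by
  intro i
  simp only [mem_succIn, Finset.mem_union]
  tauto

theorem card_gaps_union_le (hno : ¬ HasCycleOn G A (L + 2)) (hww : w ≠ w') (hwA : w ∈ A)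
    (hwA' : w' ∈ A) (hw : w ∉ Set.range f) (hw' : w' ∉ Set.range f)
    (hg : (succIn (nbrPos G f w) (nbrPos G f w)).card ≤ 1)
    (hg' : (succIn (nbrPos G f w') (nbrPos G f w')).card ≤ 1) :
    (succIn (nbrPos G f w) (nbrPos G f w) ∪ succIn (nbrPos G f w') (nbrPos G f w')).card ≤ 1 := by
  rw [Finset.card_le_one] at hg hg' ⊢
  intro a ha b hb
  rcases Finset.mem_union.1 ha with ha | ha <;> rcases Finset.mem_union.1 hb with hb | hb
  · exact hg a ha b hb
  · exact hf.eq_of_mem_gaps hno hww hwA hwA' hw hw' ha hb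
  · exact (hf.eq_of_mem_gaps hno hww hwA hwA' hw hw' hb ha).symm
  · exact hg' a ha b hb

/-- Two outside vertices miss together almost half of the cycle. -/
theorem le_two_mul_card_nonNbrPos (hno : ¬ HasCycleOn G A (L + 2)) (hww : w ≠ w') (hwA : w ∈ A)
    (hwA' : w' ∈ A) (hw : w ∉ Set.range f) (hw' : w' ∉ Set.range f)
    (hg : (succIn (nbrPos G f w) (nbrPos G f w)).card ≤ 1)
    (hg' : (succIn (nbrPos G f w') (nbrPos G f w')).card ≤ 1) :
    L ≤ 2 * (nonNbrPos G f w w').card + 3 := by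
  have h1 := card_nonNbrPos (G := G) (f := f) w w'
  have h2 := two_mul_card_le (nbrPos G f w ∪ nbrPos G f w')
  have h3 := Finset.card_le_card (succIn_union_subset (nbrPos G f w) (nbrPos G f w'))
  have h4 := hf.card_gaps_union_le hno hww hwA hwA' hw hw' hg hg'
  have h5 : (succIn (nbrPos G f w) (nbrPos G f w')).card ≤ 1 := Finset.card_le_one.2
    fun a ha b hb => hf.eq_of_mem_succIn hno hww hwA hwA' hw hw' ha hb
  have h6 : (succIn (nbrPos G f w') (nbrPos G f w)).card ≤ 1 := Finset.card_le_one.2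
    fun a ha b hb => hf.eq_of_mem_succIn hno hww.symm hwA' hwA hw' hw ha hb
  have h7 := Finset.card_union_le
    (succIn (nbrPos G f w) (nbrPos G f w) ∪ succIn (nbrPos G f w') (nbrPos G f w'))
    (succIn (nbrPos G f w) (nbrPos G f w') ∪ succIn (nbrPos G f w') (nbrPos G f w))
  have h8 := Finset.card_union_le (succIn (nbrPos G f w) (nbrPos G f w'))
    (succIn (nbrPos G f w') (nbrPos G f w))
  omega

/-- The improvement of `le_two_mul_card_nonNbrPos` for vertices that cannot be inserted anywhere. -/
theorem le_two_mul_card_nonNbrPos_of_gaps_eq_empty (hno : ¬ HasCycleOn G A (L + 2)) (hww : w ≠ w')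
    (hwA : w ∈ A) (hwA' : w' ∈ A) (hw : w ∉ Set.range f) (hw' : w' ∉ Set.range f)
    (hg : succIn (nbrPos G f w) (nbrPos G f w) = ∅)
    (hg' : succIn (nbrPos G f w') (nbrPos G f w') = ∅) :
    L ≤ 2 * (nonNbrPos G f w w').card + 2 := by
  have h1 := card_nonNbrPos (G := G) (f := f) w w'
  have h2 := two_mul_card_le (nbrPos G f w ∪ nbrPos G f w')
  have h3 := Finset.card_le_card (succIn_union_subset (nbrPos G f w) (nbrPos G f w'))
  rw [hg, hg', Finset.empty_union, Finset.empty_union] at h3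
  have h5 : (succIn (nbrPos G f w) (nbrPos G f w')).card ≤ 1 := Finset.card_le_one.2
    fun a ha b hb => hf.eq_of_mem_succIn hno hww hwA hwA' hw hw' ha hb
  have h6 : (succIn (nbrPos G f w') (nbrPos G f w)).card ≤ 1 := Finset.card_le_one.2
    fun a ha b hb => hf.eq_of_mem_succIn hno hww.symm hwA' hwA hw' hw ha hb
  have h8 := Finset.card_union_le (succIn (nbrPos G f w) (nbrPos G f w'))
    (succIn (nbrPos G f w') (nbrPos G f w))
  omega

/-- The improvement of `le_two_mul_card_nonNbrPos` for adjacent outside vertices. -/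
theorem le_two_mul_card_nonNbrPos_of_adj (hno : ¬ HasCycleOn G A (L + 2)) (hadj : G.Adj w w')
    (hwA : w ∈ A) (hwA' : w' ∈ A) (hw : w ∉ Set.range f) (hw' : w' ∉ Set.range f)
    (hg : (succIn (nbrPos G f w) (nbrPos G f w)).card ≤ 1)
    (hg' : (succIn (nbrPos G f w') (nbrPos G f w')).card ≤ 1) :
    L ≤ 2 * (nonNbrPos G f w w').card + 1 := by
  have h1 := card_nonNbrPos (G := G) (f := f) w w'
  have h2 := two_mul_card_le (nbrPos G f w ∪ nbrPos G f w')
  have h3 := Finset.card_le_card (succIn_union_subset (nbrPos G f w) (nbrPos G f w'))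
  have h4 := hf.card_gaps_union_le hno hadj.ne hwA hwA' hw hw' hg hg'
  rw [hf.succIn_eq_empty hno hadj hwA hwA' hw hw', hf.succIn_eq_empty hno hadj.symm hwA' hwA hw' hw,
    Finset.empty_union, Finset.union_empty] at h3
  omega

/-- The improvement of `le_two_mul_card_nonNbrPos` for two vertices that can be inserted at the
same place: this place is also where they cross. -/
theorem le_two_mul_card_nonNbrPos_of_common_gap (hno : ¬ HasCycleOn G A (L + 2)) (hww : w ≠ w')
    (hwA : w ∈ A) (hwA' : w' ∈ A) (hw : w ∉ Set.range f) (hw' : w' ∉ Set.range f)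
    (hg : (succIn (nbrPos G f w) (nbrPos G f w)).card ≤ 1)
    (hg' : (succIn (nbrPos G f w') (nbrPos G f w')).card ≤ 1) {a : ZMod L}
    (ha : a ∈ succIn (nbrPos G f w) (nbrPos G f w))
    (ha' : a ∈ succIn (nbrPos G f w') (nbrPos G f w')) :
    L ≤ 2 * (nonNbrPos G f w w').card + 1 := by
  have h1 := card_nonNbrPos (G := G) (f := f) w w'
  have h2 := two_mul_card_le (nbrPos G f w ∪ nbrPos G f w')
  have hsub : succIn (nbrPos G f w ∪ nbrPos G f w') (nbrPos G f w ∪ nbrPos G f w') ⊆ {a} := by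
    intro b hb
    rw [Finset.mem_singleton]
    have hb' := succIn_union_subset _ _ hb
    simp only [Finset.mem_union] at hb'
    rcases hb' with (h | h) | (h | h)
    · exact Finset.card_le_one.1 hg b h a ha
    · exact Finset.card_le_one.1 hg' b h a ha'
    · exact hf.eq_of_mem_succIn hno hww hwA hwA' hw hw' h
        (mem_succIn.2 ⟨(mem_succIn.1 ha).1, (mem_succIn.1 ha').2⟩)
    · exact hf.eq_of_mem_succIn hno hww.symm hwA' hwA hw' hw h
        (mem_succIn.2 ⟨(mem_succIn.1 ha').1, (mem_succIn.1 ha).2⟩)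
  have h3 := Finset.card_le_card hsub
  rw [Finset.card_singleton] at h3
  omega

/-- At most one outside vertex can be inserted at two different places. -/
theorem eq_of_one_lt_card_gaps (hno : ¬ HasCycleOn G A (L + 2)) (hwA : w ∈ A)
    (hwA' : w' ∈ A) (hw : w ∉ Set.range f) (hw' : w' ∉ Set.range f)
    (hg : 1 < (succIn (nbrPos G f w) (nbrPos G f w)).card)
    (hg' : (succIn (nbrPos G f w') (nbrPos G f w')).Nonempty) : w = w' := by
  by_contra hww
  obtain ⟨a, ha, b, hb, hab⟩ := Finset.one_lt_card.1 hg
  obtain ⟨c, hc⟩ := hg'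
  exact hab ((hf.eq_of_mem_gaps hno hww hwA hwA' hw hw' ha hc).trans
    (hf.eq_of_mem_gaps hno hww hwA hwA' hw hw' hb hc).symm)

omit hf in
/-- If three vertices pairwise miss the same set of positions, then two consecutive positions
outside this set are both seen by one of the three. -/
theorem exists_gap_of_nonNbrPos_eq {x y z : V} (h1 : nonNbrPos G f x y = nonNbrPos G f y z)
    (h2 : nonNbrPos G f x z = nonNbrPos G f y z) {p : ZMod L}
    (hp : p ∈ succIn (nbrPos G f y ∪ nbrPos G f z) (nbrPos G f y ∪ nbrPos G f z)) :
    p ∈ succIn (nbrPos G f x) (nbrPos G f x) ∨ p ∈ succIn (nbrPos G f y) (nbrPos G f y) ∨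
      p ∈ succIn (nbrPos G f z) (nbrPos G f z) := by
  have e1 := Finset.ext_iff.1 (compl_injective h1)
  have e2 := Finset.ext_iff.1 (compl_injective h2)
  have a1 := e1 p
  have a2 := e2 p
  have b1 := e1 (p + 1)
  have b2 := e2 (p + 1)
  clear e1 e2 h1 h2
  simp only [mem_succIn, Finset.mem_union] at a1 a2 b1 b2 hp ⊢
  grind

end IsCycleMap

/-- Either three pairwise links can be used as two consecutive links with a spare connector, or
they are all the same minimal set. -/
theorem exists_perm_of_links {ι κ : Type*} [DecidableEq κ] (C : ι → ι → Finset κ)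
    (hC : ∀ x y, C x y = C y x) {a b c : ι} (nab : a ≠ b) (nbc : b ≠ c)
    (nac : a ≠ c) {m : ℕ} (hm : 1 ≤ m) (hab : m ≤ (C a b).card)
    (hbc : m ≤ (C b c).card) (hac : m ≤ (C a c).card)
    (hne : ¬ (C a b = C b c ∧ C a c = C b c ∧ (C b c).card = m)) :
    ∃ x ∈ ({a, b, c} : Set ι), ∃ y ∈ ({a, b, c} : Set ι), ∃ z ∈ ({a, b, c} : Set ι),
      x ≠ y ∧ y ≠ z ∧ x ≠ z ∧ ∃ q ∈ C x y, m ≤ ((C y z).erase q).card := by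
  by_contra! hcon
  have key : ∀ x ∈ ({a, b, c} : Set ι), ∀ y ∈ ({a, b, c} : Set ι), ∀ z ∈ ({a, b, c} : Set ι),
      x ≠ y → y ≠ z → x ≠ z →
      m ≤ (C x y).card → m ≤ (C y z).card → C x y ⊆ C y z ∧ (C y z).card = m := by
    intro x hx y hy z hz h1 h2 h3 hxy hyz
    have h4 : ∀ q ∈ C x y, q ∈ C y z ∧ (C y z).card = m := by
      intro q hq
      have h5 := hcon x hx y hy z hz h1 h2 h3 q hq
      by_cases hq' : q ∈ C y z
      · rw [Finset.card_erase_of_mem hq'] at h5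
        exact ⟨hq', by omega⟩
      · rw [Finset.erase_eq_of_notMem hq'] at h5
        omega
    refine ⟨fun q hq => (h4 q hq).1, ?_⟩
    obtain ⟨q, hq⟩ := Finset.card_pos.1 (show 0 < (C x y).card by omega)
    exact (h4 q hq).2
  have ha : a ∈ ({a, b, c} : Set ι) := by simp
  have hb : b ∈ ({a, b, c} : Set ι) := by simp
  have hc : c ∈ ({a, b, c} : Set ι) := by simp
  have k1 := key a ha b hb c hc nab nbc nac hab hbc
  have k2 := key c hc b hb a ha nbc.symm nab.symm nac.symm (by rwa [hC]) (by rwa [hC])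
  have k3 := key a ha c hc b hb nac nbc.symm nab hac (by rwa [hC])
  rw [hC c b, hC b a] at k2
  rw [hC c b] at k3
  refine hne ⟨k1.1.antisymm k2.1, ?_, k1.2⟩
  exact Finset.eq_of_subset_of_card_le k3.1 (by omega)

variable {f : ZMod L → V}

/-- The connector lemma for outside vertices of a cycle of `G`, with connectors on the cycle and
edges in the graph `B` that contains all non-edges of `G`. -/
theorem exists_path_through_cycle (hf : IsCycleMap G A f)
    (hGB : ∀ x y, x ≠ y → G.Adj x y ∨ B.Adj x y) (us : List V) (hus : us.Nodup)
    (hout : ∀ x ∈ us, x ∉ Set.range f) (Av : Finset (ZMod L)) {a b : V} (ha : us.head? = some a)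
    (hb : us.getLast? = some b)
    (hcard : ∀ x ∈ us, ∀ y ∈ us, x ≠ y → us.length - 1 ≤ (nonNbrPos G f x y \ Av).card) :
    ∃ l, IsPathList B a b l ∧ l.length = 2 * us.length - 1 ∧
      ∃ S : Finset (ZMod L), S.card = us.length - 1 ∧ (∀ i ∈ S, i ∉ Av) ∧
        ∀ v ∈ l, v ∈ us ∨ ∃ i ∈ S, f i = v := by
  classical
  obtain ⟨l, hl, hlen, S, hSK, hSc, hlS⟩ := exists_threaded_path (G := B)
    ((Finset.univ \ Av).image f) us hus (fun x hx h => hout x hx (by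
      obtain ⟨i, -, rfl⟩ := Finset.mem_image.1 h
      exact ⟨i, rfl⟩)) ha hb (fun x hx y hy hxy => by
      refine (hcard x hx y hy hxy).trans ?_
      rw [← Finset.card_image_of_injective _ hf.inj]
      refine Finset.card_le_card fun v hv => ?_
      obtain ⟨i, hi, rfl⟩ := Finset.mem_image.1 hv
      rw [Finset.mem_sdiff, mem_nonNbrPos] at hi
      refine Finset.mem_filter.2 ⟨Finset.mem_image_of_mem f (by simpa using hi.2), ?_, ?_⟩
      · exact (hGB x (f i) fun h => hout x hx ⟨i, h.symm⟩).resolve_left hi.1.1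
      · exact ((hGB y (f i) fun h => hout y hy ⟨i, h.symm⟩).resolve_left hi.1.2).symm)
  refine ⟨l, hl, hlen, Finset.univ.filter fun i => f i ∈ S, ?_, ?_, ?_⟩
  · rw [← hSc, ← Finset.card_image_of_injective _ hf.inj]
    congr 1
    ext v
    simp only [Finset.mem_image, Finset.mem_filter, Finset.mem_univ, true_and]
    constructor
    · rintro ⟨i, hi, rfl⟩
      exact hi
    · intro hv
      obtain ⟨i, -, rfl⟩ := Finset.mem_image.1 (hSK hv)
      exact ⟨i, hv, rfl⟩
  · intro i hi
    obtain ⟨i', hi', h⟩ := Finset.mem_image.1 (hSK (Finset.mem_filter.1 hi).2)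
    rw [← hf.inj h]
    simpa using hi'
  · intro v hv
    rcases hlS v hv with h | h
    · exact Or.inl h
    · obtain ⟨i, -, rfl⟩ := Finset.mem_image.1 (hSK h)
      exact Or.inr ⟨i, by simpa using h, rfl⟩

/-- A path that starts with the link from `y` to `z`, whose connector is chosen last: it only needs
`nonNbrPos G f y z` to be large. -/
theorem exists_path_through_cycle_of_link (hf : IsCycleMap G A f)
    (hGB : ∀ x y, x ≠ y → G.Adj x y ∨ B.Adj x y) (us : List V) (hus : us.Nodup)
    (hout : ∀ x ∈ us, x ∉ Set.range f) {y z u : V} (hy : y ∉ Set.range f) (hyus : y ∉ us)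
    (hz : us.head? = some z) (hu : us.getLast? = some u) (Av : Finset (ZMod L))
    (hcard : ∀ x ∈ us, ∀ y ∈ us, x ≠ y → us.length - 1 ≤ (nonNbrPos G f x y \ Av).card)
    (hyz : us.length ≤ (nonNbrPos G f y z \ Av).card) :
    ∃ l, IsPathList B y u l ∧ l.length = 2 * us.length + 1 ∧
      ∀ v ∈ l, v = y ∨ v ∈ us ∨ ∃ i, i ∉ Av ∧ f i = v := by
  classical
  obtain ⟨l, hl, hlen, S, hSc, hSA, hlS⟩ :=
    exists_path_through_cycle hf hGB us hus hout Av hz hu hcard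
  have hpos : 0 < us.length := by
    cases us <;> simp at hz ⊢
  have hzus : z ∈ us := List.mem_of_mem_head? hz
  obtain ⟨r, hr, hrS⟩ := Finset.exists_mem_notMem_of_card_lt_card
    (s := S) (t := nonNbrPos G f y z \ Av) (by omega)
  rw [Finset.mem_sdiff, mem_nonNbrPos] at hr
  have hyr := (hGB y (f r) fun h => hy ⟨r, h.symm⟩).resolve_left hr.1.1
  have hzr := (hGB z (f r) fun h => hout z hzus ⟨r, h.symm⟩).resolve_left hr.1.2
  have hrl : f r ∉ l := by
    intro h
    rcases hlS _ h with h | ⟨i, hi, h⟩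
    · exact hout _ h ⟨r, rfl⟩
    · exact hrS (hf.inj h ▸ hi)
  have hyl : y ∉ l := by
    intro h
    rcases hlS _ h with h | ⟨i, hi, h⟩
    · exact hyus h
    · exact hy ⟨i, h⟩
  refine ⟨y :: f r :: l, (hl.cons hzr.symm hrl).cons hyr ?_, ?_, ?_⟩
  · simp only [List.mem_cons, not_or]
    exact ⟨hyr.ne, hyl⟩
  · simp only [List.length_cons]; omega
  · intro v hv
    simp only [List.mem_cons] at hv
    rcases hv with rfl | rfl | hv
    · exact Or.inl rfl
    · exact Or.inr (Or.inr ⟨r, hr.2, rfl⟩)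
    · rcases hlS v hv with h | ⟨i, hi, h⟩
      · exact Or.inr (Or.inl h)
      · exact Or.inr (Or.inr ⟨i, hSA i hi, h⟩)

/-- Two positions on a cycle are the ends of an arc that covers more than half of the cycle. -/
theorem IsCycleMap.exists_long_arc (hf : IsCycleMap G A f) {i j : ZMod L} (hij : i ≠ j) :
    ∃ l, IsPathList G (f i) (f j) l ∧ L + 2 ≤ 2 * l.length ∧ l.length ≤ L ∧
      ∀ v ∈ l, v ∈ Set.range f := by
  have h0 : ∀ a b : ZMod L, a ≠ b → 0 < (b - a).val := fun a b hab => by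
    rw [Nat.pos_iff_ne_zero, Ne, ZMod.val_eq_zero, sub_eq_zero]
    exact fun h => hab h.symm
  have key : ∀ a b : ZMod L, a ≠ b → ∃ l, IsPathList G (f a) (f b) l ∧
      l.length = (b - a).val + 1 ∧ ∀ v ∈ l, v ∈ Set.range f := by
    intro a b hab
    have h1 := isPathList_arc hf.inj hf.adj a (p := (b - a).val) (ZMod.val_lt _)
    have e : a + ((b - a).val : ZMod L) = b := by rw [ZMod.natCast_zmod_val]; abel
    rw [e] at h1
    refine ⟨_, h1, length_arc _ _, fun v hv => ?_⟩
    obtain ⟨i, -, rfl⟩ := mem_arc.1 hv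
    exact ⟨_, rfl⟩
  have hsum : (j - i).val + (i - j).val = L := by
    have : NeZero (j - i) := ⟨by rw [Ne, sub_eq_zero]; exact fun h => hij h.symm⟩
    have h2 := ZMod.val_neg_of_ne_zero (j - i)
    rw [neg_sub] at h2
    have := ZMod.val_lt (j - i)
    omega
  have h1 := h0 i j hij
  have h2 := h0 j i hij.symm
  rcases le_total (i - j).val (j - i).val with h | h
  · obtain ⟨l, hl, hlen, hr⟩ := key i j hij
    exact ⟨l, hl, by omega, by omega, hr⟩
  · obtain ⟨l, hl, hlen, hr⟩ := key j i hij.symm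
    refine ⟨l.reverse, hl.reverse, by simp; omega, by simp; omega, fun v hv => hr v ?_⟩
    exact List.mem_reverse.1 hv

end Attach

/-! ### Cycles in complete bipartite graphs with extra edges, and in pairs of linked cliques -/

section Constructions

variable {V : Type*} [DecidableEq V] {G : SimpleGraph V} {A : Set V} {X Y : Finset V}

theorem exists_list_of_mem {x : V} (hx : x ∈ X) {n : ℕ} (hn : 1 ≤ n) (hnX : n ≤ X.card) :
    ∃ us : List V, ∃ u, us.Nodup ∧ us.head? = some x ∧ us.getLast? = some u ∧ us.length = n ∧
      ∀ z ∈ us, z ∈ X := by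
  rcases hn.eq_or_lt with rfl | hn
  · exact ⟨[x], x, by simp, rfl, rfl, rfl, by simpa using hx⟩
  · obtain ⟨y, hy, hyx⟩ := Finset.exists_mem_ne (show 1 < X.card by omega) x
    obtain ⟨l, hl, hlen, hlX⟩ := exists_path_of_clique (G := ⊤) (X := X) (fun a _ b _ h => h)
      hx hy hyx.symm hn hnX
    exact ⟨l, y, hl.nodup, hl.head, hl.last, hlen, hlX⟩

theorem exists_path_in_clique (hX : G.IsClique (X : Set V)) {m : ℕ} (hm : 1 ≤ m)
    (hmX : m ≤ X.card) : ∃ a b l, IsPathList G a b l ∧ l.length = m ∧ ∀ z ∈ l, z ∈ X := by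
  obtain ⟨x, hx⟩ := Finset.card_pos.1 (show 0 < X.card by omega)
  obtain ⟨us, u, h1, h2, h3, h4, h5⟩ := exists_list_of_mem hx hm hmX
  refine ⟨x, u, us, ⟨h1, ?_, h2, h3⟩, h4, h5⟩
  exact (h1.imp_of_mem fun ha hb hab => hX (h5 _ ha) (h5 _ hb) hab).isChain

section Bipartite

variable (hXY : ∀ x ∈ X, ∀ y ∈ Y, G.Adj x y)
include hXY

omit [DecidableEq V] in
theorem disjoint_of_adj : ∀ x ∈ X, x ∉ Y := fun x hx hy => (hXY x hx x hy).ne rfl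

theorem exists_alternating_path_same {x x' : V} (hx : x ∈ X) (hx' : x' ∈ X) (hxx : x ≠ x') {n : ℕ}
    (hn : 2 ≤ n) (hnX : n ≤ X.card) (hnY : n - 1 ≤ Y.card) :
    ∃ l, IsPathList G x x' l ∧ l.length = 2 * n - 1 ∧ ∀ v ∈ l, v ∈ X ∨ v ∈ Y := by
  classical
  obtain ⟨us, hus, hlen, husX⟩ := exists_path_of_clique (G := ⊤) (X := X) (fun a _ b _ h => h)
      hx hx' hxx hn hnX
  obtain ⟨l, hl, hll, S, hS, -, hlS⟩ := exists_threaded_path (G := G) Y us hus.nodup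
    (fun z hz => disjoint_of_adj hXY z (husX z hz)) hus.head hus.last
    (fun p hp q hq _ => by
      rw [Finset.filter_true_of_mem fun y hy =>
        ⟨hXY p (husX p hp) y hy, (hXY q (husX q hq) y hy).symm⟩]
      omega)
  exact ⟨l, hl, by omega, fun v hv => (hlS v hv).imp (husX v) (fun h => hS h)⟩

theorem exists_alternating_path {x y : V} (hx : x ∈ X) (hy : y ∈ Y) {n : ℕ}
    (hn : 1 ≤ n) (hnX : n ≤ X.card) (hnY : n ≤ Y.card) :
    ∃ l, IsPathList G x y l ∧ l.length = 2 * n ∧ ∀ v ∈ l, v ∈ X ∨ v ∈ Y := by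
  classical
  obtain ⟨us, u, hus, hhd, hlast, hlen, husX⟩ := exists_list_of_mem hx hn hnX
  have huX : u ∈ X := husX u (List.mem_of_getLast? hlast)
  obtain ⟨l, hl, hll, S, hS, -, hlS⟩ := exists_threaded_path (G := G) (Y.erase y) us hus
    (fun z hz h => disjoint_of_adj hXY z (husX z hz) (Finset.mem_of_mem_erase h)) hhd hlast
    (fun p hp q hq _ => by
      rw [Finset.filter_true_of_mem fun y hy =>
        ⟨hXY p (husX p hp) y (Finset.mem_of_mem_erase hy),
          (hXY q (husX q hq) y (Finset.mem_of_mem_erase hy)).symm⟩, Finset.card_erase_of_mem hy]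
      omega)
  refine ⟨l ++ [y], hl.snoc (hXY u huX y hy) ?_, by simp; omega, ?_⟩
  · intro h
    rcases hlS y h with h | h
    · exact disjoint_of_adj hXY y (husX y h) hy
    · exact Finset.notMem_erase y Y (hS h)
  · intro v hv
    rcases List.mem_append.1 hv with hv | hv
    · exact (hlS v hv).imp (husX v) fun h => Finset.mem_of_mem_erase (hS h)
    · rw [List.mem_singleton] at hv
      exact Or.inr (hv ▸ hy)

variable (hXA : ∀ x ∈ X, x ∈ A) (hYA : ∀ y ∈ Y, y ∈ A) {k : ℕ}
include hXA hYA

/-- An edge inside one side of a complete bipartite graph closes an odd cycle. -/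
theorem hasCycleOn_of_edge_in_side {x x' : V} (hx : x ∈ X) (hx' : x' ∈ X) (hadj : G.Adj x x')
    (hk : 1 ≤ k) (hkX : k + 1 ≤ X.card) (hkY : k ≤ Y.card) : HasCycleOn G A (2 * k + 1) := by
  obtain ⟨l, hl, hll, hlXY⟩ := exists_alternating_path_same hXY hx hx' hadj.ne (n := k + 1)
    (by omega) hkX (by omega)
  exact ⟨x, x', l, hl, hadj.symm, by omega, fun v hv => (hlXY v hv).elim (hXA v) (hYA v)⟩

/-- A vertex `z` with neighbours on both sides of a complete bipartite graph closes an odd cycle. -/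
theorem hasCycleOn_of_apex {x y z : V} (hx : x ∈ X) (hy : y ∈ Y) (hzX : z ∉ X) (hzY : z ∉ Y)
    (hzA : z ∈ A) (hzx : G.Adj z x) (hzy : G.Adj z y)
    (hk : 1 ≤ k) (hkX : k ≤ X.card) (hkY : k ≤ Y.card) : HasCycleOn G A (2 * k + 1) := by
  obtain ⟨l, hl, hll, hlXY⟩ := exists_alternating_path hXY hx hy hk hkX hkY
  refine hasCycleOn_of_two_paths hl (IsPathList.singleton G z) hzy.symm hzx ?_ (by simp [hll])
    (fun v hv => (hlXY v hv).elim (hXA v) (hYA v)) (by simpa using hzA)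
  intro v hv hvz
  rw [List.mem_singleton] at hvz
  subst hvz
  exact (hlXY v hv).elim hzX hzY

/-- An edge `z z'` outside a complete bipartite graph closes an odd cycle if its ends have different
neighbours on the same side. -/
theorem hasCycleOn_of_outer_edge {y y' z z' : V} (hy : y ∈ Y) (hy' : y' ∈ Y) (hyy : y ≠ y')
    (hzX : z ∉ X) (hzY : z ∉ Y) (hzA : z ∈ A) (hzX' : z' ∉ X) (hzY' : z' ∉ Y) (hzA' : z' ∈ A)
    (hzz : G.Adj z z') (hzy : G.Adj z y) (hzy' : G.Adj z' y')
    (hk : 2 ≤ k) (hkX : k ≤ X.card) (hkY : k ≤ Y.card) : HasCycleOn G A (2 * k + 1) := by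
  obtain ⟨l, hl, hll, hlXY⟩ := exists_alternating_path_same
    (fun b hb a ha => (hXY a ha b hb).symm) hy hy' hyy hk hkY (by omega)
  refine hasCycleOn_of_two_paths hl
    ((IsPathList.singleton G z).cons hzz.symm (by simpa using hzz.ne.symm)) hzy'.symm hzy ?_
    (by simp [hll]; omega)
    (fun v hv => (hlXY v hv).elim (hYA v) (hXA v)) (by simp [hzA, hzA'])
  intro v hv hvz
  simp only [List.mem_cons, List.not_mem_nil, or_false] at hvz
  rcases hvz with rfl | rfl
  · exact (hlXY v hv).elim hzY' hzX'
  · exact (hlXY v hv).elim hzY hzX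

/-- A path `z f z'` outside a complete bipartite graph closes an odd cycle if its ends see opposite
sides. -/
theorem hasCycleOn_of_outer_path {f z z' : V} (hfX : f ∉ X) (hfY : f ∉ Y) (hfA : f ∈ A)
    (hzX : z ∉ X) (hzY : z ∉ Y) (hzA : z ∈ A) (hzX' : z' ∉ X) (hzY' : z' ∉ Y) (hzA' : z' ∈ A)
    (hzz : z ≠ z') (hfz : G.Adj f z) (hfz' : G.Adj f z') (hz : ∀ y ∈ Y, G.Adj z y)
    (hz' : ∀ x ∈ X, G.Adj z' x)
    (hk : 2 ≤ k) (hkX : k ≤ X.card) (hkY : k ≤ Y.card) : HasCycleOn G A (2 * k + 1) := by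
  obtain ⟨x, hx⟩ := Finset.card_pos.1 (show 0 < X.card by omega)
  obtain ⟨y, hy⟩ := Finset.card_pos.1 (show 0 < Y.card by omega)
  obtain ⟨l, hl, hll, hlXY⟩ := exists_alternating_path hXY hx hy (n := k - 1) (by omega)
    (by omega) (by omega)
  refine hasCycleOn_of_two_paths hl
    (((IsPathList.singleton G z').cons hfz' (by simpa using hfz'.ne)).cons hfz.symm
      (by simpa using ⟨hfz.ne.symm, hzz⟩)) (hz y hy).symm (hz' x hx) ?_
    (by simp [hll]; omega)
    (fun v hv => (hlXY v hv).elim (hXA v) (hYA v)) (by simp [hzA, hzA', hfA])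
  intro v hv hvz
  simp only [List.mem_cons, List.not_mem_nil, or_false] at hvz
  rcases hvz with rfl | rfl | rfl
  · exact (hlXY v hv).elim hzX hzY
  · exact (hlXY v hv).elim hfX hfY
  · exact (hlXY v hv).elim hzX' hzY'

end Bipartite

section Cliques

variable (hX : G.IsClique (X : Set V)) (hY : G.IsClique (Y : Set V)) (hXY : ∀ x ∈ X, x ∉ Y)
  (hXA : ∀ x ∈ X, x ∈ A) (hYA : ∀ y ∈ Y, y ∈ A) {n : ℕ}

include hX hY hXY hXA hYA in
/-- Two disjoint edges between two cliques. -/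
theorem hasCycleOn_of_two_edges {x x' y y' : V} (hx : x ∈ X) (hx' : x' ∈ X) (hxx : x ≠ x')
    (hy : y ∈ Y) (hy' : y' ∈ Y) (hyy : y ≠ y') (hxy : G.Adj x y) (hxy' : G.Adj x' y')
    (hn : 4 ≤ n) (hnXY : n ≤ X.card + Y.card) : HasCycleOn G A n := by
  have hX2 : 2 ≤ X.card := Finset.one_lt_card.2 ⟨x, hx, x', hx', hxx⟩
  have hY2 : 2 ≤ Y.card := Finset.one_lt_card.2 ⟨y, hy, y', hy', hyy⟩
  obtain ⟨r, m, hr, hm, hrX, hmY, hrm⟩ : ∃ r m, 2 ≤ r ∧ 2 ≤ m ∧ r ≤ X.card ∧ m ≤ Y.card ∧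
      r + m = n := by
    rcases le_total (n - 2) Y.card with h | h
    · exact ⟨2, n - 2, by omega, by omega, by omega, by omega, by omega⟩
    · exact ⟨n - Y.card, Y.card, by omega, by omega, by omega, by omega, by omega⟩
  obtain ⟨l, hl, hll, hlX⟩ := exists_path_of_clique (fun a ha b hb h => hX ha hb h) hx' hx hxx.symm
    hr hrX
  obtain ⟨l', hl', hll', hlY⟩ := exists_path_of_clique (fun a ha b hb h => hY ha hb h) hy hy' hyy
    hm hmY
  exact hasCycleOn_of_two_paths hl hl' hxy hxy'.symm
    (fun v hv hv' => hXY v (hlX v hv) (hlY v hv')) (by omega)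
    (fun v hv => hXA v (hlX v hv)) (fun v hv => hYA v (hlY v hv))

include hX hY hXY hXA hYA in
/-- Two outside vertices that link two cliques. -/
theorem hasCycleOn_of_two_links {z z' y y' : V} (hzX : z ∉ X) (hzY : z ∉ Y) (hzA : z ∈ A)
    (hzX' : z' ∉ X) (hzY' : z' ∉ Y) (hzA' : z' ∈ A) (hzz : z ≠ z') (hz : ∀ x ∈ X, G.Adj z x)
    (hz' : ∀ x ∈ X, G.Adj z' x) (hy : y ∈ Y) (hy' : y' ∈ Y) (hyy : y ≠ y') (hzy : G.Adj z y)
    (hzy' : G.Adj z' y') (hn : 5 ≤ n) (hX0 : 0 < X.card) (hnXY : n ≤ X.card + Y.card + 2) :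
    HasCycleOn G A n := by
  have hY2 : 2 ≤ Y.card := Finset.one_lt_card.2 ⟨y, hy, y', hy', hyy⟩
  obtain ⟨r, m, hr, hm, hrX, hmY, hrm⟩ : ∃ r m, 1 ≤ r ∧ 2 ≤ m ∧ r ≤ X.card ∧ m ≤ Y.card ∧
      r + m + 2 = n := by
    rcases le_total (n - 3) Y.card with h | h
    · exact ⟨1, n - 3, by omega, by omega, by omega, by omega, by omega⟩
    · exact ⟨n - 2 - Y.card, Y.card, by omega, by omega, by omega, by omega, by omega⟩
  obtain ⟨a, b, l, hl, hll, hlX⟩ := exists_path_in_clique hX hr hrX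
  obtain ⟨l', hl', hll', hlY⟩ := exists_path_of_clique (fun a ha b hb h => hY ha hb h) hy hy' hyy
    hm hmY
  have haX := hlX a hl.head_mem
  have hbX := hlX b hl.last_mem
  refine hasCycleOn_of_two_paths (hl.cons (hz' a haX) fun h => hzX' (hlX _ h))
    (hl'.cons hzy fun h => hzY (hlY _ h)) (hz b hbX).symm hzy'.symm ?_ (by simp; omega) ?_ ?_
  · intro v hv hv'
    rcases List.mem_cons.1 hv with rfl | hv <;> rcases List.mem_cons.1 hv' with rfl | hv'
    exacts [hzz rfl, hzY' (hlY _ hv'), hzX (hlX _ hv), hXY v (hlX v hv) (hlY v hv')]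
  · intro v hv
    rcases List.mem_cons.1 hv with rfl | hv
    exacts [hzA', hXA _ (hlX _ hv)]
  · intro v hv
    rcases List.mem_cons.1 hv with rfl | hv
    exacts [hzA, hYA _ (hlY _ hv)]

include hX hXA in
/-- Two outside vertices that are joined to a clique and have a further common neighbour. -/
theorem hasCycleOn_of_common_nbr {z z' y : V} (hzX : z ∉ X) (hzA : z ∈ A)
    (hzX' : z' ∉ X) (hzA' : z' ∈ A) (hzz : z ≠ z') (hz : ∀ x ∈ X, G.Adj z x)
    (hz' : ∀ x ∈ X, G.Adj z' x) (hyX : y ∉ X) (hyA : y ∈ A) (hzy : G.Adj z y)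
    (hzy' : G.Adj z' y) (hn : 4 ≤ n) (hnX : n ≤ X.card + 3) : HasCycleOn G A n := by
  obtain ⟨a, b, l, hl, hll, hlX⟩ := exists_path_in_clique hX (m := n - 3) (by omega) (by omega)
  have haX := hlX a hl.head_mem
  have hbX := hlX b hl.last_mem
  refine hasCycleOn_of_two_paths hl
    (((IsPathList.singleton G z').cons hzy'.symm (by simpa using hzy'.ne.symm)).cons hzy
      (by simpa using ⟨hzy.ne, hzz⟩)) (hz b hbX).symm (hz' a haX) ?_
    (by simp [hll]; omega) (fun v hv => hXA v (hlX v hv)) (by simp [hzA, hzA', hyA])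
  intro v hv hvz
  simp only [List.mem_cons, List.not_mem_nil, or_false] at hvz
  rcases hvz with rfl | rfl | rfl
  exacts [hzX (hlX _ hv), hyX (hlX _ hv), hzX' (hlX _ hv)]

end Cliques

/-- A bipartite graph without two disjoint edges is a star. -/
theorem exists_star_center {V : Type*} [Nonempty V] {X Y : Finset V} (E : V → V → Prop)
    (h : ∀ x ∈ X, ∀ x' ∈ X, ∀ y ∈ Y, ∀ y' ∈ Y, x ≠ x' → y ≠ y' → E x y → E x' y' → False) :
    ∃ v, ∀ x ∈ X, ∀ y ∈ Y, E x y → x = v ∨ y = v := by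
  by_cases h1 : ∃ a ∈ X, ∃ b ∈ Y, E a b
  · obtain ⟨a, ha, b, hb, hab⟩ := h1
    by_cases h2 : ∀ x ∈ X, ∀ y ∈ Y, E x y → x = a
    · exact ⟨a, fun x hx y hy hxy => Or.inl (h2 x hx y hy hxy)⟩
    · push Not at h2
      obtain ⟨c, hc, d, hd, hcd, hca⟩ := h2
      refine ⟨b, fun x hx y hy hxy => Or.inr ?_⟩
      by_contra hyb
      have hdb : d = b := by
        by_contra hdb
        exact h c hc a ha d hd b hb hca hdb hcd hab
      have hxa : x = a := by
        by_contra hxa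
        exact h x hx a ha y hy b hb hxa hyb hxy hab
      have hxc : x = c := by
        by_contra hxc
        exact h x hx c hc y hy d hd hxc (hdb ▸ hyb) hxy hcd
      exact hca (hxc ▸ hxa)
  · push Not at h1
    obtain ⟨v⟩ := ‹Nonempty V›
    exact ⟨v, fun x hx y hy hxy => absurd hxy (h1 x hx y hy)⟩

end Constructions

/-! ### Gluing two cliques -/

section Glue

variable {V : Type*} [DecidableEq V] {R B : SimpleGraph V} {A X Y : Finset V} {k j : ℕ}

/-- The vertex set `A` is a union of two disjoint cliques of `B`. -/
def IsTwoCliques (B : SimpleGraph V) (A : Finset V) : Prop :=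
  ∃ X Y : Finset V, X ∪ Y = A ∧ (∀ x ∈ X, x ∉ Y) ∧ B.IsClique (X : Set V) ∧ B.IsClique (Y : Set V)

/-- A vertex with red edges to both sides of a red complete bipartite graph closes a red odd
cycle. -/
theorem forall_adj_or_forall_adj (hRB : ∀ x y, x ≠ y → R.Adj x y ∨ B.Adj x y)
    (hRXY : ∀ x ∈ X, ∀ y ∈ Y, R.Adj x y) {A : Set V} (hXA : ∀ x ∈ X, x ∈ A)
    (hYA : ∀ y ∈ Y, y ∈ A) (hk : 1 ≤ k) (hkX : k ≤ X.card) (hkY : k ≤ Y.card)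
    (hnoR : ¬ HasCycleOn R A (2 * k + 1)) {z : V} (hzA : z ∈ A) (hzX : z ∉ X) (hzY : z ∉ Y) :
    (∀ x ∈ X, B.Adj z x) ∨ ∀ y ∈ Y, B.Adj z y := by
  by_contra! h
  obtain ⟨⟨x, hx, hzx⟩, y, hy, hzy⟩ := h
  refine hnoR (hasCycleOn_of_apex hRXY hXA hYA hx hy hzX hzY hzA ?_ ?_ hk hkX hkY)
  · exact (hRB z x fun h => hzX (h ▸ hx)).resolve_right hzx
  · exact (hRB z y fun h => hzY (h ▸ hy)).resolve_right hzy

/-- One side of the gluing: two vertices that are blue to all of `X` but not to all of `Y` are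
joined by a blue edge. -/
theorem adj_of_same_side (hRB : ∀ x y, x ≠ y → R.Adj x y ∨ B.Adj x y)
    (hRXY : ∀ x ∈ X, ∀ y ∈ Y, R.Adj x y) (hX : B.IsClique (X : Set V))
    (hY : B.IsClique (Y : Set V)) {A : Set V} (hXA : ∀ x ∈ X, x ∈ A) (hYA : ∀ y ∈ Y, y ∈ A)
    (hj : 3 ≤ j) (hk : 2 ≤ k) (hkX : k ≤ X.card) (hkY : k ≤ Y.card)
    (hcard : 2 * j - 1 ≤ X.card + Y.card) (hnoR : ¬ HasCycleOn R A (2 * k + 1))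
    (hnoB : ¬ HasCycleOn B A (2 * j)) {z z' : V} (hzX : z ∉ X) (hzY : z ∉ Y)
    (hzA : z ∈ A) (hzX' : z' ∉ X) (hzY' : z' ∉ Y) (hzA' : z' ∈ A) (hzz : z ≠ z')
    (hz : ∀ x ∈ X, B.Adj z x) (hz' : ∀ x ∈ X, B.Adj z' x) (hzn : ¬ ∀ y ∈ Y, B.Adj z y)
    (hzn' : ¬ ∀ y ∈ Y, B.Adj z' y) : B.Adj z z' := by
  have hdisj := disjoint_of_adj hRXY
  by_contra hB
  have hR := (hRB z z' hzz).resolve_right hB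
  push Not at hzn hzn'
  obtain ⟨y0, hy0, hzy0⟩ := hzn
  obtain ⟨y1, hy1, hzy1⟩ := hzn'
  have hRzy0 := (hRB z y0 fun h => hzY (h ▸ hy0)).resolve_right hzy0
  have hRzy1 := (hRB z' y1 fun h => hzY' (h ▸ hy1)).resolve_right hzy1
  -- All red neighbours of `z` and `z'` in `Y` are equal.
  have hone : ∀ y ∈ Y, ∀ y' ∈ Y, R.Adj z y → R.Adj z' y' → y = y' := by
    intro y hy y' hy' h h'
    by_contra hyy
    exact hnoR (hasCycleOn_of_outer_edge hRXY hXA hYA hy hy' hyy hzX hzY hzA hzX' hzY' hzA' hR h h'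
      hk hkX hkY)
  have hB0 : ∀ y ∈ Y, y ≠ y0 → B.Adj z y ∧ B.Adj z' y := by
    intro y hy hyy
    constructor
    · refine (hRB z y fun h => hzY (h ▸ hy)).resolve_left fun h => hyy ?_
      exact (hone y hy y1 hy1 h hRzy1).trans (hone y0 hy0 y1 hy1 hRzy0 hRzy1).symm
    · refine (hRB z' y fun h => hzY' (h ▸ hy)).resolve_left fun h => hyy ?_
      exact (hone y0 hy0 y hy hRzy0 h).symm
  have hce := Finset.card_erase_of_mem hy0
  rcases Nat.lt_or_ge Y.card 3 with h3 | h3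
  · obtain ⟨y, hy⟩ := Finset.card_pos.1 (show 0 < (Y.erase y0).card by omega)
    rw [Finset.mem_erase] at hy
    have := hB0 y hy.2 hy.1
    exact hnoB (hasCycleOn_of_common_nbr hX hXA hzX hzA hzX' hzA' hzz hz hz'
      (fun h => hdisj y h hy.2) (hYA y hy.2) this.1 this.2 (by omega) (by omega))
  · obtain ⟨y, hy, y', hy', hyy⟩ := Finset.one_lt_card.1 (show 1 < (Y.erase y0).card by omega)
    rw [Finset.mem_erase] at hy hy'
    exact hnoB (hasCycleOn_of_two_links hX hY hdisj hXA hYA hzX hzY hzA hzX' hzY' hzA' hzz hz hz'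
      hy.2 hy'.2 hyy (hB0 y hy.2 hy.1).1 (hB0 y' hy'.2 hy'.1).2 (by omega) (by omega) (by omega))

/-- If `A` contains two large blue cliques with all edges between them red, then `A` is a union of
two blue cliques, unless it contains a red `C_{2k+1}` or a blue `C_{2j}`. -/
theorem isTwoCliques_of_core (hRB : ∀ x y, x ≠ y → R.Adj x y ∨ B.Adj x y)
    (hRXY : ∀ x ∈ X, ∀ y ∈ Y, R.Adj x y) (hX : B.IsClique (X : Set V))
    (hY : B.IsClique (Y : Set V)) (hXA : X ⊆ A) (hYA : Y ⊆ A)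
    (hj : 3 ≤ j) (hk : 2 ≤ k) (hkX : k ≤ X.card) (hkY : k ≤ Y.card)
    (hcard : 2 * j - 1 ≤ X.card + Y.card) (hnoR : ¬ HasCycleOn R (A : Set V) (2 * k + 1))
    (hnoB : ¬ HasCycleOn B (A : Set V) (2 * j)) : IsTwoCliques B A := by
  classical
  have hdisj := disjoint_of_adj hRXY
  have hRYX : ∀ y ∈ Y, ∀ x ∈ X, R.Adj y x := fun y hy x hx => (hRXY x hx y hy).symm
  have hXA' : ∀ x ∈ X, x ∈ (A : Set V) := fun x hx => hXA hx
  have hYA' : ∀ y ∈ Y, y ∈ (A : Set V) := fun y hy => hYA hy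
  have hside : ∀ z ∈ A, z ∉ X → z ∉ Y → (∀ x ∈ X, B.Adj z x) ∨ ∀ y ∈ Y, B.Adj z y :=
    fun z hz hzX hzY => forall_adj_or_forall_adj hRB hRXY hXA' hYA' (by omega) hkX hkY hnoR hz
      hzX hzY
  -- A vertex that is blue to everything and another link to the other side give a blue cycle.
  have hfreeX : ∀ z ∈ A, z ∉ X → z ∉ Y → (∀ x ∈ X, B.Adj z x) → (∀ y ∈ Y, B.Adj z y) →
      ∀ z' ∈ A, z' ∉ X → z' ∉ Y → z ≠ z' → (∀ x ∈ X, B.Adj z' x) → ∀ y ∈ Y, ¬ B.Adj z' y := by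
    intro z hz hzX hzY h1 h2 z' hz' hzX' hzY' hzz h1' y hy hzy
    obtain ⟨y', hy', hyy⟩ := Finset.exists_mem_ne (show 1 < Y.card by omega) y
    exact hnoB (hasCycleOn_of_two_links hX hY hdisj hXA' hYA' hzX hzY hz hzX' hzY' hz' hzz h1 h1'
      hy' hy hyy (h2 y' hy') hzy (by omega) (by omega) (by omega))
  have hfreeY : ∀ z ∈ A, z ∉ X → z ∉ Y → (∀ x ∈ X, B.Adj z x) → (∀ y ∈ Y, B.Adj z y) →
      ∀ z' ∈ A, z' ∉ X → z' ∉ Y → z ≠ z' → (∀ y ∈ Y, B.Adj z' y) → ∀ x ∈ X, ¬ B.Adj z' x := by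
    intro z hz hzX hzY h1 h2 z' hz' hzX' hzY' hzz h1' x hx hzx
    obtain ⟨x', hx', hxx⟩ := Finset.exists_mem_ne (show 1 < X.card by omega) x
    exact hnoB (hasCycleOn_of_two_links hY hX (fun y hy hx => hdisj y hx hy) hYA' hXA' hzY hzX hz
      hzY' hzX' hz' hzz h2 h1' hx' hx hxx (h1 x' hx') hzx (by omega) (by omega) (by omega))
  -- The extended cliques, without the vertices that are blue to everything.
  set X1 := A.filter fun z => z ∈ X ∨ (z ∉ X ∧ z ∉ Y ∧ (∀ x ∈ X, B.Adj z x) ∧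
    ¬ ∀ y ∈ Y, B.Adj z y) with hX1
  set Y1 := A.filter fun z => z ∈ Y ∨ (z ∉ X ∧ z ∉ Y ∧ (∀ y ∈ Y, B.Adj z y) ∧
    ¬ ∀ x ∈ X, B.Adj z x) with hY1
  have hX1c : B.IsClique (X1 : Set V) := by
    intro a ha b hb hab
    simp only [hX1, Finset.coe_filter, Set.mem_ofPred_eq] at ha hb
    obtain ⟨haA, ha⟩ := ha
    obtain ⟨hbA, hb⟩ := hb
    rcases ha with ha | ⟨ha1, ha2, ha3, ha4⟩ <;> rcases hb with hb | ⟨hb1, hb2, hb3, hb4⟩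
    · exact hX ha hb hab
    · exact (hb3 a ha).symm
    · exact ha3 b hb
    · exact adj_of_same_side hRB hRXY hX hY hXA' hYA' hj hk hkX hkY hcard hnoR hnoB ha1 ha2 haA
        hb1 hb2 hbA hab ha3 hb3 ha4 hb4
  have hY1c : B.IsClique (Y1 : Set V) := by
    intro a ha b hb hab
    simp only [hY1, Finset.coe_filter, Set.mem_ofPred_eq] at ha hb
    obtain ⟨haA, ha⟩ := ha
    obtain ⟨hbA, hb⟩ := hb
    rcases ha with ha | ⟨ha1, ha2, ha3, ha4⟩ <;> rcases hb with hb | ⟨hb1, hb2, hb3, hb4⟩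
    · exact hY ha hb hab
    · exact (hb3 a ha).symm
    · exact ha3 b hb
    · exact adj_of_same_side hRB hRYX hY hX hYA' hXA' hj hk hkY hkX (by omega) hnoR hnoB ha2 ha1
        haA hb2 hb1 hbA hab ha3 hb3 ha4 hb4
  have hXY1 : ∀ x ∈ X1, x ∉ Y1 := by
    intro z hz hz'
    simp only [hX1, hY1, Finset.mem_filter] at hz hz'
    have := hdisj z
    tauto
  by_cases hf : ∃ f ∈ A, f ∉ X ∧ f ∉ Y ∧ (∀ x ∈ X, B.Adj f x) ∧ ∀ y ∈ Y, B.Adj f y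
  · obtain ⟨f, hfA, hfX, hfY, hf1, hf2⟩ := hf
    have hfX1 : f ∉ X1 := by simp only [hX1, Finset.mem_filter]; tauto
    have hfY1 : f ∉ Y1 := by simp only [hY1, Finset.mem_filter]; tauto
    have hcover : ∀ z ∈ A, z ≠ f → z ∈ X1 ∨ z ∈ Y1 := by
      intro z hz hzf
      by_cases hzX : z ∈ X
      · left; simp only [hX1, Finset.mem_filter]; tauto
      by_cases hzY : z ∈ Y
      · right; simp only [hY1, Finset.mem_filter]; tauto
      by_cases h1 : ∀ x ∈ X, B.Adj z x
      · by_cases h2 : ∀ y ∈ Y, B.Adj z y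
        · obtain ⟨y, hy⟩ := Finset.card_pos.1 (show 0 < Y.card by omega)
          exact absurd (h2 y hy) (hfreeX f hfA hfX hfY hf1 hf2 z hz hzX hzY hzf.symm h1 y hy)
        · left; simp only [hX1, Finset.mem_filter]; tauto
      · have h2 := (hside z hz hzX hzY).resolve_left h1
        right; simp only [hY1, Finset.mem_filter]; tauto
    have key : (∀ z ∈ X1, B.Adj f z) ∨ ∀ z ∈ Y1, B.Adj f z := by
      by_contra! hcon
      obtain ⟨⟨z, hz, hfz⟩, z', hz', hfz'⟩ := hcon
      have hzz : z ≠ z' := fun h => hXY1 z hz (h ▸ hz')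
      have hRz := (hRB f z fun h => hfX1 (h ▸ hz)).resolve_right hfz
      have hRz' := (hRB f z' fun h => hfY1 (h ▸ hz')).resolve_right hfz'
      simp only [hX1, hY1, Finset.mem_filter] at hz hz'
      obtain ⟨hzA, hz⟩ := hz
      obtain ⟨hzA', hz'⟩ := hz'
      have hz2 := hz.resolve_left fun h => hfz (hf1 z h)
      have hz2' := hz'.resolve_left fun h => hfz' (hf2 z' h)
      obtain ⟨a1, a2, a3, a4⟩ := hz2
      obtain ⟨b1, b2, b3, b4⟩ := hz2'
      refine hnoR (hasCycleOn_of_outer_path hRXY hXA' hYA' hfX hfY hfA a1 a2 hzA b1 b2 hzA' hzz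
        hRz hRz' ?_ ?_ hk hkX hkY)
      · intro y hy
        exact (hRB z y fun h => a2 (h ▸ hy)).resolve_right
          (hfreeX f hfA hfX hfY hf1 hf2 z hzA a1 a2 hRz.ne a3 y hy)
      · intro x hx
        exact (hRB z' x fun h => b1 (h ▸ hx)).resolve_right
          (hfreeY f hfA hfX hfY hf1 hf2 z' hzA' b1 b2 hRz'.ne b3 x hx)
    have hins : ∀ Z : Finset V, B.IsClique (Z : Set V) → (∀ z ∈ Z, B.Adj f z) →
        B.IsClique ((insert f Z : Finset V) : Set V) := by
      intro Z hZ hfZ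
      rw [Finset.coe_insert]
      exact hZ.insert fun b hb _ => hfZ b hb
    rcases key with key | key
    · refine ⟨insert f X1, Y1, ?_, ?_, hins X1 hX1c key, hY1c⟩
      · ext z
        simp only [Finset.mem_union, Finset.mem_insert]
        constructor
        · rintro ((rfl | h) | h)
          exacts [hfA, (Finset.mem_filter.1 h).1, (Finset.mem_filter.1 h).1]
        · intro h
          by_cases hzf : z = f
          · exact Or.inl (Or.inl hzf)
          · exact (hcover z h hzf).imp Or.inr id
      · intro z hz
        rcases Finset.mem_insert.1 hz with rfl | hz
        exacts [hfY1, hXY1 z hz]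
    · refine ⟨X1, insert f Y1, ?_, ?_, hX1c, hins Y1 hY1c key⟩
      · ext z
        simp only [Finset.mem_union, Finset.mem_insert]
        constructor
        · rintro (h | rfl | h)
          exacts [(Finset.mem_filter.1 h).1, hfA, (Finset.mem_filter.1 h).1]
        · intro h
          by_cases hzf : z = f
          · exact Or.inr (Or.inl hzf)
          · exact (hcover z h hzf).imp id Or.inr
      · intro z hz hz'
        rcases Finset.mem_insert.1 hz' with rfl | hz'
        exacts [hfX1 hz, hXY1 z hz hz']
  · refine ⟨X1, Y1, ?_, hXY1, hX1c, hY1c⟩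
    ext z
    simp only [Finset.mem_union]
    constructor
    · rintro (h | h)
      exacts [(Finset.mem_filter.1 h).1, (Finset.mem_filter.1 h).1]
    · intro hz
      by_cases hzX : z ∈ X
      · left; simp only [hX1, Finset.mem_filter]; tauto
      by_cases hzY : z ∈ Y
      · right; simp only [hY1, Finset.mem_filter]; tauto
      by_cases h1 : ∀ x ∈ X, B.Adj z x
      · by_cases h2 : ∀ y ∈ Y, B.Adj z y
        · exact absurd ⟨z, hz, hzX, hzY, h1, h2⟩ hf
        · left; simp only [hX1, Finset.mem_filter]; tauto
      · have h2 := (hside z hz hzX hzY).resolve_left h1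
        right; simp only [hY1, Finset.mem_filter]; tauto

end Glue

/-! ### Growing a blue even cycle -/

section Grow

variable {V : Type*} [DecidableEq V] {R B : SimpleGraph V} {A : Finset V}

/-- The vertices of `A` outside the cycle `f` that can be inserted at one place at most. -/
noncomputable def attachable (B : SimpleGraph V) (A : Finset V) {L : ℕ} [NeZero L]
    (f : ZMod L → V) : Finset V :=
  (A \ Finset.univ.image f).filter fun w => (succIn (nbrPos B f w) (nbrPos B f w)).card ≤ 1

theorem mem_attachable {L : ℕ} [NeZero L] {f : ZMod L → V} {w : V} :
    w ∈ attachable B A f ↔ w ∈ A ∧ w ∉ Set.range f ∧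
      (succIn (nbrPos B f w) (nbrPos B f w)).card ≤ 1 := by
  simp [attachable, and_assoc]

theorem card_outside {L : ℕ} [NeZero L] {f : ZMod L → V} (hf : IsCycleMap B (A : Set V) f) :
    (A \ Finset.univ.image f).card + L = A.card := by
  have h1 : Finset.univ.image f ⊆ A := fun v hv => by
    obtain ⟨i, -, rfl⟩ := Finset.mem_image.1 hv
    exact hf.mem i
  have h2 : (Finset.univ.image f).card = L := by
    rw [Finset.card_image_of_injective _ hf.inj, Finset.card_univ, ZMod.card]
  have h3 := Finset.card_sdiff_add_card_eq_card h1
  omega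

theorem card_le_card_attachable {L : ℕ} [NeZero L] {f : ZMod L → V}
    (hf : IsCycleMap B (A : Set V) f) (hno : ¬ HasCycleOn B (A : Set V) (L + 2)) :
    A.card ≤ L + (attachable B A f).card + 1 := by
  have h1 := card_outside hf
  have h2 : ((A \ Finset.univ.image f).filter fun w =>
      ¬ (succIn (nbrPos B f w) (nbrPos B f w)).card ≤ 1).card ≤ 1 := by
    rw [Finset.card_le_one]
    intro a ha b hb
    simp only [Finset.mem_filter, Finset.mem_sdiff, Finset.mem_image, Finset.mem_univ, true_and,
      not_le] at ha hb
    exact hf.eq_of_one_lt_card_gaps hno ha.1.1 hb.1.1 (by simpa using ha.1.2) (by simpa using hb.1.2)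
      ha.2 (Finset.card_pos.1 (by omega))
  have h3 := Finset.card_filter_add_card_filter_not (s := A \ Finset.univ.image f)
    fun w => (succIn (nbrPos B f w) (nbrPos B f w)).card ≤ 1
  rw [attachable]
  omega

section Even

variable {t k : ℕ} [NeZero (2 * t)] {f : ZMod (2 * t) → V}

/-- Outside a blue `C_{2t}` that cannot be enlarged to `C_{2t+2}`, a red edge closes a red cycle
`C_{2k+1}` whose other vertices alternate between the outside and the cycle. -/
theorem isClique_attachable (hRB : ∀ x y, x ≠ y → R.Adj x y ∨ B.Adj x y)
    (hf : IsCycleMap B (A : Set V) f) (ht : 2 ≤ t) (hk : 1 ≤ k) (hkt : k ≤ t)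
    (hA : 3 * t + 2 ≤ A.card) (hnoR : ¬ HasCycleOn R (A : Set V) (2 * k + 1))
    (hnoB : ¬ HasCycleOn B (A : Set V) (2 * t + 2)) :
    B.IsClique (attachable B A f : Set V) := by
  have hBR : ∀ x y, x ≠ y → B.Adj x y ∨ R.Adj x y := fun x y h => (hRB x y h).symm
  set W := attachable B A f with hW
  have hWc : t + 1 ≤ W.card := by
    have := card_le_card_attachable hf hnoB
    rw [← hW] at this
    omega
  have hWA : ∀ w ∈ W, w ∈ (A : Set V) := fun w hw => (mem_attachable.1 hw).1
  have hWf : ∀ w ∈ W, w ∉ Set.range f := fun w hw => (mem_attachable.1 hw).2.1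
  have hWg : ∀ w ∈ W, (succIn (nbrPos B f w) (nbrPos B f w)).card ≤ 1 :=
    fun w hw => (mem_attachable.1 hw).2.2
  have hfA : ∀ i, f i ∈ (A : Set V) := hf.mem
  have hc : ∀ x ∈ W, ∀ y ∈ W, x ≠ y → t - 1 ≤ (nonNbrPos B f x y).card := by
    intro x hx y hy hxy
    have := hf.le_two_mul_card_nonNbrPos hnoB hxy (hWA x hx) (hWA y hy) (hWf x hx) (hWf y hy)
      (hWg x hx) (hWg y hy)
    omega
  have hcB : ∀ x ∈ W, ∀ y ∈ W, B.Adj x y → t ≤ (nonNbrPos B f x y).card := by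
    intro x hx y hy hxy
    have := hf.le_two_mul_card_nonNbrPos_of_adj hnoB hxy (hWA x hx) (hWA y hy) (hWf x hx)
      (hWf y hy) (hWg x hx) (hWg y hy)
    omega
  intro w hw w' hw' hww
  by_contra hB
  have hR := (hRB w w' hww).resolve_right hB
  rcases hkt.lt_or_eq with hkt | rfl
  · obtain ⟨us, hus, hlen, husW⟩ := exists_path_of_clique (G := ⊤) (X := W) (fun a _ b _ h => h)
      hw hw' hww (m := k + 1) (by omega) (by omega)
    obtain ⟨l, hl, hll, S, -, -, hlS⟩ := exists_path_through_cycle hf hBR us hus.nodup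
      (fun x hx => hWf x (husW x hx)) ∅ hus.head hus.last (fun x hx y hy hxy => by
        have := hc x (husW x hx) y (husW y hy) hxy
        rw [Finset.sdiff_empty]
        omega)
    refine hnoR ⟨w, w', l, hl, hR.symm, by omega, fun v hv => ?_⟩
    rcases hlS v hv with h | ⟨i, -, rfl⟩
    exacts [hWA v (husW v h), hfA i]
  -- A link with a connector to spare at an end of a red edge suffices.
  have hlink : ∀ x ∈ W, ∀ y ∈ W, ∀ z ∈ W, z ≠ x → z ≠ y → R.Adj x y →
      (nonNbrPos B f x z).card < k := by
    intro x hx y hy z hz hzx hzy hxy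
    by_contra! hcon
    have h1 : (W.erase x).card = W.card - 1 := Finset.card_erase_of_mem hx
    obtain ⟨us, hus, hlen, husW⟩ := exists_path_of_clique (G := ⊤) (X := W.erase x)
      (fun a _ b _ h => h) (Finset.mem_erase.2 ⟨hzx, hz⟩) (Finset.mem_erase.2 ⟨hxy.ne.symm, hy⟩)
      hzy (m := k) (by omega) (by omega)
    have husW' : ∀ v ∈ us, v ∈ W := fun v hv => Finset.mem_of_mem_erase (husW v hv)
    obtain ⟨l, hl, hll, hlS⟩ := exists_path_through_cycle_of_link hf hBR us hus.nodup
      (fun v hv => hWf v (husW' v hv)) (hWf x hx)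
      (fun h => Finset.notMem_erase x W (husW x h)) hus.head hus.last ∅ (fun a ha b hb hab => by
        have := hc a (husW' a ha) b (husW' b hb) hab
        rw [Finset.sdiff_empty]
        omega) (by rw [Finset.sdiff_empty]; omega)
    refine hnoR ⟨x, y, l, hl, hxy.symm, by omega, fun v hv => ?_⟩
    rcases hlS v hv with rfl | h | ⟨i, -, rfl⟩
    exacts [hWA _ hx, hWA v (husW' v h), hfA i]
  have hspread : ∀ x ∈ W, ∀ y ∈ W, ∀ z ∈ W, z ≠ x → R.Adj x y → R.Adj x z := by
    intro x hx y hy z hz hzx hxy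
    by_cases hzy : z = y
    · exact hzy ▸ hxy
    · refine (hRB x z hzx.symm).resolve_right fun h => ?_
      have h1 := hlink x hx y hy z hz hzx hzy hxy
      have h2 := hcB x hx z hz h
      omega
  have hred : ∀ x ∈ W, ∀ y ∈ W, x ≠ y → R.Adj x y := by
    intro x hx y hy hxy
    by_cases hxw : x = w
    · exact hspread x hx w' hw' y hy hxy.symm (hxw ▸ hR)
    · exact hspread x hx w hw y hy hxy.symm (hspread w hw w' hw' x hx hxw hR).symm
  obtain ⟨a, ha, haw, haw'⟩ : ∃ a ∈ W, a ≠ w ∧ a ≠ w' := by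
    have h1 := Finset.card_erase_of_mem hw
    have h2 := Finset.card_erase_of_mem (Finset.mem_erase.2 ⟨hww.symm, hw'⟩)
    obtain ⟨a, ha⟩ := Finset.card_pos.1 (show 0 < ((W.erase w).erase w').card by omega)
    simp only [Finset.mem_erase] at ha
    exact ⟨a, ha.2.2, ha.2.1, ha.1⟩
  have hmem : ∀ x ∈ ({w, w', a} : Set V), x ∈ W := by
    rintro x (rfl | rfl | rfl) <;> assumption
  obtain ⟨x, hx, y, hy, z, hz, hxy, hyz, hxz, q, hq, hqc⟩ := exists_perm_of_links
    (nonNbrPos B f) nonNbrPos_comm hww haw'.symm haw.symm (m := k - 1) (by omega)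
    (hc w hw w' hw' hww) (hc w' hw' a ha haw'.symm) (hc w hw a ha haw.symm) (by
      rintro ⟨e1, e2, e3⟩
      have h1 := card_nonNbrPos (G := B) (f := f) w' a
      have h2 := two_mul_card_le (nbrPos B f w' ∪ nbrPos B f a)
      obtain ⟨p, hp, p', hp', hpp⟩ := Finset.one_lt_card.1 (show 1 < (succIn
        (nbrPos B f w' ∪ nbrPos B f a) (nbrPos B f w' ∪ nbrPos B f a)).card by omega)
      have key : ∀ p ∈ succIn (nbrPos B f w' ∪ nbrPos B f a) (nbrPos B f w' ∪ nbrPos B f a),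
          ∃ x ∈ W, p ∈ succIn (nbrPos B f x) (nbrPos B f x) := by
        intro p hp
        rcases IsCycleMap.exists_gap_of_nonNbrPos_eq e1 e2 hp with h | h | h
        exacts [⟨w, hw, h⟩, ⟨w', hw', h⟩, ⟨a, ha, h⟩]
      obtain ⟨x, hx, hpx⟩ := key p hp
      obtain ⟨y, hy, hpy⟩ := key p' hp'
      by_cases hxy : x = y
      · subst hxy
        exact hpp (Finset.card_le_one.1 (hWg x hx) p hpx p' hpy)
      · exact hpp (hf.eq_of_mem_gaps hnoB hxy (hWA x hx) (hWA y hy) (hWf x hx) (hWf y hy) hpx hpy))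
  have hx := hmem x hx
  have hy := hmem y hy
  have hz := hmem z hz
  have h1 := Finset.card_erase_of_mem hx
  have h2 := Finset.card_erase_of_mem (Finset.mem_erase.2 ⟨hxy.symm, hy⟩)
  obtain ⟨us, u, hus, hhd, hlast, hlen, husW⟩ := exists_list_of_mem (X := (W.erase x).erase y)
    (x := z) (by simp [hz, hyz.symm, hxz.symm]) (n := k - 1) (by omega) (by omega)
  have husW' : ∀ v ∈ us, v ≠ y ∧ v ≠ x ∧ v ∈ W := fun v hv => by simpa using husW v hv
  have hsd : ∀ S : Finset (ZMod (2 * k)), S \ {q} = S.erase q := fun S => Finset.sdiff_singleton_eq_erase q S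
  obtain ⟨l, hl, hll, hlS⟩ := exists_path_through_cycle_of_link hf hBR us hus
    (fun v hv => hWf v (husW' v hv).2.2) (hWf y hy) (fun h => (husW' y h).1 rfl) hhd hlast {q}
    (fun a ha b hb hab => by
      have := hc a (husW' a ha).2.2 b (husW' b hb).2.2 hab
      have h3 := Finset.pred_card_le_card_erase (s := nonNbrPos B f a b) (a := q)
      rw [hsd]
      omega) (by rw [hsd]; omega)
  have hu := husW' u (List.mem_of_getLast? hlast)
  rw [mem_nonNbrPos] at hq
  have hxq := (hRB x (f q) fun h => hWf x hx ⟨q, h.symm⟩).resolve_right hq.1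
  have hyq := (hRB y (f q) fun h => hWf y hy ⟨q, h.symm⟩).resolve_right hq.2
  refine hnoR (hasCycleOn_of_two_paths hl ((IsPathList.singleton R (f q)).cons hxq
    (by simpa using hxq.ne)) (hred u hu.2.2 x hx hu.2.1) hyq.symm ?_ (by simp; omega) ?_ ?_)
  · intro v hv hv'
    simp only [List.mem_cons, List.not_mem_nil, or_false] at hv'
    rcases hlS v hv with rfl | h | ⟨i, hi, rfl⟩
    · rcases hv' with rfl | h
      exacts [hxy rfl, hWf _ hy ⟨q, h.symm⟩]
    · rcases hv' with rfl | h'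
      exacts [(husW' _ h).2.1 rfl, hWf _ (husW' _ h).2.2 ⟨q, h'.symm⟩]
    · rcases hv' with h | h
      · exact hWf _ hx ⟨i, h⟩
      · exact hi (by simpa using hf.inj h)
  · intro v hv
    rcases hlS v hv with rfl | h | ⟨i, -, rfl⟩
    exacts [hWA _ hy, hWA v (husW' v h).2.2, hfA i]
  · intro v hv
    simp only [List.mem_cons, List.not_mem_nil, or_false] at hv
    rcases hv with rfl | rfl
    exacts [hWA _ hx, hfA q]

/-- A set of at least `3t + 2` vertices with a blue `C_{2t}`, but without blue `C_{2t+2}` and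
without red `C_{2k+1}`, is a union of two blue cliques. -/
theorem isTwoCliques_of_cycleMap (hRB : ∀ x y, x ≠ y → R.Adj x y ∨ B.Adj x y)
    (hf : IsCycleMap B (A : Set V) f) (ht : 2 ≤ t) (hk : 2 ≤ k) (hkt : k ≤ t)
    (hA : 3 * t + 2 ≤ A.card) (hnoR : ¬ HasCycleOn R (A : Set V) (2 * k + 1))
    (hnoB : ¬ HasCycleOn B (A : Set V) (2 * t + 2)) : IsTwoCliques B A := by
  have hclique := isClique_attachable hRB hf ht (by omega) hkt hA hnoR hnoB
  set W := attachable B A f with hW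
  have hWc : t + 1 ≤ W.card := by
    have := card_le_card_attachable hf hnoB
    rw [← hW] at this
    omega
  have hWA : W ⊆ A := fun w hw => (mem_attachable.1 hw).1
  have hWf : ∀ w ∈ W, w ∉ Set.range f := fun w hw => (mem_attachable.1 hw).2.1
  set Q := Finset.univ.image f with hQ
  have hQc : Q.card = 2 * t := by
    rw [hQ, Finset.card_image_of_injective _ hf.inj, Finset.card_univ, ZMod.card]
  have hQA : Q ⊆ A := fun v hv => by
    obtain ⟨i, -, rfl⟩ := Finset.mem_image.1 hv
    exact hf.mem i
  have hQW : ∀ v ∈ Q, v ∉ W := fun v hv hv' => by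
    obtain ⟨i, -, rfl⟩ := Finset.mem_image.1 hv
    exact hWf _ hv' ⟨i, rfl⟩
  have : Nonempty V := ⟨f 0⟩
  obtain ⟨v, hv⟩ := exists_star_center (X := W) (Y := Q) B.Adj (by
    intro w hw w' hw' y hy y' hy' hww hyy hwy hwy'
    obtain ⟨i, -, rfl⟩ := Finset.mem_image.1 hy
    obtain ⟨i', -, rfl⟩ := Finset.mem_image.1 hy'
    obtain ⟨l, hl, hl1, hl2, hlf⟩ := hf.exists_long_arc (i := i) (j := i')
      fun h => hyy (h ▸ rfl)
    obtain ⟨l', hl', hll', hlW⟩ := exists_path_of_clique (fun a ha b hb h => hclique ha hb h)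
      hw' hw hww.symm (m := 2 * t + 2 - l.length) (by omega) (by omega)
    refine hnoB (hasCycleOn_of_two_paths hl hl' hwy'.symm hwy ?_ (by omega) ?_ ?_)
    · intro v hv hv'
      exact hWf v (hlW v hv') (hlf v hv)
    · intro v hv
      obtain ⟨a, rfl⟩ := hlf v hv
      exact hf.mem a
    · intro v hv
      exact hWA (hlW v hv))
  have hRQW : ∀ x ∈ Q.erase v, ∀ y ∈ W.erase v, R.Adj x y := by
    intro x hx y hy
    rw [Finset.mem_erase] at hx hy
    refine (hRB x y fun h => hQW x hx.2 (h ▸ hy.2)).resolve_right fun h => ?_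
    rcases hv y hy.2 x hx.2 h.symm with h | h
    exacts [hy.1 h, hx.1 h]
  have hQ1 := Finset.pred_card_le_card_erase (s := Q) (a := v)
  have hW1 := Finset.pred_card_le_card_erase (s := W) (a := v)
  have hsum : 3 * t ≤ (Q.erase v).card + (W.erase v).card := by
    by_cases hvQ : v ∈ Q
    · rw [Finset.erase_eq_of_notMem (hQW v hvQ)]
      omega
    · rw [Finset.erase_eq_of_notMem hvQ]
      omega
  have hQA' : ∀ x ∈ Q.erase v, x ∈ (A : Set V) := fun x hx => hQA (Finset.mem_of_mem_erase hx)
  have hWA' : ∀ x ∈ W.erase v, x ∈ (A : Set V) := fun x hx => hWA (Finset.mem_of_mem_erase hx)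
  have hQcl : B.IsClique ((Q.erase v : Finset V) : Set V) := by
    intro x hx y hy hxy
    refine (hRB x y hxy).resolve_left fun h => ?_
    exact hnoR (hasCycleOn_of_edge_in_side hRQW hQA' hWA' hx hy h (by omega) (by omega) (by omega))
  exact isTwoCliques_of_core (j := t + 1) hRB hRQW hQcl
    (hclique.subset (by simp)) (fun x hx => hQA' x hx) (fun x hx => hWA' x hx)
    (by omega) hk (by omega) (by omega) (by omega) hnoR hnoB

end Even
end Grow

/-! ### A red odd cycle that cannot be enlarged -/

section Odd

variable {V : Type*} [DecidableEq V] {R B : SimpleGraph V} {A : Finset V}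

/-- A blue path of outside vertices is closed up by a blue path that alternates between the outside
and the red cycle `f`. -/
theorem hasCycleOn_of_inner_path {L : ℕ} [NeZero L] {f : ZMod L → V}
    (hRB : ∀ x y, x ≠ y → R.Adj x y ∨ B.Adj x y) (hf : IsCycleMap R (A : Set V) f)
    {Z : Finset V} (hZA : Z ⊆ A) (hZf : ∀ z ∈ Z, z ∉ Set.range f) {n : ℕ}
    (hc : ∀ x ∈ Z, ∀ y ∈ Z, x ≠ y → n - 1 ≤ (nonNbrPos R f x y).card) {a b e e' : V}
    {l : List V} (hl : IsPathList B a b l) (hlZ : ∀ v ∈ l, v ∈ Z) (he : e ∈ Z) (he' : e' ∈ Z)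
    (hel : e ∉ l) (hel' : e' ∉ l) (hee : e ≠ e') (hea : B.Adj e a) (hbe : B.Adj b e')
    (hn : 2 ≤ n) (hnl : n + l.length ≤ Z.card) :
    HasCycleOn B (A : Set V) (2 * n - 1 + l.length) := by
  have h1 : (Z \ l.toFinset).card = Z.card - l.length := by
    rw [Finset.card_sdiff_of_subset (fun v hv => hlZ v (List.mem_toFinset.1 hv)),
      List.toFinset_card_of_nodup hl.nodup]
  obtain ⟨us, hus, hlen, husW⟩ := exists_path_of_clique (G := ⊤) (X := Z \ l.toFinset)
    (fun a _ b _ h => h) (x := e') (y := e) (by simp [he', hel']) (by simp [he, hel])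
    hee.symm (m := n) (by omega) (by omega)
  have husZ : ∀ v ∈ us, v ∈ Z ∧ v ∉ l := fun v hv => by simpa using husW v hv
  obtain ⟨p, hp, hpl, S, -, -, hpS⟩ := exists_path_through_cycle hf hRB us hus.nodup
    (fun v hv => hZf v (husZ v hv).1) ∅ hus.head hus.last (fun x hx y hy hxy => by
      rw [Finset.sdiff_empty, hlen]
      exact hc x (husZ x hx).1 y (husZ y hy).1 hxy)
  refine hasCycleOn_of_two_paths hp hl hea hbe ?_ (by omega) ?_ (fun v hv => hZA (hlZ v hv))
  · intro v hv hv'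
    rcases hpS v hv with h | ⟨i, -, rfl⟩
    exacts [(husZ v h).2 hv', hZf _ (hlZ _ hv') ⟨i, rfl⟩]
  · intro v hv
    rcases hpS v hv with h | ⟨i, -, rfl⟩
    exacts [hZA (husZ v h).1, hf.mem i]

/-- The outside of a red `C_{2s+1}` that cannot be enlarged to a red `C_{2s+3}`: its vertices miss
so many common vertices of the cycle that there is a blue `C_{2s+2}`. -/
theorem hasCycleOn_of_odd_cycleMap {s : ℕ} {f : ZMod (2 * s + 1) → V}
    (hRB : ∀ x y, x ≠ y → R.Adj x y ∨ B.Adj x y) (hf : IsCycleMap R (A : Set V) f)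
    (hs : 2 ≤ s) (hA : 3 * s + 5 ≤ A.card) (hno : ¬ HasCycleOn R (A : Set V) (2 * s + 1 + 2)) :
    HasCycleOn B (A : Set V) (2 * s + 2) := by
  set Z := A \ Finset.univ.image f with hZ
  have hZc : s + 4 ≤ Z.card := by
    have : Z.card + (2 * s + 1) = A.card := by convert card_outside hf
    omega
  have hZA : Z ⊆ A := Finset.sdiff_subset
  have hZA' : ∀ z ∈ Z, z ∈ (A : Set V) := fun z hz => hZA hz
  have hZf : ∀ z ∈ Z, z ∉ Set.range f := fun z hz => by
    rw [hZ, Finset.mem_sdiff] at hz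
    simpa using hz.2
  set gap : V → Finset (ZMod (2 * s + 1)) := fun w => succIn (nbrPos R f w) (nbrPos R f w) with hgap
  set J := Z.filter fun z => gap z = ∅ with hJ
  set I := Z.filter fun z => ¬ gap z = ∅ with hI
  have hIJ : J.card + I.card = Z.card := Finset.card_filter_add_card_filter_not _
  have hJZ : J ⊆ Z := Finset.filter_subset _ _
  have hIZ : I ⊆ Z := Finset.filter_subset _ _
  have hJg : ∀ z ∈ J, gap z = ∅ := fun z hz => (Finset.mem_filter.1 hz).2
  have hIg : ∀ z ∈ I, (gap z).Nonempty := fun z hz =>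
    Finset.nonempty_iff_ne_empty.2 (Finset.mem_filter.1 hz).2
  have hJc : ∀ x ∈ J, ∀ y ∈ J, x ≠ y → s ≤ (nonNbrPos R f x y).card := by
    intro x hx y hy hxy
    have := hf.le_two_mul_card_nonNbrPos_of_gaps_eq_empty hno hxy (hZA' x (hJZ hx))
      (hZA' y (hJZ hy)) (hZf x (hJZ hx)) (hZf y (hJZ hy)) (hJg x hx) (hJg y hy)
    omega
  by_cases hJs : s + 1 ≤ J.card
  · -- `s + 1` vertices of `J` and `s + 1` connectors on the cycle.
    obtain ⟨a, b, c, ha, hb, hc, hab, hac, hbc⟩ := Finset.two_lt_card_iff.1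
      (show 2 < J.card by omega)
    have hmem : ∀ x ∈ ({a, b, c} : Set V), x ∈ J := by
      rintro x (rfl | rfl | rfl) <;> assumption
    obtain ⟨x, hx, y, hy, z, hz, hxy, hyz, hxz, q, hq, hqc⟩ := exists_perm_of_links
      (nonNbrPos R f) nonNbrPos_comm hab hbc hac (m := s) (by omega)
      (hJc a ha b hb hab) (hJc b hb c hc hbc) (hJc a ha c hc hac) (by
        rintro ⟨e1, e2, e3⟩
        have h1 := card_nonNbrPos (G := R) (f := f) b c
        have h2 := two_mul_card_le (nbrPos R f b ∪ nbrPos R f c)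
        obtain ⟨p, hp⟩ := Finset.card_pos.1 (show 0 < (succIn
          (nbrPos R f b ∪ nbrPos R f c) (nbrPos R f b ∪ nbrPos R f c)).card by omega)
        rcases IsCycleMap.exists_gap_of_nonNbrPos_eq e1 e2 hp with h | h | h
        exacts [Finset.notMem_empty p (hJg a ha ▸ h), Finset.notMem_empty p (hJg b hb ▸ h),
          Finset.notMem_empty p (hJg c hc ▸ h)])
    have hx := hmem x hx
    have hy := hmem y hy
    have hz := hmem z hz
    have h1 := Finset.card_erase_of_mem hy
    obtain ⟨us, hus, hlen, husW⟩ := exists_path_of_clique (G := ⊤) (X := J.erase y)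
      (fun a _ b _ h => h) (Finset.mem_erase.2 ⟨hyz.symm, hz⟩) (Finset.mem_erase.2 ⟨hxy, hx⟩)
      hxz.symm (m := s) (by omega) (by omega)
    have husJ : ∀ v ∈ us, v ≠ y ∧ v ∈ J := fun v hv => by simpa using husW v hv
    obtain ⟨l, hl, hll, hlS⟩ := exists_path_through_cycle_of_link hf hRB us hus.nodup
      (fun v hv => hZf v (hJZ (husJ v hv).2)) (hZf y (hJZ hy)) (fun h => (husJ y h).1 rfl)
      hus.head hus.last {q}
      (fun a ha b hb hab => by
        have := hJc a (husJ a ha).2 b (husJ b hb).2 hab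
        have h3 := Finset.pred_card_le_card_erase (s := nonNbrPos R f a b) (a := q)
        rw [Finset.sdiff_singleton_eq_erase]
        omega) (by rw [Finset.sdiff_singleton_eq_erase]; omega)
    rw [mem_nonNbrPos] at hq
    have hxq := (hRB x (f q) fun h => hZf x (hJZ hx) ⟨q, h.symm⟩).resolve_left hq.1
    have hyq := (hRB y (f q) fun h => hZf y (hJZ hy) ⟨q, h.symm⟩).resolve_left hq.2
    refine hasCycleOn_of_two_paths hl (IsPathList.singleton B (f q)) hxq hyq.symm ?_
      (by simp; omega) ?_ ?_
    · intro v hv hv'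
      obtain rfl := List.mem_singleton.1 hv'
      rcases hlS _ hv with h | h | ⟨i, hi, h⟩
      · exact hZf _ (hJZ hy) ⟨q, h⟩
      · exact hZf _ (hJZ (husJ _ h).2) ⟨q, rfl⟩
      · exact hi (by simpa using hf.inj h)
    · intro v hv
      rcases hlS v hv with rfl | h | ⟨i, -, rfl⟩
      exacts [hZA' _ (hJZ hy), hZA' v (hJZ (husJ v h).2), hf.mem i]
    · intro v hv
      obtain rfl := List.mem_singleton.1 hv
      exact hf.mem q
  have hI4 : 4 ≤ I.card := by omega
  have hgI : ∀ x ∈ I, (gap x).card ≤ 1 := by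
    intro x hx
    by_contra! hcon
    have h1 : I ⊆ {x} := fun y hy => Finset.mem_singleton.2
      (hf.eq_of_one_lt_card_gaps hno (hZA' x (hIZ hx)) (hZA' y (hIZ hy)) (hZf x (hIZ hx))
        (hZf y (hIZ hy)) hcon (hIg y hy)).symm
    have := Finset.card_le_card h1
    rw [Finset.card_singleton] at this
    omega
  have hgZ : ∀ x ∈ Z, (gap x).card ≤ 1 := by
    intro x hx
    by_cases h : gap x = ∅
    · simp [h]
    · exact hgI x (Finset.mem_filter.2 ⟨hx, h⟩)
  obtain ⟨p, hp⟩ : ∃ p, ∀ x ∈ I, p ∈ gap x := by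
    obtain ⟨x, hx⟩ := Finset.card_pos.1 (show 0 < I.card by omega)
    obtain ⟨p, hp⟩ := hIg x hx
    refine ⟨p, fun y hy => ?_⟩
    by_cases hxy : x = y
    · exact hxy ▸ hp
    · obtain ⟨q, hq⟩ := hIg y hy
      rw [hf.eq_of_mem_gaps hno hxy (hZA' x (hIZ hx)) (hZA' y (hIZ hy)) (hZf x (hIZ hx))
        (hZf y (hIZ hy)) hp hq]
      exact hq
  have hIB : ∀ x ∈ I, ∀ y ∈ I, x ≠ y → B.Adj x y := by
    intro x hx y hy hxy
    refine (hRB x y hxy).resolve_left fun h => ?_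
    have h1 := hf.succIn_eq_empty hno h (hZA' x (hIZ hx)) (hZA' y (hIZ hy)) (hZf x (hIZ hx))
      (hZf y (hIZ hy))
    refine Finset.notMem_empty p (h1 ▸ mem_succIn.2 ⟨?_, ?_⟩)
    exacts [(mem_succIn.1 (hp x hx)).1, (mem_succIn.1 (hp y hy)).2]
  by_cases hmix : ∃ u ∈ I, ∃ z ∈ J, B.Adj u z
  · obtain ⟨u, hu, z, hz, huz⟩ := hmix
    have h1 := Finset.card_erase_of_mem hu
    obtain ⟨a, b, c, ha, hb, hc, hab, hac, hbc⟩ := Finset.two_lt_card_iff.1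
      (show 2 < (I.erase u).card by omega)
    rw [Finset.mem_erase] at ha hb hc
    have hzI : ∀ x ∈ I, x ≠ z := by
      rintro x hx rfl
      exact (Finset.mem_filter.1 hx).2 (hJg _ hz)
    have hl : IsPathList B u b [u, a, b] :=
      ((IsPathList.singleton B b).cons (hIB a ha.2 b hb.2 hab) (by simpa using hab)).cons
        (hIB u hu a ha.2 ha.1.symm) (by simp [ha.1.symm, hb.1.symm])
    have := hasCycleOn_of_inner_path hRB hf hZA hZf (n := s) (fun x hx y hy hxy => by
      have := hf.le_two_mul_card_nonNbrPos hno hxy (hZA' x hx) (hZA' y hy) (hZf x hx)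
        (hZf y hy) (hgZ x hx) (hgZ y hy)
      omega) hl (by simp [hIZ hu, hIZ ha.2, hIZ hb.2]) (hJZ hz) (hIZ hc.2)
      (by simp [(hzI u hu).symm, (hzI a ha.2).symm, (hzI b hb.2).symm])
      (by simp [hc.1, hac.symm, hbc.symm]) (hzI c hc.2).symm huz.symm (hIB b hb.2 c hc.2 hbc) hs
      (by simp; omega)
    rwa [show 2 * s - 1 + [u, a, b].length = 2 * s + 2 by simp; omega] at this
  · push Not at hmix
    obtain ⟨a, b, c, ha, hb, hc, hab, hac, hbc⟩ := Finset.two_lt_card_iff.1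
      (show 2 < I.card by omega)
    have hadj : ∀ x ∈ I, ∀ y ∈ J, R.Adj x y := fun x hx y hy =>
      (hRB x y (by rintro rfl; exact (Finset.mem_filter.1 hx).2 (hJg _ hy))).resolve_right
        (hmix x hx y hy)
    have hc' : ∀ x ∈ Z, ∀ y ∈ Z, x ≠ y → s ≤ (nonNbrPos R f x y).card := by
      intro x hx y hy hxy
      by_cases hxy' : R.Adj x y
      · have := hf.le_two_mul_card_nonNbrPos_of_adj hno hxy' (hZA' x hx) (hZA' y hy) (hZf x hx)
          (hZf y hy) (hgZ x hx) (hgZ y hy)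
        omega
      by_cases h1 : gap x = ∅ <;> by_cases h2 : gap y = ∅
      · exact hJc x (Finset.mem_filter.2 ⟨hx, h1⟩) y (Finset.mem_filter.2 ⟨hy, h2⟩) hxy
      · exact absurd (hadj y (Finset.mem_filter.2 ⟨hy, h2⟩) x
          (Finset.mem_filter.2 ⟨hx, h1⟩)).symm hxy'
      · exact absurd (hadj x (Finset.mem_filter.2 ⟨hx, h1⟩) y
          (Finset.mem_filter.2 ⟨hy, h2⟩)) hxy'
      · have := hf.le_two_mul_card_nonNbrPos_of_common_gap hno hxy (hZA' x hx) (hZA' y hy)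
          (hZf x hx) (hZf y hy) (hgZ x hx) (hgZ y hy) (hp x (Finset.mem_filter.2 ⟨hx, h1⟩))
          (hp y (Finset.mem_filter.2 ⟨hy, h2⟩))
        omega
    have := hasCycleOn_of_inner_path hRB hf hZA hZf (n := s + 1) (by simpa using hc')
      (IsPathList.singleton B b) (by simp [hIZ hb]) (hIZ ha) (hIZ hc) (by simpa using hab)
      (by simpa using hbc.symm) hac (hIB a ha b hb hab) (hIB b hb c hc hbc) (by omega)
      (by simp; omega)
    rwa [show 2 * (s + 1) - 1 + [b].length = 2 * s + 2 by simp; omega] at this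

end Odd

/-! ### Red pentagons and blue quadrilaterals on eight vertices -/

section Small

variable {V : Type*} [DecidableEq V] {R B : SimpleGraph V} {A : Finset V}

omit [DecidableEq V] in
theorem hasCycleOn_four {G : SimpleGraph V} {A : Set V} {a b c d : V} (hab : G.Adj a b)
    (hbc : G.Adj b c) (hcd : G.Adj c d) (hda : G.Adj d a) (hac : a ≠ c) (hbd : b ≠ d)
    (ha : a ∈ A) (hb : b ∈ A) (hc : c ∈ A) (hd : d ∈ A) : HasCycleOn G A 4 :=
  ⟨a, d, [a, b, c, d], ⟨by simp [hab.ne, hac, hda.ne.symm, hbc.ne, hbd, hcd.ne],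
    by simp [hab, hbc, hcd], rfl, rfl⟩, hda, rfl, by simp [ha, hb, hc, hd]⟩

omit [DecidableEq V] in
theorem hasCycleOn_five {G : SimpleGraph V} {A : Set V} {a b c d e : V} (hab : G.Adj a b)
    (hbc : G.Adj b c) (hcd : G.Adj c d) (hde : G.Adj d e) (hea : G.Adj e a) (hac : a ≠ c)
    (had : a ≠ d) (hbd : b ≠ d) (hbe : b ≠ e) (hce : c ≠ e)
    (ha : a ∈ A) (hb : b ∈ A) (hc : c ∈ A) (hd : d ∈ A) (he : e ∈ A) : HasCycleOn G A 5 :=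
  ⟨a, e, [a, b, c, d, e], ⟨by simp [hab.ne, hac, hea.ne.symm, hbc.ne, hbd, hcd.ne, had, hbe, hce,
    hde.ne], by simp [hab, hbc, hcd, hde], rfl, rfl⟩, hea, rfl, by simp [ha, hb, hc, hd, he]⟩

/-- With a red triangle: two outside vertices with the same two red neighbours on it force enough
blue edges. -/
theorem hasCycleOn_four_of_triangle (hRB : ∀ x y, x ≠ y → R.Adj x y ∨ B.Adj x y)
    (hA : 8 ≤ A.card) (hnoR : ¬ HasCycleOn R (A : Set V) 5) {x y z : V} (hx : x ∈ A) (hy : y ∈ A)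
    (hz : z ∈ A) (hxy : R.Adj x y) (hyz : R.Adj y z) (hxz : R.Adj x z) :
    HasCycleOn B (A : Set V) 4 := by
  by_contra hnoB
  -- Two vertices with the red neighbours `x` and `y`.
  have h1 : ∀ x ∈ A, ∀ y ∈ A, ∀ z ∈ A, R.Adj x y → R.Adj y z → R.Adj x z → ∀ w ∈ A, ∀ w' ∈ A,
      w ≠ w' → w ≠ z → w' ≠ z → R.Adj w x → R.Adj w y → R.Adj w' x → R.Adj w' y → False := by
    intro x hx y hy z hz hxy hyz hxz w hw w' hw' hww hwz hwz' h1 h2 h3 h4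
    set Z := A \ {x, y, z, w, w'} with hZ
    have hZc : 3 ≤ Z.card := by
      rw [hZ]
      have := Finset.le_card_sdiff {x, y, z, w, w'} A
      have := Finset.card_le_five (a := x) (b := y) (c := z) (d := w) (e := w')
      omega
    have hZm : ∀ u ∈ Z, u ∈ A ∧ u ≠ x ∧ u ≠ y ∧ u ≠ z ∧ u ≠ w ∧ u ≠ w' := fun u hu => by
      simpa [hZ] using hu
    have hblue : ∀ u ∈ Z, R.Adj u x ∨ R.Adj u y → B.Adj w u ∧ B.Adj w' u := by
      intro u hu h
      obtain ⟨huA, hux, huy, huz, huw, huw'⟩ := hZm u hu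
      refine ⟨(hRB w u huw.symm).resolve_left fun h' => hnoR ?_,
        (hRB w' u huw'.symm).resolve_left fun h' => hnoR ?_⟩ <;> rcases h with h | h
      · exact hasCycleOn_five h' h hxz hyz.symm h2.symm h1.ne hwz huz huy hxy.ne hw huA hx hz hy
      · exact hasCycleOn_five h' h hyz hxz.symm h1.symm h2.ne hwz huz hux hxy.ne.symm hw huA hy hz hx
      · exact hasCycleOn_five h' h hxz hyz.symm h4.symm h3.ne hwz' huz huy hxy.ne hw' huA hx hz hy
      · exact hasCycleOn_five h' h hyz hxz.symm h3.symm h4.ne hwz' huz hux hxy.ne.symm hw' huA hy hz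
          hx
    classical
    have h5 : (Z.filter fun u => ¬ (R.Adj u x ∨ R.Adj u y)).card ≤ 1 := by
      rw [Finset.card_le_one]
      intro u hu v hv
      rw [Finset.mem_filter, not_or] at hu hv
      obtain ⟨huA, hux, huy, -⟩ := hZm u hu.1
      obtain ⟨hvA, hvx, hvy, -⟩ := hZm v hv.1
      by_contra huv
      exact hnoB (hasCycleOn_four ((hRB u x hux).resolve_left hu.2.1)
        ((hRB v x hvx).resolve_left hv.2.1).symm ((hRB v y hvy).resolve_left hv.2.2)
        ((hRB u y huy).resolve_left hu.2.2).symm huv hxy.ne huA hx hvA hy)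
    have h6 := Finset.card_filter_add_card_filter_not (s := Z) fun u => R.Adj u x ∨ R.Adj u y
    obtain ⟨u, hu, v, hv, huv⟩ := Finset.one_lt_card.1
      (show 1 < (Z.filter fun u => R.Adj u x ∨ R.Adj u y).card by omega)
    rw [Finset.mem_filter] at hu hv
    have hu' := hblue u hu.1 hu.2
    have hv' := hblue v hv.1 hv.2
    exact hnoB (hasCycleOn_four hu'.1 hu'.2.symm hv'.2 hv'.1.symm hww huv hw (hZm u hu.1).1 hw'
      (hZm v hv.1).1)
  have h2 : ∀ x ∈ A, ∀ y ∈ A, ∀ z ∈ A, R.Adj x y → R.Adj y z → R.Adj x z → ∀ w ∈ A, ∀ w' ∈ A,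
      w ≠ w' → w ≠ z → w' ≠ x → w' ≠ y → w' ≠ z → R.Adj w x → R.Adj w y →
      (R.Adj w' x ∧ R.Adj w' y ∨ R.Adj w' y ∧ R.Adj w' z ∨ R.Adj w' x ∧ R.Adj w' z) → False := by
    intro x hx y hy z hz hxy hyz hxz w hw w' hw' hww hwz hwx' hwy' hwz' h3 h4 h
    rcases h with ⟨h5, h6⟩ | ⟨h5, h6⟩ | ⟨h5, h6⟩
    · exact h1 x hx y hy z hz hxy hyz hxz w hw w' hw' hww hwz hwz' h3 h4 h5 h6
    · exact hnoR (hasCycleOn_five h3.symm h4 h5.symm h6 hxz.symm hxy.ne hwx'.symm hww hwz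
        hyz.ne hx hw hy hw' hz)
    · exact hnoR (hasCycleOn_five h4.symm h3 h5.symm h6 hyz.symm hxy.ne.symm hwy'.symm hww hwz
        hxz.ne hy hw hx hw' hz)
  set Z := A \ {x, y, z} with hZ
  have hZc : 5 ≤ Z.card := by
    rw [hZ]
    have := Finset.le_card_sdiff {x, y, z} A
    have := Finset.card_le_three (a := x) (b := y) (c := z)
    omega
  have hZm : ∀ u ∈ Z, u ∈ A ∧ u ≠ x ∧ u ≠ y ∧ u ≠ z := fun u hu => by simpa [hZ] using hu
  classical
  set P : V → Prop := fun u => R.Adj u x ∧ R.Adj u y ∨ R.Adj u y ∧ R.Adj u z ∨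
    R.Adj u x ∧ R.Adj u z with hP
  have h3 : (Z.filter P).card ≤ 1 := by
    rw [Finset.card_le_one]
    intro w hw w' hw'
    rw [Finset.mem_filter] at hw hw'
    obtain ⟨hwA, hwx, hwy, hwz⟩ := hZm w hw.1
    obtain ⟨hwA', hwx', hwy', hwz'⟩ := hZm w' hw'.1
    by_contra hww
    have hw2 := hw'.2
    rcases hw.2 with ⟨h4, h5⟩ | ⟨h4, h5⟩ | ⟨h4, h5⟩
    · exact h2 x hx y hy z hz hxy hyz hxz w hwA w' hwA' hww hwz hwx' hwy' hwz' h4 h5 hw2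
    · exact h2 y hy z hz x hx hyz hxz.symm hxy.symm w hwA w' hwA' hww hwx hwy' hwz' hwx' h4 h5
        (by simp only [hP] at hw2; tauto)
    · exact h2 x hx z hz y hy hxz hyz.symm hxy w hwA w' hwA' hww hwy hwx' hwz' hwy' h4 h5
        (by simp only [hP] at hw2; tauto)
  have h4 := Finset.card_filter_add_card_filter_not (s := Z) P
  obtain ⟨u, hu, v, hv, huv, he⟩ := Finset.exists_ne_map_eq_of_card_lt_of_maps_to
    (s := Z.filter fun u => ¬ P u) (t := Finset.range 3)
    (f := fun u => if B.Adj u x ∧ B.Adj u y then 0 else if B.Adj u y ∧ B.Adj u z then 1 else 2)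
    (by rw [Finset.card_range]; omega) (fun u _ => by dsimp only; split_ifs <;> simp)
  rw [Finset.mem_filter] at hu hv
  obtain ⟨huA, hux, huy, huz⟩ := hZm u hu.1
  obtain ⟨hvA, hvx, hvy, hvz⟩ := hZm v hv.1
  have key : ∀ p ∈ A, ∀ q ∈ A, p ≠ q → B.Adj u p → B.Adj u q → B.Adj v p → B.Adj v q → False :=
    fun p hp q hq hpq h1 h2 h3 h4 =>
      hnoB (hasCycleOn_four h1 h3.symm h4 h2.symm huv hpq huA hp hvA hq)
  have k1 := key x hx y hy hxy.ne
  have k2 := key y hy z hz hyz.ne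
  have k3 := key x hx z hz hxz.ne
  have u1 := hRB u x hux
  have u2 := hRB u y huy
  have u3 := hRB u z huz
  have v1 := hRB v x hvx
  have v2 := hRB v y hvy
  have v3 := hRB v z hvz
  have hu := hu.2
  have hv := hv.2
  simp only [hP] at hu hv
  clear h1 h2 h3 h4 hP key hZm
  split_ifs at he <;> grind

/-- Of two colours on eight vertices, there is a red pentagon or a blue quadrilateral. -/
theorem hasCycleOn_four_of_no_pentagon (hRB : ∀ x y, x ≠ y → R.Adj x y ∨ B.Adj x y)
    (hA : 8 ≤ A.card) (hnoR : ¬ HasCycleOn R (A : Set V) 5) : HasCycleOn B (A : Set V) 4 := by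
  by_contra hnoB
  have htri : ∀ x ∈ A, ∀ y ∈ A, ∀ z ∈ A, R.Adj x y → R.Adj y z → ¬ R.Adj x z :=
    fun x hx y hy z hz h1 h2 h3 => hnoB (hasCycleOn_four_of_triangle hRB hA hnoR hx hy hz h1 h2 h3)
  classical
  obtain ⟨v, hv⟩ := Finset.card_pos.1 (show 0 < A.card by omega)
  have h1 := Finset.card_erase_of_mem hv
  have h2 := Finset.card_filter_add_card_filter_not (s := A.erase v) fun u => R.Adj v u
  have h3 : ((A.erase v).filter fun u => R.Adj v u).card ≤ 3 := by
    by_contra! hcon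
    refine hnoB ((hasCycleOn_of_clique (G := B) (X := (A.erase v).filter fun u => R.Adj v u)
      ?_ (m := 4) (by omega) hcon).mono fun x hx => ?_)
    · intro x hx y hy hxy
      simp only [Finset.mem_filter, Finset.mem_erase] at hx hy
      exact (hRB x y hxy).resolve_left (htri x hx.1.2 v hv y hy.1.2 hx.2.symm hy.2)
    · simp only [Finset.coe_filter, Finset.mem_erase] at hx
      exact hx.1.2
  set N := (A.erase v).filter fun u => ¬ R.Adj v u with hN
  have hNc : 4 ≤ N.card := by omega
  have hNA : ∀ u ∈ N, u ∈ A := fun u hu => Finset.mem_of_mem_erase (Finset.mem_filter.1 hu).1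
  have hNB : ∀ u ∈ N, B.Adj v u := fun u hu => by
    simp only [hN, Finset.mem_filter, Finset.mem_erase] at hu
    exact (hRB v u hu.1.1.symm).resolve_left hu.2
  have hmatch : ∀ x ∈ N, ∀ y ∈ N, ∀ z ∈ N, y ≠ z → B.Adj x y → R.Adj x z ∨ x = z := by
    intro x hx y hy z hz hyz hxy
    by_cases hxz : x = z
    · exact Or.inr hxz
    refine Or.inl ((hRB x z hxz).resolve_right fun h => ?_)
    exact hnoB (hasCycleOn_four hxy (hNB y hy).symm (hNB z hz) h.symm (hNB x hx).ne.symm hyz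
      (hNA x hx) (hNA y hy) hv (hNA z hz))
  -- The blue edges among four blue neighbours of `v` form a perfect matching `p q`, `r s`.
  obtain ⟨p, q, r, hp, hq, hr, hpq, hpr, hqr, hb⟩ : ∃ p q r, p ∈ N ∧ q ∈ N ∧ r ∈ N ∧ p ≠ q ∧
      p ≠ r ∧ q ≠ r ∧ B.Adj p q := by
    obtain ⟨a, b, c, ha, hb, hc, hab, hac, hbc⟩ := Finset.two_lt_card_iff.1
      (show 2 < N.card by omega)
    by_cases h1 : B.Adj a b
    · exact ⟨a, b, c, ha, hb, hc, hab, hac, hbc, h1⟩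
    by_cases h2 : B.Adj b c
    · exact ⟨b, c, a, hb, hc, ha, hbc, hab.symm, hac.symm, h2⟩
    · have h3 := htri a (hNA a ha) b (hNA b hb) c (hNA c hc) ((hRB a b hab).resolve_right h1)
        ((hRB b c hbc).resolve_right h2)
      exact ⟨a, c, b, ha, hc, hb, hac, hab, hbc.symm, (hRB a c hac).resolve_left h3⟩
  obtain ⟨s, hs⟩ := Finset.card_pos.1 (show 0 < (N \ {p, q, r}).card by
    have := Finset.le_card_sdiff {p, q, r} N
    have := Finset.card_le_three (a := p) (b := q) (c := r)
    omega)
  simp only [Finset.mem_sdiff, Finset.mem_insert, Finset.mem_singleton, not_or] at hs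
  obtain ⟨hs, hsp, hsq, hsr⟩ := hs
  have hpr' := (hmatch p hp q hq r hr hqr hb).resolve_right hpr
  have hps' := (hmatch p hp q hq s hs (Ne.symm hsq) hb).resolve_right (Ne.symm hsp)
  have hqr' := (hmatch q hq p hp r hr hpr hb.symm).resolve_right hqr
  have hqs' := (hmatch q hq p hp s hs (Ne.symm hsp) hb.symm).resolve_right (Ne.symm hsq)
  obtain ⟨o, ho⟩ := Finset.card_pos.1 (show 0 < (A \ {v, p, q, r, s}).card by
    have := Finset.le_card_sdiff {v, p, q, r, s} A
    have := Finset.card_le_five (a := v) (b := p) (c := q) (d := r) (e := s)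
    omega)
  simp only [Finset.mem_sdiff, Finset.mem_insert, Finset.mem_singleton, not_or] at ho
  obtain ⟨ho, hov, hop, hoq, hor, hos⟩ := ho
  have key : ∀ x ∈ N, ∀ y ∈ N, x ≠ y → B.Adj o x → B.Adj o y → False :=
    fun x hx y hy hxy h1 h2 => hnoB (hasCycleOn_four h1 (hNB x hx).symm (hNB y hy) h2.symm hov hxy
      ho (hNA x hx) hv (hNA y hy))
  have hred : ∀ x ∈ N, R.Adj o x → R.Adj x r → R.Adj x s → False := fun x hx h1 h2 h3 =>
    key r hr s hs (Ne.symm hsr)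
      ((hRB o r hor).resolve_left (htri o ho x (hNA x hx) r (hNA r hr) h1 h2))
      ((hRB o s hos).resolve_left (htri o ho x (hNA x hx) s (hNA s hs) h1 h3))
  exact key p hp q hq hpq ((hRB o p hop).resolve_left fun h => hred p hp h hpr' hps')
    ((hRB o q hoq).resolve_left fun h => hred q hq h hqr' hqs')

end Small

/-! ### The two-clique theorem -/

section TwoClique

variable {V : Type*} [DecidableEq V] {R B : SimpleGraph V} {A : Finset V}

/-- A blue `C_{2t}` makes `isTwoCliques_of_cycleMap` applicable. -/
theorem isTwoCliques_of_hasCycleOn {t k : ℕ} (hRB : ∀ x y, x ≠ y → R.Adj x y ∨ B.Adj x y)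
    (hB : HasCycleOn B (A : Set V) (2 * t)) (ht : 2 ≤ t) (hk : 2 ≤ k) (hkt : k ≤ t)
    (hA : 3 * t + 2 ≤ A.card) (hnoR : ¬ HasCycleOn R (A : Set V) (2 * k + 1))
    (hnoB : ¬ HasCycleOn B (A : Set V) (2 * t + 2)) : IsTwoCliques B A := by
  have : NeZero (2 * t) := ⟨by omega⟩
  obtain ⟨f, h1, h2, h3⟩ := hB.exists_zmod (by omega)
  exact isTwoCliques_of_cycleMap hRB ⟨h1, h2, h3⟩ ht hk hkt hA hnoR hnoB

/-- Let `2 ≤ k < j` and let `A` have at least `3j - 1` vertices. If `A` contains neither a red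
`C_{2k+1}` nor a blue `C_{2j}`, then it is a union of two blue cliques. -/
theorem isTwoCliques_of_no_cycles (hRB : ∀ x y, x ≠ y → R.Adj x y ∨ B.Adj x y) {j : ℕ}
    (hj : 3 ≤ j) : ∀ (A : Finset V) (k : ℕ), 2 ≤ k → k < j → 3 * j - 1 ≤ A.card →
      ¬ HasCycleOn R (A : Set V) (2 * k + 1) → ¬ HasCycleOn B (A : Set V) (2 * j) →
      IsTwoCliques B A := by
  induction j, hj using Nat.le_induction with
  | base =>
    intro A k hk hkj hA hnoR hnoB
    obtain rfl : k = 2 := by omega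
    exact isTwoCliques_of_hasCycleOn (t := 2) hRB
      (hasCycleOn_four_of_no_pentagon hRB (by omega) hnoR) le_rfl le_rfl le_rfl (by omega) hnoR hnoB
  | succ j hj ih =>
    intro A k hk hkj hA hnoR hnoB
    by_cases hB : HasCycleOn B (A : Set V) (2 * j)
    · exact isTwoCliques_of_hasCycleOn hRB hB (by omega) hk (by omega) (by omega) hnoR hnoB
    -- A red cycle `C_{2j-1}` could be enlarged to `C_{2j+1}`, so `k < j` may be assumed.
    obtain ⟨k, hk, hkj, hnoR⟩ : ∃ k, 2 ≤ k ∧ k < j ∧ ¬ HasCycleOn R (A : Set V) (2 * k + 1) := by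
      rcases (Nat.lt_succ_iff.1 hkj).lt_or_eq with h | rfl
      · exact ⟨k, hk, h, hnoR⟩
      refine ⟨k - 1, by omega, by omega, fun h => hB ?_⟩
      obtain ⟨f, h1, h2, h3⟩ := h.exists_zmod (by omega)
      have := hasCycleOn_of_odd_cycleMap hRB (A := A) ⟨h1, h2, h3⟩ (by omega) (by omega)
        (by rwa [show 2 * (k - 1) + 1 + 2 = 2 * k + 1 by omega])
      rwa [show 2 * (k - 1) + 2 = 2 * k by omega] at this
    obtain ⟨A', hAA', hA'⟩ := Finset.exists_subset_card_eq (show 3 * j - 1 ≤ A.card by omega)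
    have hsub : (A' : Set V) ⊆ A := by exact_mod_cast hAA'
    obtain ⟨X, Y, hXY, hdisj, hX, hY⟩ := ih A' k hk hkj hA'.ge (fun h => hnoR (h.mono hsub))
      fun h => hB (h.mono hsub)
    have hXA' : X ⊆ A' := hXY ▸ Finset.subset_union_left
    have hYA' : Y ⊆ A' := hXY ▸ Finset.subset_union_right
    have hcard : X.card + Y.card = 3 * j - 1 := by
      rw [← hA', ← hXY, Finset.card_union_of_disjoint (Finset.disjoint_left.2 hdisj)]
    have hsmall : ∀ W : Finset V, W ⊆ A' → B.IsClique (W : Set V) → W.card < 2 * j := by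
      intro W hW hWB
      by_contra! hcon
      exact hB ((hasCycleOn_of_clique (fun x hx y hy h => hWB hx hy h) (by omega) hcon).mono
        fun x hx => hsub (hW hx))
    have hX1 := hsmall X hXA' hX
    have hY1 := hsmall Y hYA' hY
    obtain ⟨x₀, hx₀⟩ := Finset.card_pos.1 (show 0 < X.card by omega)
    have : Nonempty V := ⟨x₀⟩
    obtain ⟨v, hv⟩ := exists_star_center (X := X) (Y := Y) B.Adj (by
      intro x hx x' hx' y hy y' hy' hxx hyy hxy hxy'
      exact hB ((hasCycleOn_of_two_edges (A := (A' : Set V)) hX hY hdisj (fun x hx => hXA' hx)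
        (fun y hy => hYA' hy) hx hx' hxx hy hy' hyy hxy hxy' (by omega) (by omega)).mono hsub))
    have hR : ∀ x ∈ X.erase v, ∀ y ∈ Y.erase v, R.Adj x y := by
      intro x hx y hy
      rw [Finset.mem_erase] at hx hy
      refine (hRB x y fun h => hdisj x hx.2 (h ▸ hy.2)).resolve_right fun h => ?_
      rcases hv x hx.2 y hy.2 h with h | h
      exacts [hx.1 h, hy.1 h]
    have hX2 := Finset.pred_card_le_card_erase (s := X) (a := v)
    have hY2 := Finset.pred_card_le_card_erase (s := Y) (a := v)
    have hsum : 3 * j - 2 ≤ (X.erase v).card + (Y.erase v).card := by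
      by_cases hvX : v ∈ X
      · rw [Finset.erase_eq_of_notMem (hdisj v hvX)]
        omega
      · rw [Finset.erase_eq_of_notMem hvX]
        omega
    exact isTwoCliques_of_core (j := j + 1) hRB hR (hX.subset (by simp)) (hY.subset (by simp))
      (((Finset.erase_subset _ _).trans hXA').trans hAA')
      (((Finset.erase_subset _ _).trans hYA').trans hAA') (by omega) hk (by omega) (by omega)
      (by omega) hnoR hnoB

end TwoClique

/-! ### A vertex of large blue degree -/

section LargeDegree

variable {V : Type*} [DecidableEq V] {R B : SimpleGraph V} {X Y : Finset V} {j k : ℕ}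

omit [DecidableEq V] in
/-- A cycle inside the neighbourhood of a vertex is a wheel. -/
theorem wheelGraph_isContained {G : SimpleGraph V} {h : V} {n : ℕ} (hn : 2 ≤ n)
    (hc : HasCycleOn G (G.neighborSet h) n) : wheelGraph n ⊑ G := by
  obtain ⟨g, hg, hadj, hmem⟩ := hc.exists_zmod hn
  obtain ⟨m, rfl⟩ : ∃ m, n = m + 2 := ⟨n - 2, by omega⟩
  let f : Fin (m + 2) ⊕ Unit → V := Sum.elim (g : Fin (m + 2) → V) fun _ => h
  have hf : Function.Injective f := by
    rintro (a | a) (b | b) hab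
    · exact congrArg Sum.inl (hg hab)
    · exact absurd (hab : g a = h) (hmem a).ne.symm
    · exact absurd (hab : h = g b) (hmem b).ne
    · rfl
  refine ⟨⟨⟨f, ?_⟩, hf⟩⟩
  have hcyc : ∀ a b : Fin (m + 2), (SimpleGraph.cycleGraph (m + 2)).Adj a b →
      G.Adj (g a) (g b) := by
    intro a b hab
    rcases SimpleGraph.cycleGraph_adj.1 hab with h | h
    · have e : a = b + 1 := by rw [← h]; abel
      rw [e]
      exact (hadj b).symm
    · have e : b = a + 1 := by rw [← h]; abel
      rw [e]
      exact hadj a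
  rintro (a | a) (b | b) hab
  · exact hcyc a b (by simpa [wheelGraph] using hab)
  · exact (hmem a).symm
  · exact hmem b
  · simp [wheelGraph] at hab

/-- If at least `j + 1` vertices are joined to all others in a set of `2j + 1` vertices, the set
contains a wheel whose rim alternates. -/
theorem exists_wheel_of_joined_clique {W : Finset V} (hXW : X ⊆ W)
    (hWX : ∀ w ∈ W, ∀ x ∈ X, w ≠ x → B.Adj w x) (hj : 1 ≤ j) (hXc : j + 1 ≤ X.card)
    (hW : 2 * j + 1 ≤ W.card) : ∃ h, HasCycleOn B (B.neighborSet h) (2 * j) := by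
  obtain ⟨h, hh⟩ := Finset.card_pos.1 (show 0 < X.card by omega)
  have h1 := Finset.card_erase_of_mem hh
  obtain ⟨P, hPX, hP⟩ := Finset.exists_subset_card_eq (show j ≤ (X.erase h).card by omega)
  have hQ : j ≤ ((W.erase h) \ P).card := by
    have h2 := Finset.card_erase_of_mem (hXW hh)
    have h3 := Finset.le_card_sdiff P (W.erase h)
    omega
  have hPQ : ∀ p ∈ P, ∀ q ∈ (W.erase h) \ P, B.Adj p q := by
    intro p hp q hq
    rw [Finset.mem_sdiff, Finset.mem_erase] at hq
    exact (hWX q hq.1.2 p (Finset.mem_of_mem_erase (hPX hp)) (by rintro rfl; exact hq.2 hp)).symm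
  obtain ⟨p, hp⟩ := Finset.card_pos.1 (show 0 < P.card by omega)
  obtain ⟨q, hq⟩ := Finset.card_pos.1 (show 0 < ((W.erase h) \ P).card by omega)
  obtain ⟨l, hl, hlen, hlm⟩ := exists_alternating_path hPQ hp hq hj (by omega) hQ
  refine ⟨h, p, q, l, hl, (hPQ p hp q hq).symm, hlen, fun v hv => ?_⟩
  have hvW : v ∈ W ∧ v ≠ h := by
    rcases hlm v hv with h | h
    · have := hPX h
      rw [Finset.mem_erase] at this
      exact ⟨hXW this.2, this.1⟩
    · rw [Finset.mem_sdiff, Finset.mem_erase] at h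
      exact ⟨h.1.2, h.1.1⟩
  exact (hWX v hvW.1 h hh hvW.2).symm

/-- A clique of `n + 1` vertices contains a wheel. -/
theorem exists_wheel_of_clique {n : ℕ} (hn : 2 ≤ n) (hX : B.IsClique (X : Set V))
    (hXc : n + 1 ≤ X.card) : ∃ h, HasCycleOn B (B.neighborSet h) n := by
  obtain ⟨h, hh⟩ := Finset.card_pos.1 (show 0 < X.card by omega)
  have h1 := Finset.card_erase_of_mem hh
  refine ⟨h, (hasCycleOn_of_clique (X := X.erase h) (fun x hx y hy hxy =>
    hX (Finset.mem_of_mem_erase hx) (Finset.mem_of_mem_erase hy) hxy) hn (by omega)).mono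
    fun x hx => ?_⟩
  have hx : x ∈ X.erase h := hx
  rw [Finset.mem_erase] at hx
  exact hX hh hx.2 hx.1.symm

variable [Fintype V]

/-- The vertices with blue edges to all other vertices of `Y`; if `Y` is a blue clique, this includes
the members of `Y`. -/
noncomputable def joinedTo (B : SimpleGraph V) (Y : Finset V) : Finset V := by
  classical exact Finset.univ.filter fun z => ∀ y ∈ Y, z ≠ y → B.Adj z y

theorem mem_joinedTo {z : V} : z ∈ joinedTo B Y ↔ ∀ y ∈ Y, z ≠ y → B.Adj z y := by
  simp [joinedTo]

/-- If the side `Y` is large and only few vertices are joined to it, then the remaining ones form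
a blue clique. -/
theorem exists_wheel_of_large_side (hRB : ∀ x y, x ≠ y → R.Adj x y ∨ B.Adj x y)
    (hRXY : ∀ x ∈ X, ∀ y ∈ Y, R.Adj x y) (hX : B.IsClique (X : Set V))
    (hY : B.IsClique (Y : Set V)) {v : V} (hv : ∀ y ∈ Y, B.Adj v y) (hk : 2 ≤ k) (hj : 4 ≤ j)
    (hkX : k ≤ X.card) (hkY : k ≤ Y.card) (hYc : 2 * j - 2 ≤ Y.card)
    (hV : 2 * j + 1 ≤ ((joinedTo B Y)ᶜ).card)
    (hnoR : ¬ HasCycleOn R Set.univ (2 * k + 1)) :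
    ∃ h, HasCycleOn B (B.neighborSet h) (2 * j) := by
  by_contra! hnoW
  obtain ⟨h, hh⟩ := exists_wheel_of_clique (B := B) (X := (joinedTo B Y)ᶜ) (n := 2 * j) (by omega) (by
    have hmemX : ∀ z ∈ (joinedTo B Y)ᶜ, z ∉ X → ∀ x ∈ X, B.Adj z x := by
      intro z hz hzX
      rw [Finset.mem_compl, mem_joinedTo] at hz
      have hzY : z ∉ Y := fun h => hz fun y hy hzy => hY h hy hzy
      refine (forall_adj_or_forall_adj hRB hRXY (fun _ _ => Set.mem_univ _)
        (fun _ _ => Set.mem_univ _) (by omega) hkX hkY hnoR (Set.mem_univ z) hzX hzY).resolve_right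
        fun h => hz fun y hy _ => h y hy
    intro z hz z' hz' hzz
    by_cases hzX : z ∈ X
    · by_cases hzX' : z' ∈ X
      · exact hX hzX hzX' hzz
      · exact (hmemX z' hz' hzX' z hzX).symm
    by_cases hzX' : z' ∈ X
    · exact hmemX z hz hzX z' hzX'
    refine (hRB z z' hzz).resolve_left fun hR => ?_
    rw [Finset.mem_coe, Finset.mem_compl, mem_joinedTo] at hz hz'
    have hzY : z ∉ Y := fun h => hz fun y hy hzy => hY h hy hzy
    have hzY' : z' ∉ Y := fun h => hz' fun y hy hzy => hY h hy hzy
    push Not at hz hz'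
    obtain ⟨y, hy, hzy, hBy⟩ := hz
    obtain ⟨y', hy', hzy', hBy'⟩ := hz'
    have hsame : ∀ a ∈ Y, ∀ b ∈ Y, R.Adj z a → R.Adj z' b → a = b := by
      intro a ha b hb h1 h2
      by_contra hab
      exact hnoR (hasCycleOn_of_outer_edge hRXY (fun _ _ => Set.mem_univ _)
        (fun _ _ => Set.mem_univ _) ha hb hab hzX hzY (Set.mem_univ _) hzX' hzY' (Set.mem_univ _)
        hR h1 h2 hk hkX hkY)
    have hRy := (hRB z y hzy).resolve_right hBy
    have hRy' := (hRB z' y' hzy').resolve_right hBy'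
    obtain rfl := hsame y hy y' hy' hRy hRy'
    -- `z` and `z'` have blue edges to `Y` except for `y`.
    have hzB : ∀ a ∈ Y, a ≠ y → B.Adj z a := fun a ha hay =>
      (hRB z a (by rintro rfl; exact hzY ha)).resolve_left fun h => hay (hsame a ha y hy h hRy')
    have hzB' : ∀ a ∈ Y, a ≠ y → B.Adj z' a := fun a ha hay =>
      (hRB z' a (by rintro rfl; exact hzY' ha)).resolve_left fun h =>
        hay (hsame y hy a ha hRy h).symm
    have hvY : v ∉ Y := fun h => (hv v h).ne rfl
    have h1 := Finset.card_erase_of_mem hy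
    obtain ⟨h, hh⟩ := Finset.card_pos.1 (show 0 < (Y.erase y).card by omega)
    have h2 := Finset.card_erase_of_mem hh
    obtain ⟨a, b, c, ha, hb, hc, hab, hac, hbc⟩ := Finset.two_lt_card_iff.1
      (show 2 < ((Y.erase y).erase h).card by omega)
    simp only [Finset.mem_erase] at ha hb hc hh
    -- The rim lies in `(Y \ h) ∪ {v, z, z'}`.
    set C := insert v ((Y.erase h).erase b) with hC
    have hCc : 2 * j - 3 ≤ C.card := by
      have h3 := Finset.card_erase_of_mem hh.2
      have h4 := Finset.card_erase_of_mem (Finset.mem_erase.2 ⟨hb.1, hb.2.2⟩)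
      rw [hC, Finset.card_insert_of_notMem (by simp [hvY])]
      omega
    have hCm : ∀ x ∈ C, x = v ∨ (x ≠ b ∧ x ≠ h ∧ x ∈ Y) := fun x hx => by simpa [hC] using hx
    obtain ⟨l, hl, hlen, hlC⟩ := exists_path_of_clique (G := B) (X := C) (x := a) (y := c) (by
      intro x hx y hy hxy
      rcases hCm x hx with rfl | h1 <;> rcases hCm y hy with rfl | h2
      exacts [absurd rfl hxy, hv y h2.2.2, (hv x h1.2.2).symm, hY h1.2.2 h2.2.2 hxy])
      (by simp [hC, ha.2.2, ha.1, hab]) (by simp [hC, hc.2.2, hc.1, hbc.symm]) hac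
      (m := 2 * j - 3) (by omega) hCc
    have hm : IsPathList B z z' [z, b, z'] :=
      ((IsPathList.singleton B z').cons (hzB' b hb.2.2 hb.2.1).symm
        (by simp; rintro rfl; exact hzY' hb.2.2)).cons (hzB b hb.2.2 hb.2.1)
        (by simp [hzz]; rintro rfl; exact hzY hb.2.2)
    refine hnoW h (hasCycleOn_of_two_paths hl hm (hzB c hc.2.2 hc.2.1).symm (hzB' a ha.2.2 ha.2.1)
      ?_ (by simp; omega) ?_ ?_)
    · intro x hx hx'
      have hzv : z ≠ v := fun h => hBy (h ▸ hv y hy)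
      have hzv' : z' ≠ v := fun h => hBy' (h ▸ hv y hy)
      simp only [List.mem_cons, List.not_mem_nil, or_false] at hx'
      rcases hCm x (hlC x hx) with rfl | h <;> rcases hx' with rfl | rfl | rfl
      exacts [hzv rfl, hvY hb.2.2, hzv' rfl, hzY h.2.2, h.1 rfl, hzY' h.2.2]
    · intro x hx
      rcases hCm x (hlC x hx) with rfl | hx
      exacts [(hv h hh.2).symm, hY hh.2 hx.2.2 hx.2.1.symm]
    · intro x hx
      simp only [List.mem_cons, List.not_mem_nil, or_false] at hx
      rcases hx with rfl | rfl | rfl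
      exacts [(hzB h hh.2 hh.1).symm, hY hh.2 hb.2.2 hb.1.symm, (hzB' h hh.2 hh.1).symm]) hV
  exact hnoW h hh

/-- On at least `4j + 1` vertices without red `C_{2k+1}`, a vertex of blue degree at least
`3j - 1` yields a blue wheel. -/
theorem exists_wheel_of_large_degree (hRB : ∀ x y, x ≠ y → R.Adj x y ∨ B.Adj x y)
    (hk : 2 < k) (hkj : k < j) (hV : 4 * j + 1 ≤ Fintype.card V) {v : V} {A : Finset V}
    (hvA : ∀ a ∈ A, B.Adj v a) (hA : 3 * j - 1 ≤ A.card)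
    (hnoR : ¬ HasCycleOn R Set.univ (2 * k + 1)) :
    ∃ h, HasCycleOn B (B.neighborSet h) (2 * j) := by
  by_contra! hnoW
  have hnoB : ¬ HasCycleOn B (A : Set V) (2 * j) := fun h => hnoW v (h.mono hvA)
  obtain ⟨X, Y, hXY, hdisj, hX, hY⟩ := isTwoCliques_of_no_cycles hRB (show 3 ≤ j by omega) A k
    (by omega) hkj hA (fun h => hnoR (h.mono (Set.subset_univ _))) hnoB
  have hXA : X ⊆ A := hXY ▸ Finset.subset_union_left
  have hYA : Y ⊆ A := hXY ▸ Finset.subset_union_right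
  have hcard : 3 * j - 1 ≤ X.card + Y.card := by
    rwa [← Finset.card_union_of_disjoint (Finset.disjoint_left.2 hdisj), hXY]
  have hsmall : ∀ W : Finset V, W ⊆ A → B.IsClique (W : Set V) → W.card < 2 * j := by
    intro W hW hWB
    by_contra! hcon
    exact hnoB ((hasCycleOn_of_clique (fun x hx y hy h => hWB hx hy h) (by omega) hcon).mono
      fun x hx => hW hx)
  have hX1 := hsmall X hXA hX
  have hY1 := hsmall Y hYA hY
  have : Nonempty V := ⟨v⟩
  obtain ⟨s, hs⟩ := exists_star_center (X := X) (Y := Y) B.Adj (by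
    intro x hx x' hx' y hy y' hy' hxx hyy hxy hxy'
    exact hnoB (hasCycleOn_of_two_edges hX hY hdisj (fun x hx => hXA hx)
      (fun y hy => hYA hy) hx hx' hxx hy hy' hyy hxy hxy' (by omega) (by omega)))
  have hR : ∀ x ∈ X.erase s, ∀ y ∈ Y.erase s, R.Adj x y := by
    intro x hx y hy
    rw [Finset.mem_erase] at hx hy
    refine (hRB x y fun h => hdisj x hx.2 (h ▸ hy.2)).resolve_right fun h => ?_
    rcases hs x hx.2 y hy.2 h with h | h
    exacts [hx.1 h, hy.1 h]
  have hX2 := Finset.pred_card_le_card_erase (s := X) (a := s)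
  have hY2 := Finset.pred_card_le_card_erase (s := Y) (a := s)
  have hsum : 3 * j - 2 ≤ (X.erase s).card + (Y.erase s).card := by
    by_cases hsX : s ∈ X
    · rw [Finset.erase_eq_of_notMem (hdisj s hsX)]
      omega
    · rw [Finset.erase_eq_of_notMem hsX]
      omega
  have hX0 : B.IsClique ((X.erase s : Finset V) : Set V) := hX.subset (by simp)
  have hY0 : B.IsClique ((Y.erase s : Finset V) : Set V) := hY.subset (by simp)
  have hvX : ∀ x ∈ X.erase s, B.Adj v x := fun x hx => hvA x (hXA (Finset.mem_of_mem_erase hx))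
  have hvY : ∀ y ∈ Y.erase s, B.Adj v y := fun y hy => hvA y (hYA (Finset.mem_of_mem_erase hy))
  generalize X.erase s = X at *
  generalize Y.erase s = Y at *
  have hjoin : ∀ W : Finset V, B.IsClique (W : Set V) → j + 1 ≤ W.card →
      (joinedTo B W).card ≤ 2 * j := by
    intro W hW hWc
    by_contra! hcon
    obtain ⟨h, hh⟩ := exists_wheel_of_joined_clique
      (fun w hw => mem_joinedTo.2 fun y hy h => hW hw hy h)
      (fun w hw => mem_joinedTo.1 hw) (by omega) hWc hcon
    exact hnoW h hh
  have hcompl : ∀ W : Finset V, W.card + (Wᶜ).card = Fintype.card V :=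
    fun W => Finset.card_add_card_compl W
  have hYl : Y.card < 2 * j - 2 := by
    by_contra! hcon
    have h1 := hjoin Y hY0 (by omega)
    have h2 := hcompl (joinedTo B Y)
    obtain ⟨h, hh⟩ := exists_wheel_of_large_side hRB hR hX0 hY0 hvY (by omega) (by omega)
      (by omega) (by omega) hcon (by omega) hnoR
    exact hnoW h hh
  have hXl : X.card < 2 * j - 2 := by
    by_contra! hcon
    have h1 := hjoin X hX0 (by omega)
    have h2 := hcompl (joinedTo B X)
    obtain ⟨h, hh⟩ := exists_wheel_of_large_side hRB (fun y hy x hx => (hR x hx y hy).symm) hY0 hX0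
      hvX (by omega) (by omega) (by omega) (by omega) hcon (by omega) hnoR
    exact hnoW h hh
  have h1 := hjoin X hX0 (by omega)
  have h2 := hjoin Y hY0 (by omega)
  have h3 : joinedTo B X ∪ joinedTo B Y = Finset.univ := by
    refine Finset.eq_univ_of_forall fun z => ?_
    rw [Finset.mem_union, mem_joinedTo, mem_joinedTo]
    by_cases hzX : z ∈ X
    · exact Or.inl fun y hy hzy => hX0 hzX hy hzy
    by_cases hzY : z ∈ Y
    · exact Or.inr fun y hy hzy => hY0 hzY hy hzy
    exact (forall_adj_or_forall_adj hRB hR (fun _ _ => Set.mem_univ _)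
      (fun _ _ => Set.mem_univ _) (by omega) (by omega) (by omega) hnoR (Set.mem_univ z) hzX
      hzY).imp (fun h x hx _ => h x hx) fun h x hx _ => h x hx
  have h4 := Finset.card_union_le (joinedTo B X) (joinedTo B Y)
  rw [h3, Finset.card_univ] at h4
  omega

end LargeDegree

/-! ### Longest paths and cycles of prescribed length -/

section LongestPath

variable {V : Type*} {G : SimpleGraph V} {F : Finset V} {a b : V} {l : List V}

/-- `l` is a path from `a` to `b` in `F`, and no path in `F` has more vertices. -/
structure IsLongestPath (G : SimpleGraph V) (F : Finset V) (a b : V) (l : List V) : Prop where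
  path : IsPathList G a b l
  mem : ∀ x ∈ l, x ∈ F
  le : ∀ a' b' l', IsPathList G a' b' l' → (∀ x ∈ l', x ∈ F) → l'.length ≤ l.length

theorem exists_isLongestPath [DecidableEq V] (hF : F.Nonempty) :
    ∃ a b l, IsLongestPath G F a b l := by
  classical
  obtain ⟨v, hv⟩ := hF
  let P : ℕ → Prop := fun n => ∃ a b l, IsPathList G a b l ∧ (∀ x ∈ l, x ∈ F) ∧ l.length = n
  have h1 : P 1 := ⟨v, v, [v], IsPathList.singleton G v, by simp [hv], rfl⟩
  have hbd : ∀ n, P n → n ≤ F.card := by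
    rintro n ⟨a, b, l, hl, hlF, rfl⟩
    rw [← List.toFinset_card_of_nodup hl.nodup]
    exact Finset.card_le_card fun x hx => hlF x (List.mem_toFinset.1 hx)
  obtain ⟨a, b, l, hl, hlF, hlen⟩ := Nat.findGreatest_spec (hbd 1 h1) h1
  refine ⟨a, b, l, hl, hlF, fun a' b' l' hl' hlF' => ?_⟩
  rw [hlen]
  exact Nat.le_findGreatest (hbd _ ⟨a', b', l', hl', hlF', rfl⟩) ⟨a', b', l', hl', hlF', rfl⟩

namespace IsLongestPath

theorem reverse (h : IsLongestPath G F a b l) : IsLongestPath G F b a l.reverse :=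
  ⟨h.path.reverse, fun x hx => h.mem x (List.mem_reverse.1 hx), fun a' b' l' h1 h2 => by
    rw [List.length_reverse]
    exact h.le a' b' l' h1 h2⟩

theorem mem_of_adj (h : IsLongestPath G F a b l) {v : V} (hv : v ∈ F) (hav : G.Adj a v) :
    v ∈ l := by
  by_contra hvl
  have := h.le v b (v :: l) (h.path.cons hav.symm hvl) (by
    intro x hx
    rcases List.mem_cons.1 hx with rfl | hx
    exacts [hv, h.mem x hx])
  simp at this

end IsLongestPath

theorem IsPathList.take (h : IsPathList G a b l) {i : ℕ} (hi : i < l.length) :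
    IsPathList G a l[i] (l.take (i + 1)) :=
  ⟨h.nodup.sublist (List.take_sublist _ _), h.chain.take _, by
    rw [List.head?_take, if_neg (by omega), h.head], by
    rw [List.getLast?_take, if_neg (by omega)]
    simp [hi]⟩

theorem IsPathList.drop (h : IsPathList G a b l) {i : ℕ} (hi : i < l.length) :
    IsPathList G l[i] b (l.drop i) :=
  ⟨h.nodup.sublist (List.drop_sublist _ _), h.chain.drop _, by simp [hi], by
    rw [List.getLast?_drop, if_neg (by omega), h.last]⟩

theorem IsPathList.disjoint_take_drop (h : IsPathList G a b l) (i : ℕ) :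
    ∀ x ∈ l.take i, x ∉ l.drop i := fun _ h1 h2 =>
  List.disjoint_of_nodup_append (by rw [List.take_append_drop]; exact h.nodup) h1 h2

/-- A neighbour `l[i]` of the first vertex of a path closes a cycle. -/
theorem IsPathList.hasCycleOn (h : IsPathList G a b l) {i : ℕ} (hi : i < l.length)
    (hadj : G.Adj a l[i]) : HasCycleOn G {x | x ∈ l} (i + 1) :=
  ⟨a, l[i], l.take (i + 1), h.take hi, hadj.symm, by simp; omega, fun _ hx => List.mem_of_mem_take hx⟩

/-- If the first vertex of a longest path is adjacent to `l[i + 1]`, turning around the initial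
segment gives a longest path that starts at `l[i]`. -/
theorem IsLongestPath.rotate (h : IsLongestPath G F a b l) {i : ℕ} (hi : i + 1 < l.length)
    (hadj : G.Adj a l[i + 1]) :
    IsLongestPath G F l[i] b ((l.take (i + 1)).reverse ++ l.drop (i + 1)) := by
  refine ⟨(h.path.take (by omega)).reverse.append (h.path.drop hi) hadj fun x hx =>
    h.path.disjoint_take_drop _ x (List.mem_reverse.1 hx), fun x hx => ?_, fun a' b' l' h1 h2 => ?_⟩
  · rcases List.mem_append.1 hx with hx | hx
    exacts [h.mem x (List.mem_of_mem_take (List.mem_reverse.1 hx)),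
      h.mem x (List.mem_of_mem_drop hx)]
  · refine (h.le a' b' l' h1 h2).trans ?_
    simp
    omega

end LongestPath

section Pancyclic

variable {V : Type*} {G : SimpleGraph V}

theorem IsCycleMap.exists_slice {L : ℕ} [NeZero L] {A : Set V} {f : ZMod L → V}
    (hf : IsCycleMap G A f) {p q : ℕ} (hpq : p ≤ q) (hq : q < L) :
    ∃ l, IsPathList G (f (p : ℕ)) (f (q : ℕ)) l ∧ l.length = q - p + 1 ∧
      ∀ v ∈ l, ∃ i : ℕ, p ≤ i ∧ i ≤ q ∧ f (i : ℕ) = v := by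
  have h1 := isPathList_arc hf.inj hf.adj (p : ℕ) (p := q - p) (by omega)
  rw [← Nat.cast_add, Nat.add_sub_cancel' hpq] at h1
  refine ⟨_, h1, length_arc _ _, fun v hv => ?_⟩
  obtain ⟨i, hi, rfl⟩ := mem_arc.1 hv
  exact ⟨p + i, by omega, by omega, by rw [Nat.cast_add]⟩

theorem card_nbrPos {L : ℕ} [NeZero L] {f : ZMod L → V} {w : V} [DecidableRel G.Adj] :
    ((Finset.range L).filter fun i => G.Adj w (f (i : ℕ))).card = (nbrPos G f w).card := by
  refine Finset.card_nbij' (fun i => (i : ZMod L)) ZMod.val ?_ ?_ ?_ ?_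
  · intro i hi
    simp only [Finset.coe_filter, Finset.mem_range, Set.mem_ofPred_eq] at hi
    exact mem_nbrPos.2 hi.2
  · intro i hi
    have hi := mem_nbrPos.1 hi
    simp only [Finset.coe_filter, Finset.mem_range, Set.mem_ofPred_eq]
    exact ⟨ZMod.val_lt i, by rwa [ZMod.natCast_zmod_val]⟩
  · intro i hi
    simp only [Finset.coe_filter, Finset.mem_range, Set.mem_ofPred_eq] at hi
    exact ZMod.val_natCast_of_lt hi.1
  · intro i _
    exact ZMod.natCast_zmod_val i

/-- Bondy's counting argument: if the degree sum of two consecutive vertices of a cycle exceeds its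
length, then two of their chords cut out a cycle of any given smaller length. -/
theorem IsCycleMap.hasCycleOn_of_lt_card {L : ℕ} [NeZero L] {A : Set V} {f : ZMod L → V}
    (hf : IsCycleMap G A f) (hdeg : L < (nbrPos G f (f ((0 : ℕ) : ZMod L))).card +
      (nbrPos G f (f ((L - 1 : ℕ) : ZMod L))).card) {n : ℕ} (hn : 3 ≤ n) (hnL : n ≤ L) :
    HasCycleOn G A n := by
  classical
  by_contra hno
  set g : ℕ → V := fun i => f (i : ℕ) with hg
  have hgi : ∀ p q, p < L → q < L → g p = g q → p = q := by
    intro p q hp hq h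
    have h1 := hf.inj h
    rwa [ZMod.natCast_eq_natCast_iff, Nat.ModEq, Nat.mod_eq_of_lt hp, Nat.mod_eq_of_lt hq] at h1
  have hgA : ∀ i, g i ∈ A := fun i => hf.mem _
  have hlast : G.Adj (g (L - 1)) (g 0) := by
    have h1 := hf.adj ((L - 1 : ℕ) : ZMod L)
    rwa [← Nat.cast_succ, Nat.succ_eq_add_one, Nat.sub_add_cancel (by omega), ZMod.natCast_self,
      ← Nat.cast_zero] at h1
  rw [← card_nbrPos, ← card_nbrPos] at hdeg
  set S := (Finset.range L).filter fun i => G.Adj (g 0) (g i) with hS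
  set T := (Finset.range L).filter fun i => G.Adj (g (L - 1)) (g i) with hT
  -- The chords from `g 0` to `g i` and from `g (L - 1)` to `g (φ i)` cut out a cycle of length `n`.
  set φ : ℕ → ℕ := fun i => if i ≤ L + 1 - n then i + n - 3 else i + n - L - 1 with hφ
  have hS1 : ∀ i ∈ S, 1 ≤ i ∧ i < L ∧ G.Adj (g 0) (g i) := by
    intro i hi
    rw [hS, Finset.mem_filter, Finset.mem_range] at hi
    refine ⟨Nat.one_le_iff_ne_zero.2 ?_, hi⟩
    rintro rfl
    exact hi.2.ne rfl
  have hφT : ∀ i ∈ S, φ i ∈ Finset.range (L - 1) \ T := by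
    intro i hi
    obtain ⟨h1, h2, h3⟩ := hS1 i hi
    have hlt : φ i < L - 1 := by
      simp only [hφ]
      split_ifs <;> omega
    rw [Finset.mem_sdiff, Finset.mem_range]
    refine ⟨hlt, fun h => hno ?_⟩
    have h4 : G.Adj (g (L - 1)) (g (φ i)) := (Finset.mem_filter.1 h).2
    by_cases hi' : i ≤ L + 1 - n
    · have e : φ i = i + n - 3 := by simp [hφ, hi']
      rw [e] at h4 hlt
      obtain ⟨l, hl, hlen, hlm⟩ := hf.exists_slice (p := i) (q := i + n - 3) (by omega) (by omega)
      refine hasCycleOn_of_two_paths hl ((IsPathList.singleton G (g 0)).cons hlast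
        (by simpa using hlast.ne)) h4.symm h3 ?_ (by simp; omega) ?_ ?_
      · intro x hx hx'
        obtain ⟨q, hq, hq', rfl⟩ := hlm x hx
        simp only [List.mem_cons, List.not_mem_nil, or_false] at hx'
        rcases hx' with h | h
        · have := hgi _ _ (by omega) (by omega) h
          omega
        · have := hgi _ _ (by omega) (by omega) h
          omega
      · intro x hx
        obtain ⟨q, -, -, rfl⟩ := hlm x hx
        exact hgA q
      · intro x hx
        simp only [List.mem_cons, List.not_mem_nil, or_false] at hx
        rcases hx with rfl | rfl <;> exact hgA _
    · have e : φ i = i + n - L - 1 := by simp [hφ, hi']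
      rw [e] at h4 hlt
      obtain ⟨l, hl, hlen, hlm⟩ := hf.exists_slice (p := 0) (q := i + n - L - 1) (by omega)
        (by omega)
      obtain ⟨m, hm, hlen', hmm⟩ := hf.exists_slice (p := i) (q := L - 1) (by omega) (by omega)
      refine hasCycleOn_of_two_paths hl hm.reverse h4.symm h3.symm ?_ (by simp; omega) ?_ ?_
      · intro x hx hx'
        obtain ⟨q, hq, hq', rfl⟩ := hlm x hx
        obtain ⟨r, hr, hr', h⟩ := hmm _ (List.mem_reverse.1 hx')
        have := hgi _ _ (by omega) (by omega) h
        omega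
      · intro x hx
        obtain ⟨q, -, -, rfl⟩ := hlm x hx
        exact hgA q
      · intro x hx
        obtain ⟨q, -, -, rfl⟩ := hmm x (List.mem_reverse.1 hx)
        exact hgA q
  have hinj : Set.InjOn φ (S.erase 1 : Finset ℕ) := by
    intro p hp q hq h
    rw [Finset.mem_coe, Finset.mem_erase] at hp hq
    have h1 := hS1 p hp.2
    have h2 := hS1 q hq.2
    have h3 := hp.1
    have h4 := hq.1
    simp only [hφ] at h
    split_ifs at h <;> omega
  have h1 : (S.erase 1).card ≤ (Finset.range (L - 1) \ T).card := by
    rw [← Finset.card_image_of_injOn hinj]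
    refine Finset.card_le_card fun x hx => ?_
    obtain ⟨i, hi, rfl⟩ := Finset.mem_image.1 hx
    exact hφT i (Finset.mem_of_mem_erase hi)
  have hTs : T ⊆ Finset.range (L - 1) := by
    intro i hi
    rw [hT, Finset.mem_filter, Finset.mem_range] at hi
    rw [Finset.mem_range]
    have : i ≠ L - 1 := by
      rintro rfl
      exact hi.2.ne rfl
    omega
  have h2 := Finset.card_sdiff_add_card_eq_card hTs
  rw [Finset.card_range] at h2
  have h3 := Finset.pred_card_le_card_erase (s := S) (a := 1)
  omega

variable [DecidableEq V] [DecidableRel G.Adj] {F : Finset V}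

/-- All neighbours of the first vertex of a longest path are counted by their predecessors on the
path. -/
theorem IsLongestPath.card_le {a b : V} {l : List V} (h : IsLongestPath G F a b l) :
    (F.filter (G.Adj a)).card ≤ ((Finset.range (l.length - 1)).filter fun i =>
      G.Adj a (l.getD (i + 1) a)).card := by
  refine (Finset.card_le_card fun v hv => ?_).trans
    (Finset.card_image_le (f := fun i => l.getD (i + 1) a))
  rw [Finset.mem_filter] at hv
  obtain ⟨i, hi, rfl⟩ := List.getElem_of_mem (h.mem_of_adj hv.1 hv.2)
  have hi0 : i ≠ 0 := by
    rintro rfl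
    have h1 := h.path.head
    rw [List.head?_eq_getElem?, List.getElem?_eq_getElem hi] at h1
    rw [Option.some.inj h1] at hv
    exact hv.2.ne rfl
  refine Finset.mem_image.2 ⟨i - 1, ?_, ?_⟩
  · simp only [Finset.mem_filter, Finset.mem_range]
    rw [Nat.sub_add_cancel (by omega), List.getD_eq_getElem _ _ hi]
    exact ⟨by omega, hv.2⟩
  · rw [Nat.sub_add_cancel (by omega), List.getD_eq_getElem _ _ hi]

/-- Dirac: a graph on `F` in which all degrees exceed `|F| / 2` has a cycle through all of `F`. -/
theorem exists_cycleMap_of_degree (hF : F.Nonempty)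
    (hdeg : ∀ v ∈ F, F.card < 2 * (F.filter (G.Adj v)).card) :
    ∃ f : ZMod F.card → V, Function.Injective f ∧ (∀ i, G.Adj (f i) (f (i + 1))) ∧
      ∀ i, f i ∈ F := by
  obtain ⟨a, b, l, h⟩ := exists_isLongestPath (G := G) hF
  have haF := h.mem a h.path.head_mem
  have hbF := h.mem b h.path.last_mem
  set g : ℕ → V := fun i => l.getD i a with hg
  have hgl : ∀ i (hi : i < l.length), g i = l[i] := fun i hi => by simp [hg, hi]
  have hlF : l.length ≤ F.card := by
    rw [← List.toFinset_card_of_nodup h.path.nodup]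
    exact Finset.card_le_card fun x hx => h.mem x (List.mem_toFinset.1 hx)
  have hpos : 0 < l.length := List.length_pos_of_mem h.path.head_mem
  have hg0 : g 0 = a := by
    have := h.path.head
    rw [hgl 0 hpos]
    rw [List.head?_eq_getElem?, List.getElem?_eq_getElem hpos] at this
    exact Option.some.inj this
  have hglast : g (l.length - 1) = b := by
    have := h.path.last
    rw [hgl _ (by omega)]
    rw [List.getLast?_eq_getElem?, List.getElem?_eq_getElem (by omega)] at this
    exact Option.some.inj this
  -- Neighbours of the two ends of the path cross.
  obtain ⟨i, hi⟩ : ∃ i, i ∈ ((Finset.range (l.length - 1)).filter fun i => G.Adj a (g (i + 1))) ∩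
      (Finset.range (l.length - 1)).filter fun i => G.Adj b (g i) := by
    have h1 : (F.filter (G.Adj a)).card ≤
        ((Finset.range (l.length - 1)).filter fun i => G.Adj a (g (i + 1))).card := h.card_le
    have h2 : (F.filter (G.Adj b)).card ≤
        ((Finset.range (l.length - 1)).filter fun i => G.Adj b (g i)).card := by
      refine (Finset.card_le_card fun v hv => ?_).trans (Finset.card_image_le (f := g))
      rw [Finset.mem_filter] at hv
      obtain ⟨i, hi, rfl⟩ := List.getElem_of_mem (List.mem_reverse.1 (h.reverse.mem_of_adj hv.1 hv.2))
      have hi0 : i ≠ l.length - 1 := by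
        rintro rfl
        rw [← hgl _ (by omega), hglast] at hv
        exact hv.2.ne rfl
      refine Finset.mem_image.2 ⟨i, ?_, hgl i hi⟩
      rw [Finset.mem_filter, Finset.mem_range, hgl i hi]
      exact ⟨by omega, hv.2⟩
    have h3 := Finset.card_union_add_card_inter
      ((Finset.range (l.length - 1)).filter fun i => G.Adj a (g (i + 1)))
      ((Finset.range (l.length - 1)).filter fun i => G.Adj b (g i))
    have h4 := Finset.card_le_card (Finset.union_subset
      (Finset.filter_subset (fun i => G.Adj a (g (i + 1))) (Finset.range (l.length - 1)))
      (Finset.filter_subset (fun i => G.Adj b (g i)) (Finset.range (l.length - 1))))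
    rw [Finset.card_range] at h4
    have h5 := hdeg a haF
    have h6 := hdeg b hbF
    exact Finset.card_pos.1 (by omega)
  simp only [Finset.mem_inter, Finset.mem_filter, Finset.mem_range] at hi
  obtain ⟨⟨hil, hai⟩, -, hbi⟩ := hi
  rw [hgl _ (by omega)] at hai hbi
  have hcyc : HasCycleOn G (F : Set V) l.length := by
    refine hasCycleOn_of_two_paths (h.path.take (i := i) (by omega))
      (h.path.drop (i := i + 1) (by omega)).reverse hbi.symm hai.symm ?_ (by simp; omega) ?_ ?_
    · exact fun x hx hx' => h.path.disjoint_take_drop _ x hx (List.mem_reverse.1 hx')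
    · exact fun x hx => h.mem x (List.mem_of_mem_take hx)
    · exact fun x hx => h.mem x (List.mem_of_mem_drop (List.mem_reverse.1 hx))
  obtain ⟨f, hf, hadj, hmem⟩ := hcyc.exists_zmod (by omega)
  have : NeZero l.length := ⟨by omega⟩
  have hclosed : ∀ i, ∀ w ∈ F, G.Adj (f i) w → w ∈ Finset.univ.image f := by
    intro i w hw hiw
    by_contra hwf
    have h1 := isPathList_arc hf hadj i (p := l.length - 1) (by omega)
    have h2 := h.le _ _ _ (h1.cons hiw.symm fun hw' => by
      obtain ⟨q, -, rfl⟩ := mem_arc.1 hw'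
      exact hwf (Finset.mem_image_of_mem f (Finset.mem_univ _))) (by
      intro x hx
      rcases List.mem_cons.1 hx with rfl | hx
      · exact hw
      · obtain ⟨q, -, rfl⟩ := mem_arc.1 hx
        exact hmem _)
    rw [List.length_cons, length_arc] at h2
    omega
  have hcard : (Finset.univ.image f).card = l.length := by
    rw [Finset.card_image_of_injective _ hf, Finset.card_univ, ZMod.card]
  have hsub : Finset.univ.image f ⊆ F := fun v hv => by
    obtain ⟨i, -, rfl⟩ := Finset.mem_image.1 hv
    exact hmem i
  have heq : l.length = F.card := by
    by_contra hne
    obtain ⟨u, hu⟩ := Finset.card_pos.1 (show 0 < (F \ Finset.univ.image f).card by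
      have := Finset.card_sdiff_add_card_eq_card hsub
      omega)
    rw [Finset.mem_sdiff] at hu
    have h1 : (F.filter (G.Adj u)).card ≤ (F \ Finset.univ.image f).card :=
      Finset.card_le_card fun v hv => by
        rw [Finset.mem_filter] at hv
        refine Finset.mem_sdiff.2 ⟨hv.1, fun h' => hu.2 ?_⟩
        obtain ⟨i, -, rfl⟩ := Finset.mem_image.1 h'
        exact hclosed i u hu.1 hv.2.symm
    have h2 : (F.filter (G.Adj (f 0))).card ≤ (Finset.univ.image f).card :=
      Finset.card_le_card fun v hv => by
        rw [Finset.mem_filter] at hv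
        exact hclosed 0 v hv.1 hv.2
    have h3 := Finset.card_sdiff_add_card_eq_card hsub
    have h4 := hdeg u hu.1
    have h5 := hdeg _ (hmem 0)
    omega
  exact heq ▸ ⟨f, hf, hadj, hmem⟩

/-- A graph on `F` in which all degrees exceed `|F| / 2` is pancyclic. -/
theorem hasCycleOn_of_degree (hdeg : ∀ v ∈ F, F.card < 2 * (F.filter (G.Adj v)).card) {n : ℕ}
    (hn : 3 ≤ n) (hnF : n ≤ F.card) : HasCycleOn G (F : Set V) n := by
  obtain ⟨f, hf, hadj, hmem⟩ := exists_cycleMap_of_degree (Finset.card_pos.1 (by omega)) hdeg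
  have : NeZero F.card := ⟨by omega⟩
  have himage : Finset.univ.image f = F := by
    refine Finset.eq_of_subset_of_card_le (fun v hv => ?_) ?_
    · obtain ⟨i, -, rfl⟩ := Finset.mem_image.1 hv
      exact hmem i
    · rw [Finset.card_image_of_injective _ hf, Finset.card_univ, ZMod.card]
  have hpos : ∀ v, (F.filter (G.Adj v)).card ≤ (nbrPos G f v).card := by
    intro v
    refine (Finset.card_le_card fun u hu => ?_).trans (Finset.card_image_le (f := f))
    rw [Finset.mem_filter, ← himage] at hu
    obtain ⟨i, -, rfl⟩ := Finset.mem_image.1 hu.1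
    exact Finset.mem_image_of_mem f (mem_nbrPos.2 hu.2)
  refine IsCycleMap.hasCycleOn_of_lt_card ⟨hf, hadj, hmem⟩ ?_ hn hnF
  have h1 := hdeg _ (hmem ((0 : ℕ) : ZMod F.card))
  have h2 := hdeg _ (hmem ((F.card - 1 : ℕ) : ZMod F.card))
  have h3 := hpos (f ((0 : ℕ) : ZMod F.card))
  have h4 := hpos (f ((F.card - 1 : ℕ) : ZMod F.card))
  omega

end Pancyclic

/-! ### All blue degrees small -/

section SmallDegree

variable {V : Type*} [DecidableEq V] {R B : SimpleGraph V} {S F : Finset V} {j k : ℕ}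

/-- Without a red `C_{2k+1}` in `F`, some vertex of `F` has many blue neighbours in `F`: otherwise
the red graph on `F` is pancyclic. -/
theorem exists_blue_degree [DecidableRel B.Adj] (hRB : ∀ x y, x ≠ y → R.Adj x y ∨ B.Adj x y)
    (hk : 1 ≤ k) (hkF : 2 * k + 1 ≤ F.card) {d : ℕ} (hd : 2 * d + 1 ≤ F.card)
    (hnoR : ¬ HasCycleOn R (F : Set V) (2 * k + 1)) :
    ∃ z ∈ F, d ≤ (F.filter (B.Adj z)).card := by
  classical
  by_contra! hcon
  refine hnoR (hasCycleOn_of_degree (fun z hz => ?_) (by omega) hkF)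
  have h1 := hcon z hz
  have h2 : F.erase z ⊆ F.filter (R.Adj z) ∪ F.filter (B.Adj z) := by
    intro w hw
    rw [Finset.mem_erase] at hw
    rcases hRB z w hw.1.symm with h | h
    · exact Finset.mem_union_left _ (Finset.mem_filter.2 ⟨hw.2, h⟩)
    · exact Finset.mem_union_right _ (Finset.mem_filter.2 ⟨hw.2, h⟩)
  have h3 := Finset.card_le_card h2
  rw [Finset.card_erase_of_mem hz] at h3
  have h4 := Finset.card_union_le (F.filter (R.Adj z)) (F.filter (B.Adj z))
  omega

/-- Large sets `S` and `F` with only blue edges between them: a vertex of `F` with many blue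
neighbours in `F` is the hub of a wheel whose rim alternates. -/
theorem exists_wheel_of_joined (hRB : ∀ x y, x ≠ y → R.Adj x y ∨ B.Adj x y)
    (hSF : ∀ s ∈ S, ∀ f ∈ F, B.Adj s f) (hk : 1 ≤ k) (hkj : k < j) (hS : j ≤ S.card)
    (hF : 2 * j + 1 ≤ F.card) (hnoR : ¬ HasCycleOn R Set.univ (2 * k + 1)) :
    ∃ h, HasCycleOn B (B.neighborSet h) (2 * j) := by
  classical
  obtain ⟨z, hz, hzc⟩ := exists_blue_degree hRB hk (by omega) hF
    (fun h => hnoR (h.mono (Set.subset_univ _)))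
  have hSF' : ∀ s ∈ S, ∀ f ∈ F.filter (B.Adj z), B.Adj s f :=
    fun s hs f hf => hSF s hs f (Finset.mem_filter.1 hf).1
  obtain ⟨s, hs⟩ := Finset.card_pos.1 (show 0 < S.card by omega)
  obtain ⟨f, hf⟩ := Finset.card_pos.1 (show 0 < (F.filter (B.Adj z)).card by omega)
  obtain ⟨l, hl, hlen, hlm⟩ := exists_alternating_path hSF' hs hf (n := j) (by omega) hS hzc
  refine ⟨z, s, f, l, hl, (hSF' s hs f hf).symm, hlen, fun v hv => ?_⟩
  rcases hlm v hv with h | h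
  exacts [(hSF v h z hz).symm, (Finset.mem_filter.1 h).2]

/-- The balanced case: the rim alternates except for a blue path with three vertices in `S`. -/
theorem exists_wheel_of_joined_balanced (hRB : ∀ x y, x ≠ y → R.Adj x y ∨ B.Adj x y)
    (hSF : ∀ s ∈ S, ∀ f ∈ F, B.Adj s f) (hk : 2 ≤ k) (hkj : k < j) (hS : 2 * j ≤ S.card)
    (hF : 2 * j ≤ F.card) (hnoR : ¬ HasCycleOn R Set.univ (2 * k + 1)) :
    ∃ h, HasCycleOn B (B.neighborSet h) (2 * j) := by
  classical
  obtain ⟨z, hz, hzc⟩ := exists_blue_degree hRB (d := j - 1) (by omega) (by omega) (by omega)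
    (fun h => hnoR (h.mono (Set.subset_univ (F : Set V))))
  obtain ⟨w, hw, hwc⟩ := exists_blue_degree hRB (d := j - 1) (by omega) (by omega) (by omega)
    (fun h => hnoR (h.mono (Set.subset_univ (S : Set V))))
  obtain ⟨a, ha, b, hb, hab⟩ := Finset.one_lt_card.1
    (show 1 < (S.filter (B.Adj w)).card by omega)
  rw [Finset.mem_filter] at ha hb
  have hSF' : ∀ s ∈ S.erase w, ∀ f ∈ F.filter (B.Adj z), B.Adj s f :=
    fun s hs f hf => hSF s (Finset.mem_of_mem_erase hs) f (Finset.mem_filter.1 hf).1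
  have h1 := Finset.card_erase_of_mem hw
  obtain ⟨l, hl, hlen, hlm⟩ := exists_alternating_path_same hSF'
    (Finset.mem_erase.2 ⟨ha.2.ne.symm, ha.1⟩) (Finset.mem_erase.2 ⟨hb.2.ne.symm, hb.1⟩) hab
    (n := j) (by omega) (by omega) hzc
  refine ⟨z, hasCycleOn_of_two_paths hl (IsPathList.singleton B w) hb.2.symm ha.2 ?_
    (by simp; omega) (fun v hv => ?_) fun v hv => ?_⟩
  · intro v hv hv'
    obtain rfl := List.mem_singleton.1 hv'
    rcases hlm _ hv with h | h
    · exact Finset.notMem_erase _ _ h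
    · exact (hSF _ hw _ (Finset.mem_filter.1 h).1).ne rfl
  · rcases hlm v hv with h | h
    exacts [(hSF v (Finset.mem_of_mem_erase h) z hz).symm, (Finset.mem_filter.1 h).2]
  · obtain rfl := List.mem_singleton.1 hv
    exact (hSF _ hw z hz).symm

variable [Fintype V]

/-- A red graph of minimum degree at least `j` has a cycle of length at least `2k + 1`. Otherwise, on
a longest red path, each predecessor of a neighbour of the first vertex is the start of another
longest path, so it sends only blue edges to the vertices outside the first `2k` of the path. -/
theorem exists_long_cycle [DecidableRel R.Adj] (hRB : ∀ x y, x ≠ y → R.Adj x y ∨ B.Adj x y)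
    (hk : 1 ≤ k) (hkj : k < j) (hV : 4 * j + 1 ≤ Fintype.card V)
    (hdeg : ∀ v, j ≤ (Finset.univ.filter (R.Adj v)).card)
    (hnoW : ¬ ∃ h, HasCycleOn B (B.neighborSet h) (2 * j)) :
    ∃ t, 2 * k + 1 ≤ t ∧ HasCycleOn R Set.univ t := by
  classical
  by_contra! hcon
  obtain ⟨a, b, l, h⟩ := exists_isLongestPath (G := R) (F := (Finset.univ : Finset V))
    (Finset.card_pos.1 (by rw [Finset.card_univ]; omega))
  have hshort : ∀ {a b : V} {l : List V}, IsPathList R a b l → ∀ i (hi : i < l.length),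
      R.Adj a l[i] → i + 1 ≤ 2 * k := by
    intro a b l hl i hi hadj
    by_contra! hi'
    exact hcon _ hi' ((hl.hasCycleOn hi hadj).mono (Set.subset_univ _))
  set T := (Finset.range (l.length - 1)).filter fun i => R.Adj a (l.getD (i + 1) a) with hT
  have hTc : j ≤ T.card := (hdeg a).trans h.card_le
  have hTm : ∀ i ∈ T, ∃ hi : i + 1 < l.length, R.Adj a l[i + 1] := by
    intro i hi
    rw [hT, Finset.mem_filter, Finset.mem_range] at hi
    have hi' : i + 1 < l.length := by omega
    rw [List.getD_eq_getElem _ _ hi'] at hi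
    exact ⟨hi', hi.2⟩
  have hS : (T.image fun i => l.getD i a).card = T.card := by
    refine Finset.card_image_of_injOn fun p hp q hq hpq => ?_
    obtain ⟨hp, -⟩ := hTm p hp
    obtain ⟨hq, -⟩ := hTm q hq
    rw [List.getD_eq_getElem _ _ (by omega), List.getD_eq_getElem _ _ (by omega)] at hpq
    exact (h.path.nodup.getElem_inj_iff).1 hpq
  set H := (l.take (2 * k)).toFinset with hH
  have hHc : H.card ≤ 2 * k := (List.toFinset_card_le _).trans (by simp)
  have hHc' := Finset.card_add_card_compl H
  refine hnoW (exists_wheel_of_joined (S := T.image fun i => l.getD i a) (F := Hᶜ) (R := R) (k := k)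
    hRB ?_ hk hkj (by omega) (by omega) fun h => hcon _ le_rfl h)
  intro s hs w hw
  obtain ⟨i, hi, rfl⟩ := Finset.mem_image.1 hs
  obtain ⟨hil, hadj⟩ := hTm i hi
  rw [List.getD_eq_getElem _ _ (by omega)]
  have hi2 := hshort h.path _ hil hadj
  rw [Finset.mem_compl, hH, List.mem_toFinset] at hw
  refine (hRB _ w ?_).resolve_left fun hsw => hw ?_
  · rintro rfl
    exact hw (List.mem_take_iff_getElem.2 ⟨i, by omega, rfl⟩)
  have hrot := h.rotate hil hadj
  obtain ⟨p, hp, hpw⟩ := List.getElem_of_mem (hrot.mem_of_adj (Finset.mem_univ w) hsw)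
  have hp2 := hshort hrot.path p hp (by rwa [hpw])
  rcases Nat.lt_or_ge p (i + 1) with hpi | hpi
  · rw [List.getElem_append_left (by simp; omega)] at hpw
    have h1 : w ∈ l.take (i + 1) := by
      rw [← List.mem_reverse, ← hpw]
      exact List.getElem_mem _
    exact (List.take_sublist_take_left (by omega)).subset h1
  · rw [List.getElem_append_right (by simp; omega), List.getElem_drop] at hpw
    refine List.mem_take_iff_getElem.2 ⟨p, ?_, ?_⟩
    · simp at hp
      omega
    · rw [← hpw]
      congr 1
      simp
      omega

/-- After deletion of the at most one vertex in `C`, the set `P` is a union of red components. Hence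
all edges from `P` to the remaining vertices are blue. -/
theorem exists_wheel_of_separation [DecidableRel R.Adj]
    (hRB : ∀ x y, x ≠ y → R.Adj x y ∨ B.Adj x y)
    (hk : 2 ≤ k) (hkj : k < j) (hV : 4 * j + 1 ≤ Fintype.card V)
    (hdeg : ∀ v, j ≤ ((Finset.univ.filter (R.Adj v)).card))
    (hnoR : ¬ HasCycleOn R Set.univ (2 * k + 1)) {C P : Finset V} (hC : C.card ≤ 1)
    (hPC : ∀ x ∈ P, x ∉ C) (hP : ∀ x ∈ P, ∀ y, y ∉ C → R.Adj x y → y ∈ P) {u w : V} (hu : u ∈ P)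
    (hw : w ∉ P) (hwC : w ∉ C) : ∃ h, HasCycleOn B (B.neighborSet h) (2 * j) := by
  set Q := (P ∪ C)ᶜ with hQ
  have hQm : ∀ x, x ∈ Q ↔ x ∉ P ∧ x ∉ C := fun x => by simp [hQ]
  have hcard : P.card + C.card + Q.card = Fintype.card V := by
    rw [← Finset.card_union_of_disjoint (Finset.disjoint_left.2 hPC), Finset.card_add_card_compl]
  have hPQ : ∀ x ∈ P, ∀ y ∈ Q, B.Adj x y := by
    intro x hx y hy
    rw [hQm] at hy
    exact (hRB x y (by rintro rfl; exact hy.1 hx)).resolve_left fun h => hy.1 (hP x hx y hy.2 h)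
  -- Each side contains a vertex together with its red neighbours, up to the vertex of `C`.
  have hside : ∀ (W : Finset V) (x : V), x ∈ W → (∀ y, R.Adj x y → y ∈ W ∪ C) → j ≤ W.card := by
    intro W x hx hW
    have h1 : insert x (Finset.univ.filter (R.Adj x)) ⊆ W ∪ C := by
      intro y hy
      rcases Finset.mem_insert.1 hy with rfl | hy
      · exact Finset.mem_union_left _ hx
      · exact hW y (Finset.mem_filter.1 hy).2
    have h2 := Finset.card_le_card h1
    rw [Finset.card_insert_of_notMem (by simp)] at h2
    have h3 := Finset.card_union_le W C
    have h4 := hdeg x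
    omega
  have hPj := hside P u hu fun y hy => by
    by_cases hyC : y ∈ C
    · exact Finset.mem_union_right _ hyC
    · exact Finset.mem_union_left _ (hP u hu y hyC hy)
  have hQj := hside Q w ((hQm w).2 ⟨hw, hwC⟩) fun y hy => by
    by_cases hyC : y ∈ C
    · exact Finset.mem_union_right _ hyC
    · exact Finset.mem_union_left _ ((hQm y).2 ⟨fun h => hw (hP y h w hwC hy.symm), hyC⟩)
  rcases Nat.lt_or_ge (2 * j) Q.card with h | h
  · exact exists_wheel_of_joined hRB hPQ (by omega) hkj hPj h hnoR
  rcases Nat.lt_or_ge (2 * j) P.card with h' | h'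
  · exact exists_wheel_of_joined hRB (fun y hy x hx => (hPQ x hx y hy).symm) (by omega) hkj hQj h'
      hnoR
  · exact exists_wheel_of_joined_balanced hRB hPQ hk hkj (by omega) (by omega) hnoR

theorem isTwoConnected_of_no_wheel [DecidableRel R.Adj]
    (hRB : ∀ x y, x ≠ y → R.Adj x y ∨ B.Adj x y)
    (hk : 2 ≤ k) (hkj : k < j) (hV : 4 * j + 1 ≤ Fintype.card V)
    (hdeg : ∀ v, j ≤ ((Finset.univ.filter (R.Adj v)).card))
    (hnoR : ¬ HasCycleOn R Set.univ (2 * k + 1))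
    (hnoW : ¬ ∃ h, HasCycleOn B (B.neighborSet h) (2 * j)) : IsTwoConnected R := by
  classical
  refine ⟨by omega, ?_, fun v => ?_⟩
  · have : Nonempty V := Fintype.card_pos_iff.1 (by omega)
    refine ⟨fun u w => ?_⟩
    by_contra huw
    refine hnoW (exists_wheel_of_separation hRB hk hkj hV hdeg hnoR (C := ∅)
      (P := Finset.univ.filter (R.Reachable u)) (u := u) (w := w) (by simp) (by simp) ?_ (by simp)
      (by simpa using huw) (by simp))
    intro x hx y _ hxy
    rw [Finset.mem_filter] at hx ⊢
    exact ⟨Finset.mem_univ _, hx.2.trans hxy.reachable⟩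
  · have : Nonempty ({v}ᶜ : Set V) := by
      obtain ⟨w, hw⟩ := Fintype.exists_ne_of_one_lt_card (by omega) v
      exact ⟨⟨w, hw⟩⟩
    refine ⟨fun u w => ?_⟩
    by_contra huw
    refine hnoW (exists_wheel_of_separation hRB hk hkj hV hdeg hnoR (C := {v})
      (P := Finset.univ.filter fun x => ∃ hx : x ∈ ({v}ᶜ : Set V),
        (R.induce ({v}ᶜ : Set V)).Reachable u ⟨x, hx⟩) (u := u) (w := w) (by simp) ?_ ?_ ?_ ?_ ?_)
    · intro x hx
      obtain ⟨hx, -⟩ := (Finset.mem_filter.1 hx).2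
      simpa using hx
    · intro x hx y hy hxy
      obtain ⟨hx, hr⟩ := (Finset.mem_filter.1 hx).2
      refine Finset.mem_filter.2 ⟨Finset.mem_univ _, by simpa using hy, hr.trans ?_⟩
      exact SimpleGraph.Adj.reachable (G := R.induce ({v}ᶜ : Set V)) hxy
    · exact Finset.mem_filter.2 ⟨Finset.mem_univ _, u.2, .refl _⟩
    · intro h
      obtain ⟨_, hr⟩ := (Finset.mem_filter.1 h).2
      exact huw hr
    · exact fun h => w.2 (Finset.mem_singleton.1 h)

omit [DecidableEq V] in
/-- A class of a bipartition of the red graph is a blue clique. -/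
theorem not_isBipartite_of_no_wheel (hRB : ∀ x y, x ≠ y → R.Adj x y ∨ B.Adj x y) (hj : 1 ≤ j)
    (hV : 4 * j + 1 ≤ Fintype.card V)
    (hnoW : ¬ ∃ h, HasCycleOn B (B.neighborSet h) (2 * j)) : ¬ R.IsBipartite := by
  classical
  rintro ⟨c⟩
  have hclass : ∀ i, (Finset.univ.filter fun v => c v = i).card ≤ 2 * j := by
    intro i
    by_contra! hcon
    refine hnoW (exists_wheel_of_clique (X := Finset.univ.filter fun v => c v = i) (by omega) ?_ hcon)
    intro x hx y hy hxy
    simp only [Finset.coe_filter, Finset.mem_univ, true_and, Set.mem_ofPred_eq] at hx hy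
    exact (hRB x y hxy).resolve_left fun h => c.valid h (hx.trans hy.symm)
  have h1 := Finset.card_eq_sum_card_fiberwise (s := (Finset.univ : Finset V)) (t := Finset.univ)
    (f := c) fun _ _ => Finset.mem_coe.2 (Finset.mem_univ _)
  rw [Fin.sum_univ_two, Finset.card_univ] at h1
  have h2 := hclass 0
  have h3 := hclass 1
  omega

end SmallDegree

/-! ### A lower bound for admissible pairs -/

section RingOfBlocks

/-- Neighbourhoods of a cyclic arrangement of three blocks `K_5 - e` (on `{0, …, 4}`, `{5, …, 9}`
and `{9, …, 12, 0}`), where the ends of the missing edges are linked by the edge `4 5` or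
identified. -/
def ringNbrs : Fin 13 → List (Fin 13) :=
  ![[1, 2, 3, 10, 11, 12], [0, 2, 3, 4], [0, 1, 3, 4], [0, 1, 2, 4], [1, 2, 3, 5], [4, 6, 7, 8],
    [5, 7, 8, 9], [5, 6, 8, 9], [5, 6, 7, 9], [6, 7, 8, 10, 11, 12], [0, 9, 11, 12], [0, 9, 10, 12],
    [0, 9, 10, 11]]

/-- A 2-connected non-bipartite Hamiltonian graph on 13 vertices of minimum degree 4 that has no
cycle of length 6. -/
def ringGraph : SimpleGraph (Fin 13) where
  Adj a b := b ∈ ringNbrs a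
  symm := ⟨by decide⟩
  loopless := ⟨by decide⟩

instance : DecidableRel ringGraph.Adj := fun a b => inferInstanceAs (Decidable (b ∈ ringNbrs a))

theorem ringGraph_adj_succ : ∀ i, ringGraph.Adj i (i + 1) := by decide

theorem ringGraph_minDegree : ringGraph.minDegree = 4 := by decide

set_option synthInstance.maxSize 2000 in
set_option synthInstance.maxHeartbeats 200000 in
set_option maxRecDepth 100000 in
/-- No walk `a b c d e f` along six distinct vertices returns to its start. -/
theorem ringGraph_no_hexagon : ∀ a, ∀ b ∈ ringNbrs a, ∀ c ∈ ringNbrs b, a = c ∨ ∀ d ∈ ringNbrs c,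
    a = d ∨ b = d ∨ ∀ e ∈ ringNbrs d, a = e ∨ b = e ∨ c = e ∨ ∀ f ∈ ringNbrs e,
      b = f ∨ c = f ∨ d = f ∨ a ∉ ringNbrs f := by decide

end RingOfBlocks

section Circumference

/-- A graph with a cycle through all vertices is 2-connected. -/
theorem isTwoConnected_of_adj_succ {n : ℕ} [NeZero n] (hn : 2 < n) {G : SimpleGraph (ZMod n)}
    (hG : ∀ i, G.Adj i (i + 1)) : IsTwoConnected G := by
  refine ⟨by rwa [ZMod.card], ⟨fun x y => ?_⟩, fun v => ?_⟩
  · have h : ∀ i : ℕ, G.Reachable 0 (i : ZMod n) := by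
      intro i
      induction i with
      | zero => simp
      | succ i ih =>
        refine ih.trans ?_
        rw [Nat.cast_succ]
        exact (hG _).reachable
    rw [← ZMod.natCast_zmod_val x, ← ZMod.natCast_zmod_val y]
    exact (h _).symm.trans (h _)
  · -- The other vertices form the path `v + 1, v + 2, …, v + (n - 1)`.
    have hne : ∀ i : ℕ, i < n - 1 → v + ((i + 1 : ℕ) : ZMod n) ∈ ({v}ᶜ : Set (ZMod n)) := by
      intro i hi h
      rw [Set.mem_singleton_iff, add_eq_left, ZMod.natCast_eq_zero_iff] at h
      exact absurd (Nat.le_of_dvd (by omega) h) (by omega)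
    have h : ∀ (i : ℕ) (hi : i < n - 1), (G.induce ({v}ᶜ : Set (ZMod n))).Reachable
        ⟨_, hne 0 (by omega)⟩ ⟨_, hne i hi⟩ := by
      intro i hi
      induction i with
      | zero => rfl
      | succ i ih =>
        refine (ih (by omega)).trans (SimpleGraph.Adj.reachable ?_)
        have := hG (v + ((i + 1 : ℕ) : ZMod n))
        rwa [add_assoc, ← Nat.cast_succ] at this
    have hall : ∀ x : ({v}ᶜ : Set (ZMod n)), (G.induce ({v}ᶜ : Set (ZMod n))).Reachable
        ⟨_, hne 0 (by omega)⟩ x := by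
      rintro ⟨x, hx⟩
      have h0 : (x - v).val ≠ 0 := by
        rw [Ne, ZMod.val_eq_zero, sub_eq_zero]
        exact hx
      have hlt := ZMod.val_lt (x - v)
      have h1 := h ((x - v).val - 1) (by omega)
      have e : v + (((x - v).val - 1 + 1 : ℕ) : ZMod n) = x := by
        rw [Nat.sub_add_cancel (by omega), ZMod.natCast_zmod_val]
        abel
      simp only [e] at h1
      exact h1
    have : Nonempty ({v}ᶜ : Set (ZMod n)) := ⟨⟨_, hne 0 (by omega)⟩⟩
    exact ⟨fun x y => (hall x).symm.trans (hall y)⟩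

theorem le_circumference {V : Type*} [Fintype V] {G : SimpleGraph V} {t : ℕ} (ht : 3 ≤ t)
    (h : SimpleGraph.cycleGraph t ⊑ G) : t ≤ circumference G := by
  refine le_csSup ⟨Fintype.card V, ?_⟩ ⟨ht, h⟩
  rintro s ⟨-, ⟨f⟩⟩
  simpa using Fintype.card_le_of_injective f f.injective

theorem ringGraph_not_isBipartite : ¬ ringGraph.IsBipartite := by
  rintro ⟨c⟩
  have h1 : c 0 ≠ c 1 := c.valid (show ringGraph.Adj 0 1 by decide)
  have h2 : c 1 ≠ c 2 := c.valid (show ringGraph.Adj 1 2 by decide)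
  have h3 : c 0 ≠ c 2 := c.valid (show ringGraph.Adj 0 2 by decide)
  omega

theorem ringGraph_cycleGraph_free : ¬ SimpleGraph.cycleGraph 6 ⊑ ringGraph := by
  rintro ⟨f⟩
  have hadj : ∀ i : Fin 6, f (i + 1) ∈ ringNbrs (f i) := fun i =>
    f.toHom.map_adj (SimpleGraph.cycleGraph_adj.2 (Or.inr (by abel)))
  have hne : ∀ i j : Fin 6, i ≠ j → f i ≠ f j := fun i j h h' => h (f.injective h')
  have h1 := (ringGraph_no_hexagon (f 0) (f 1) (hadj 0) (f 2) (hadj 1)).resolve_left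
    (hne _ _ (by decide)) (f 3) (hadj 2)
  have h2 := ((h1.resolve_left (hne _ _ (by decide))).resolve_left (hne _ _ (by decide))) (f 4)
    (hadj 3)
  have h3 := (((h2.resolve_left (hne _ _ (by decide))).resolve_left
    (hne _ _ (by decide))).resolve_left (hne _ _ (by decide))) (f 5) (hadj 4)
  exact (((h3.resolve_left (hne _ _ (by decide))).resolve_left
    (hne _ _ (by decide))).resolve_left (hne _ _ (by decide))) (hadj 5)

/-- The graph `ringGraph` has a cycle of length 13 but none of length 6, so its minimum degree must
violate the bound of an admissible pair. -/
theorem IsAdmissiblePair.four_lt {α β : ℝ} (h : IsAdmissiblePair α β) : 4 < α * 13 + β := by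
  by_contra! hcon
  have h13 : (13 : ℕ) ≤ circumference ringGraph := le_circumference (by omega)
    (cycleGraph_isContained_of_zmod (n := 13) (fun i : Fin 13 => i) (fun _ _ h => h)
      ringGraph_adj_succ (by omega))
  refine ringGraph_cycleGraph_free (h.2.2.2 13 ringGraph
    (isTwoConnected_of_adj_succ (n := 13) (by omega) ringGraph_adj_succ) ringGraph_not_isBipartite ?_ 6 le_rfl
    (le_trans (by omega) h13))
  rw [ringGraph_minDegree]
  exact_mod_cast hcon

end Circumference

/-! ### The Ramsey bound -/

section Ramsey

/-- The colouring argument for a given number `N` of vertices; the last hypothesis says that a red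
degree of at least `N - 3j + 1` is at least `αN + β`. -/
theorem ramseyArrows_of_bounds {α β : ℝ} (h : IsAdmissiblePair α β) {k j N : ℕ} (hk : 2 < k)
    (hkj : k < j) (hN : 4 * j + 1 ≤ N) (hN' : 3 * (j : ℝ) + β ≤ (N + 1) * (1 - α)) :
    RamseyArrows N (SimpleGraph.cycleGraph (2 * k + 1)) (wheelGraph (2 * j)) := by
  classical
  intro R
  by_contra hcon
  obtain ⟨hcyc, hwheel⟩ := not_or.1 hcon
  have hRB : ∀ x y, x ≠ y → R.Adj x y ∨ Rᶜ.Adj x y := fun x y hxy => by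
    rw [SimpleGraph.compl_adj]
    tauto
  have hnoR : ¬ HasCycleOn R Set.univ (2 * k + 1) := fun h => hcyc (h.isContained (by omega))
  have hnoW : ¬ ∃ h, HasCycleOn Rᶜ (Rᶜ.neighborSet h) (2 * j) := fun ⟨_, h⟩ =>
    hwheel (wheelGraph_isContained (by omega) h)
  have hV : 4 * j + 1 ≤ Fintype.card (Fin N) := by simpa using hN
  have hdeg : ∀ v, N + 1 ≤ R.degree v + 3 * j := by
    intro v
    by_contra! hlt
    have h1 := R.degree_compl v
    rw [Fintype.card_fin] at h1
    have h2 := R.degree_lt_card_verts v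
    rw [Fintype.card_fin] at h2
    refine hnoW (exists_wheel_of_large_degree hRB hk hkj hV (v := v) (A := Rᶜ.neighborFinset v)
      (fun a ha => (Rᶜ.mem_neighborFinset v a).1 ha) ?_ hnoR)
    rw [SimpleGraph.card_neighborFinset_eq_degree]
    omega
  have hdeg' : ∀ v, j ≤ (Finset.univ.filter (R.Adj v)).card := by
    intro v
    have h1 := hdeg v
    have h2 : (Finset.univ.filter (R.Adj v)).card = R.degree v := by
      rw [← SimpleGraph.card_neighborFinset_eq_degree]
      congr 1
      ext
      simp
    omega
  have h2 := isTwoConnected_of_no_wheel hRB (by omega) hkj hV hdeg' hnoR hnoW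
  have hnb := not_isBipartite_of_no_wheel hRB (by omega) hV hnoW
  obtain ⟨t, ht, hRt⟩ := exists_long_cycle hRB (by omega) hkj hV hdeg' hnoW
  have : Nonempty (Fin N) := ⟨⟨0, by omega⟩⟩
  have hmin : N + 1 ≤ R.minDegree + 3 * j := by
    obtain ⟨v, hv⟩ := R.exists_minimal_degree_vertex
    rw [hv]
    exact hdeg v
  have hmin' : (N : ℝ) + 1 ≤ R.minDegree + 3 * j := by exact_mod_cast hmin
  refine hcyc (h.2.2.2 N R h2 hnb ?_ (2 * k + 1) (by omega)
    (ht.trans (le_circumference (by omega) (hRt.isContained (by omega)))))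
  have h1 := h.1
  nlinarith

end Ramsey

theorem theorem3 (α β : ℝ) (hαβ : IsAdmissiblePair α β) (k j : ℕ) (hk : 2 < k) (hkj : k < j) :
    (∃ N : ℕ, RamseyArrows N (SimpleGraph.cycleGraph (2 * k + 1)) (wheelGraph (2 * j))) ∧
      (ramseyNumber (SimpleGraph.cycleGraph (2 * k + 1)) (wheelGraph (2 * j)) : ℝ) ≤
        (3 * (j : ℝ) + β) / (1 - α) := by
  have hα := hαβ.1
  have hα' := hαβ.2.1
  have hβ := hαβ.2.2.1
  have h13 := hαβ.four_lt
  have hpos : 0 < 1 - α := by linarith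
  have hj : (4 : ℝ) ≤ j := by exact_mod_cast (show 4 ≤ j by omega)
  have hx : 0 ≤ (3 * (j : ℝ) + β) / (1 - α) := by positivity
  set N := ⌊(3 * (j : ℝ) + β) / (1 - α)⌋₊ with hN
  have hN4 : 4 * j + 1 ≤ N := by
    refine Nat.le_floor ?_
    rw [le_div_iff₀ hpos]
    push_cast
    -- The difference of the two sides exceeds `(j - 3) * (4 * α - 1)`.
    nlinarith [mul_nonneg (show (0 : ℝ) ≤ j - 3 by linarith) (show 0 ≤ 4 * α - 1 by linarith)]
  have hN' : 3 * (j : ℝ) + β ≤ (N + 1) * (1 - α) := by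
    rw [← div_le_iff₀ hpos]
    exact (Nat.lt_floor_add_one _).le
  have harrow := ramseyArrows_of_bounds hαβ hk hkj hN4 hN'
  refine ⟨⟨N, harrow⟩, le_trans ?_ (Nat.floor_le hx)⟩
  exact Nat.cast_le.2 (Nat.sInf_le harrow)
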